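/- Let $d$ be a dimension and let $s,t>0$ satisfy $s+t>1$. Let $\Sigma_t^s(\mathbf R^d)$ be the Beurling type Gelfand--Shilov space of all $f\in C^\infty(\mathbf R^d)$ such that, for every $h>0$, $$\|f\|_{t,s,h}=\sup_{\alpha,\beta\in\mathbf N^d,\;x\in\mathbf R^d}\frac{|x^\alpha D^\beta f(x)|}{h^{|\alpha+\beta|}\,\alpha!^t\,\beta!^s}<\infty ,$$ and let $(\Sigma_t^s)'(\mathbf R^d)$ be its topological dual, written as the space of continuous conjugate linear functionals $\varphi\mapsto(u,\varphi)$ (consistently with the $L^2$ inner product). For $\psi\in\Sigma_t^s(\mathbf R^d)\setminus 0$ and $u\in(\Sigma_t^s)'(\mathbf R^d)$ let $$V_\psi u(x,\xi)=(2\pi)^{-d/2}(u,M_\xi T_x\psi),\qquad M_\xi T_x\psi(y)=e^{i\langle y,\xi\rangle}\psi(y-x),$$ and let $\mathrm{WF}^{t,s}(u)\subseteq T^*\mathbf R^d\setminus 0$ be defined by: $(x_0,\xi_0)\in T^*\mathbf R^d\setminus 0$ satisfies $(x_0,\xi_0)\notin\mathrm{WF}^{t,s}(u)$ if and only if there is an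 open set $U\subseteq T^*\mathbf R^d\setminus 0$ containing $(x_0,\xi_0)$ such that $$\sup_{\lambda>0,\;(x,\xi)\in U}e^{r\lambda}\,|V_\psi u(\lambda^t x,\lambda^s\xi)|<\infty\qquad\text{for all } r>0 .$$ The identities below hold for every choice of the nonzero windows $\psi$ used to define the two wave front sets involved (each in the test function space belonging to its ultradistribution). Let $u\in(\Sigma_t^s)'(\mathbf R^d)$. (i) Let $\widehat f(\xi)=(2\pi)^{-d/2}\int f(x)e^{-i\langle x,\xi\rangle}\,dx$. The Fourier transform maps $\Sigma_t^s(\mathbf R^d)$ into $\Sigma_s^t(\mathbf R^d)$, there is a unique $\widehat u\in(\Sigma_s^t)'(\mathbf R^d)$ such that $(\widehat u,\widehat\varphi)=(u,\varphi)$ for all $\varphi\in\Sigma_t^s(\mathbf R^d)$, and $$\mathrm{WF}^{s,t}(\widehat u)=\mathcal J\,\mathrm{WF}^{t,s}(u),\qquad \mathcal J(x,\xi)=(\xi,-x).$$ (ii) Let $A\in\mathrm{GL}(d,\mathbf R)$ and $u_A(x)=|A|^{1/2}u(Ax)$. Here $|A|=\det A$, and $|A|^{1/2}$ may be any complex number of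 modulus $|\det A|^{1/2}$ (for instance a square root of $\det A$). That is, $u_A\in(\Sigma_t^s)'(\mathbf R^d)$ is the well-defined, unique element with $(u_A,\varphi)=|A|^{1/2}\,|\det A|^{-1}\,(u,\varphi(A^{-1}\,\cdot\,))$ for all $\varphi\in\Sigma_t^s(\mathbf R^d)$. Then $$\mathrm{WF}^{t,s}(u_A)=\begin{pmatrix}A^{-1}&0\\0&A^T\end{pmatrix}\mathrm{WF}^{t,s}(u).$$ -/

import Mathlib

open scoped ContDiff ENNReal NNReal

noncomputable section

namespace GelfandShilov

/-- The configuration space `ℝᵈ` with its Euclidean structure. -/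
abbrev E (d : ℕ) : Type := EuclideanSpace ℝ (Fin d)

/-! ### Multi-indices -/

/-- The length `|α| = α₁ + ⋯ + α_d` of a multi-index. -/
def mlen {d : ℕ} (α : Fin d → ℕ) : ℕ := ∑ i, α i

/-- The factorial `α! = α₁! ⋯ α_d!` of a multi-index. -/
def mfact {d : ℕ} (α : Fin d → ℕ) : ℕ := ∏ i, (α i).factorial

/-- The monomial `x ^ α = x₁ ^ α₁ ⋯ x_d ^ α_d`. -/
def mpow {d : ℕ} (α : Fin d → ℕ) (x : E d) : ℝ := ∏ i, x i ^ α i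

/-- The partial derivative `∂ᵢ f`. -/
def pderiv {d : ℕ} (i : Fin d) (f : E d → ℂ) : E d → ℂ :=
  fun x => fderiv ℝ f x (EuclideanSpace.single i 1)

/-- The derivative `∂₁ ^ β₁ ⋯ ∂_d ^ β_d f`. It has the same modulus as `D ^ β f`, where
`D_j = -i ∂_j`. -/
def mderiv {d : ℕ} (β : Fin d → ℕ) (f : E d → ℂ) : E d → ℂ :=
  (List.finRange d).foldr (fun i g => (pderiv i)^[β i] g) f

/-! ### Gelfand--Shilov spaces of Beurling type and their duals -/

/-- The norm `sup |x ^ α D ^ β f(x)| / (h ^ |α + β| α! ^ t β! ^ s)`, the supremum being over all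
`α, β ∈ ℕᵈ` and `x ∈ ℝᵈ`, as an element of `[0, ∞]`. -/
def gsNorm {d : ℕ} (t s h : ℝ) (f : E d → ℂ) : ℝ≥0∞ :=
  ⨆ (α : Fin d → ℕ) (β : Fin d → ℕ) (x : E d),
    ENNReal.ofReal (‖(mpow α x : ℂ) * mderiv β f x‖ /
      (h ^ mlen (α + β) * (mfact α : ℝ) ^ t * (mfact β : ℝ) ^ s))

/-- Membership in the space `Σ_t^s(ℝᵈ)`: smoothness and finiteness of all the norms. -/
def IsGelfandShilov {d : ℕ} (t s : ℝ) (f : E d → ℂ) : Prop :=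
  ContDiff ℝ ∞ f ∧ ∀ h : ℝ, 0 < h → gsNorm t s h f < ⊤

section Aux

variable {d : ℕ}

/-- The space of smooth functions, used only to prove closure properties. -/
def Sm (d : ℕ) : Submodule ℂ (E d → ℂ) where
  carrier := {f | ContDiff ℝ ∞ f}
  add_mem' := fun {f g} (hf : ContDiff ℝ ∞ f) (hg : ContDiff ℝ ∞ g) => hf.add hg
  zero_mem' := (contDiff_const : ContDiff ℝ ∞ fun _ : E d => (0 : ℂ))
  smul_mem' := fun c f (hf : ContDiff ℝ ∞ f) => (contDiff_const.smul hf : ContDiff ℝ ∞ (c • f))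

/-- The partial derivative as an endomorphism of the smooth functions. -/
def pd (i : Fin d) : Module.End ℂ (Sm d) where
  toFun f := ⟨pderiv i f.1, by
    have hf : ContDiff ℝ ∞ f.1 := f.2
    exact (hf.fderiv_right (m := ∞) (by simp)).clm_apply contDiff_const⟩
  map_add' f g := by
    ext x
    have hf : ContDiff ℝ ∞ f.1 := f.2
    have hg : ContDiff ℝ ∞ g.1 := g.2
    change fderiv ℝ (f.1 + g.1) x _ = fderiv ℝ f.1 x _ + fderiv ℝ g.1 x _
    rw [fderiv_add (hf.differentiable (by simp) x) (hg.differentiable (by simp) x)]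
    rfl
  map_smul' c f := by
    ext x
    have hf : ContDiff ℝ ∞ f.1 := f.2
    change fderiv ℝ (c • f.1) x _ = c • fderiv ℝ f.1 x _
    rw [fderiv_const_smul (hf.differentiable (by simp) x)]
    rfl

lemma pd_coe (i : Fin d) (f : Sm d) : (pd i f : E d → ℂ) = pderiv i f.1 := rfl

lemma pd_pow_coe (i : Fin d) (n : ℕ) (f : Sm d) :
    (((pd i) ^ n) f : E d → ℂ) = (pderiv i)^[n] f.1 := by
  induction n generalizing f with
  | zero => rfl
  | succ n ih => rw [pow_succ, Module.End.mul_apply, ih, pd_coe, Function.iterate_succ_apply]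

/-- The differential operator `∂ ^ β` as an endomorphism of the smooth functions. -/
def md (β : Fin d → ℕ) : Module.End ℂ (Sm d) := ((List.finRange d).map fun i => pd i ^ β i).prod

lemma md_coe (β : Fin d → ℕ) (f : Sm d) : (md β f : E d → ℂ) = mderiv β f.1 := by
  unfold md mderiv
  induction List.finRange d with
  | nil => rfl
  | cons i l ih =>
    rw [List.map_cons, List.prod_cons, Module.End.mul_apply, pd_pow_coe, ih, List.foldr_cons]

lemma mfact_pos (α : Fin d → ℕ) : 0 < (mfact α : ℝ) := by
  have : 0 < mfact α := Finset.prod_pos fun i _ => Nat.factorial_pos _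
  exact_mod_cast this

/-- The denominators in the norms. -/
def wt (t s h : ℝ) (α β : Fin d → ℕ) : ℝ :=
  h ^ mlen (α + β) * (mfact α : ℝ) ^ t * (mfact β : ℝ) ^ s

lemma wt_pos {t s h : ℝ} (hh : 0 < h) (α β : Fin d → ℕ) : 0 < wt t s h α β := by
  have := mfact_pos α
  have := mfact_pos β
  unfold wt
  positivity

lemma gsNorm_lt_top_iff {t s h : ℝ} (hh : 0 < h) (f : E d → ℂ) :
    gsNorm t s h f < ⊤ ↔ ∃ B : ℝ, 0 ≤ B ∧ ∀ α β x,
      ‖(mpow α x : ℂ) * mderiv β f x‖ ≤ B * wt t s h α β := by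
  constructor
  · intro H
    refine ⟨(gsNorm t s h f).toReal, ENNReal.toReal_nonneg, fun α β x => ?_⟩
    rw [← div_le_iff₀ (wt_pos hh α β)]
    rw [← ENNReal.ofReal_le_iff_le_toReal H.ne]
    unfold gsNorm
    exact le_iSup_of_le α (le_iSup_of_le β (le_iSup_of_le x le_rfl))
  · rintro ⟨B, hB, H⟩
    refine lt_of_le_of_lt ?_ (ENNReal.ofReal_lt_top (r := B))
    refine iSup_le fun α => iSup_le fun β => iSup_le fun x => ?_
    refine ENNReal.ofReal_le_ofReal ?_
    exact (div_le_iff₀ (wt_pos hh α β)).2 (H α β x)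

lemma isGelfandShilov_iff {t s : ℝ} (f : E d → ℂ) :
    IsGelfandShilov t s f ↔ ∃ hf : f ∈ Sm d, ∀ h : ℝ, 0 < h → ∃ B : ℝ, 0 ≤ B ∧ ∀ α β x,
      ‖(mpow α x : ℂ) * (md β ⟨f, hf⟩ : Sm d).1 x‖ ≤ B * wt t s h α β := by
  constructor
  · rintro ⟨h1, h2⟩
    refine ⟨h1, fun h hh => ?_⟩
    simp only [md_coe]
    exact (gsNorm_lt_top_iff hh f).1 (h2 h hh)
  · rintro ⟨h1, h2⟩
    refine ⟨h1, fun h hh => ?_⟩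
    simp only [md_coe] at h2
    exact (gsNorm_lt_top_iff hh f).2 (h2 h hh)

lemma isGelfandShilov_zero (t s : ℝ) : IsGelfandShilov t s (0 : E d → ℂ) := by
  rw [isGelfandShilov_iff]
  refine ⟨zero_mem _, fun h hh => ⟨0, le_rfl, fun α β x => ?_⟩⟩
  have : (⟨0, zero_mem _⟩ : Sm d) = 0 := rfl
  rw [this, map_zero]
  simp

lemma IsGelfandShilov.add {t s : ℝ} {f g : E d → ℂ} (hf : IsGelfandShilov t s f)
    (hg : IsGelfandShilov t s g) : IsGelfandShilov t s (f + g) := by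
  rw [isGelfandShilov_iff] at *
  obtain ⟨f1, f2⟩ := hf
  obtain ⟨g1, g2⟩ := hg
  refine ⟨add_mem f1 g1, fun h hh => ?_⟩
  obtain ⟨B, hB, HB⟩ := f2 h hh
  obtain ⟨C, hC, HC⟩ := g2 h hh
  refine ⟨B + C, by positivity, fun α β x => ?_⟩
  have : (⟨f + g, add_mem f1 g1⟩ : Sm d) = ⟨f, f1⟩ + ⟨g, g1⟩ := rfl
  rw [this, map_add, add_mul]
  refine le_trans ?_ (add_le_add (HB α β x) (HC α β x))
  rw [Submodule.coe_add, Pi.add_apply, mul_add]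
  exact norm_add_le _ _

lemma IsGelfandShilov.smul {t s : ℝ} {f : E d → ℂ} (c : ℂ) (hf : IsGelfandShilov t s f) :
    IsGelfandShilov t s (c • f) := by
  rw [isGelfandShilov_iff] at *
  obtain ⟨f1, f2⟩ := hf
  refine ⟨Submodule.smul_mem _ c f1, fun h hh => ?_⟩
  obtain ⟨B, hB, HB⟩ := f2 h hh
  refine ⟨‖c‖ * B, by positivity, fun α β x => ?_⟩
  have : (⟨c • f, Submodule.smul_mem _ c f1⟩ : Sm d) = c • ⟨f, f1⟩ := rfl
  rw [this, map_smul, mul_assoc]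
  refine le_trans (le_of_eq ?_) (mul_le_mul_of_nonneg_left (HB α β x) (norm_nonneg c))
  rw [Submodule.coe_smul, Pi.smul_apply, smul_eq_mul, mul_left_comm, norm_mul]

/-! Bounds for the sums that arise from the binomial formula. -/

lemma mlen_update (β : Fin d → ℕ) (i : Fin d) {j : ℕ} (hj : j ≤ β i) :
    mlen (Function.update β i j) + (β i - j) = mlen β := by
  unfold mlen
  rw [← Finset.add_sum_erase _ _ (Finset.mem_univ i), ← Finset.add_sum_erase _ _ (Finset.mem_univ i)]
  have : ∑ x ∈ Finset.univ.erase i, Function.update β i j x = ∑ x ∈ Finset.univ.erase i, β x :=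
    Finset.sum_congr rfl fun k hk => by rw [Function.update_of_ne (Finset.ne_of_mem_erase hk)]
  rw [this, Function.update_self]
  omega

lemma mfact_update (β : Fin d → ℕ) (i : Fin d) {j : ℕ} (hj : j ≤ β i) :
    mfact (Function.update β i j) * (β i - j).factorial ≤ mfact β := by
  unfold mfact
  rw [← Finset.mul_prod_erase _ _ (Finset.mem_univ i),
    ← Finset.mul_prod_erase _ (fun i => (β i).factorial) (Finset.mem_univ i)]
  have : ∏ x ∈ Finset.univ.erase i, (Function.update β i j x).factorial
      = ∏ x ∈ Finset.univ.erase i, (β x).factorial :=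
    Finset.prod_congr rfl fun k hk => by rw [Function.update_of_ne (Finset.ne_of_mem_erase hk)]
  rw [this, Function.update_self, mul_right_comm]
  refine Nat.mul_le_mul_right _ ?_
  exact Nat.le_of_dvd (Nat.factorial_pos _) (Nat.factorial_mul_factorial_dvd_factorial hj)

lemma pow_le_factorial_rpow {s h : ℝ} (hs : 0 < s) (hh : 0 < h) {a : ℝ} (ha : 0 ≤ a) :
    ∃ K : ℝ, 0 ≤ K ∧ ∀ m : ℕ, a ^ m ≤ K * h ^ m * (m.factorial : ℝ) ^ s := by
  refine ⟨(Real.exp ((a / h) ^ (1 / s))) ^ s, by positivity, fun m => ?_⟩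
  have h1 := Real.pow_div_factorial_le_exp (x := (a / h) ^ (1 / s)) (by positivity) m
  have hm : (0 : ℝ) < m.factorial := by exact_mod_cast Nat.factorial_pos m
  rw [div_le_iff₀ hm] at h1
  have h2 := Real.rpow_le_rpow (by positivity) h1 hs.le
  rw [Real.mul_rpow (by positivity) hm.le, ← Real.rpow_natCast, ← Real.rpow_mul (by positivity),
    ← Real.rpow_mul (by positivity)] at h2
  have e : 1 / s * (m * s) = (m : ℝ) := by field_simp
  rw [e, Real.rpow_natCast, div_pow, div_le_iff₀ (by positivity)] at h2
  linarith

lemma sum_bound {s h : ℝ} (hs : 0 < s) (hh : 0 < h) {a : ℝ} (ha : 0 ≤ a) :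
    ∃ K : ℝ, 0 ≤ K ∧ ∀ (β : Fin d → ℕ) (i : Fin d),
      ∑ j ∈ Finset.range (β i + 1), a ^ (β i - j) * (β i).choose j *
        ((h / 2) ^ mlen (Function.update β i j) * (mfact (Function.update β i j) : ℝ) ^ s)
        ≤ K * (h ^ mlen β * (mfact β : ℝ) ^ s) := by
  obtain ⟨K, hK, H⟩ := pow_le_factorial_rpow hs (half_pos hh) ha
  refine ⟨K, hK, fun β i => ?_⟩
  have key : ∀ j ∈ Finset.range (β i + 1), a ^ (β i - j) * (β i).choose j *
        ((h / 2) ^ mlen (Function.update β i j) * (mfact (Function.update β i j) : ℝ) ^ s)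
        ≤ (β i).choose j * (K * ((h / 2) ^ mlen β * (mfact β : ℝ) ^ s)) := by
    intro j hj
    have hj' : j ≤ β i := Nat.lt_succ_iff.1 (Finset.mem_range.1 hj)
    have h1 : (mfact (Function.update β i j) : ℝ) ^ s * ((β i - j).factorial : ℝ) ^ s
        ≤ (mfact β : ℝ) ^ s := by
      rw [← Real.mul_rpow (by positivity) (by positivity)]
      refine Real.rpow_le_rpow (by positivity) ?_ hs.le
      exact_mod_cast mfact_update β i hj'
    have h2 := mlen_update β i hj'
    have h3 := H (β i - j)
    calc _ ≤ (K * (h / 2) ^ (β i - j) * ((β i - j).factorial : ℝ) ^ s) * (β i).choose j *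
        ((h / 2) ^ mlen (Function.update β i j) * (mfact (Function.update β i j) : ℝ) ^ s) := by
          gcongr
      _ = (β i).choose j * (K * ((h / 2) ^ (mlen (Function.update β i j) + (β i - j)) *
          ((mfact (Function.update β i j) : ℝ) ^ s * ((β i - j).factorial : ℝ) ^ s))) := by
          rw [pow_add]; ring
      _ ≤ _ := by rw [h2]; gcongr
  refine (Finset.sum_le_sum key).trans ?_
  rw [← Finset.sum_mul]
  have h4 : ∑ j ∈ Finset.range (β i + 1), ((β i).choose j : ℝ) = 2 ^ β i := by
    exact_mod_cast Nat.sum_range_choose (β i)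
  have h5 : (2 : ℝ) ^ β i ≤ 2 ^ mlen β := by
    refine pow_le_pow_right₀ (by norm_num) ?_
    exact Finset.single_le_sum (f := β) (fun _ _ => Nat.zero_le _) (Finset.mem_univ i)
  rw [h4]
  calc (2 : ℝ) ^ β i * (K * ((h / 2) ^ mlen β * (mfact β : ℝ) ^ s))
      ≤ 2 ^ mlen β * (K * ((h / 2) ^ mlen β * (mfact β : ℝ) ^ s)) := by gcongr
    _ = _ := by rw [div_pow]; field_simp

lemma wt_eq (t s h : ℝ) (α β : Fin d → ℕ) :
    wt t s h α β = (h ^ mlen α * (mfact α : ℝ) ^ t) * (h ^ mlen β * (mfact β : ℝ) ^ s) := by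
  have : mlen (α + β) = mlen α + mlen β := by simp [mlen, Finset.sum_add_distrib]
  rw [wt, this, pow_add]; ring

/-! Translation in one coordinate. -/

/-- Translation as an endomorphism of the smooth functions. -/
def tr (v : E d) : Module.End ℂ (Sm d) where
  toFun f := ⟨fun y => f.1 (y - v), by
    have hf : ContDiff ℝ ∞ f.1 := f.2
    exact hf.comp (contDiff_id.sub contDiff_const)⟩
  map_add' _ _ := rfl
  map_smul' _ _ := rfl

lemma pd_tr (i : Fin d) (v : E d) : pd i * tr v = tr v * pd i := by
  ext f x
  change fderiv ℝ (fun y => f.1 (y - v)) x _ = fderiv ℝ f.1 (x - v) _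
  rw [fderiv_comp_sub]

lemma md_tr (β : Fin d → ℕ) (v : E d) : md β * tr v = tr v * md β := by
  have h : ∀ l : List (Fin d), Commute ((l.map fun i => pd i ^ β i).prod) (tr v) := by
    intro l
    induction l with
    | nil => exact Commute.one_left _
    | cons i l ih =>
      rw [List.map_cons, List.prod_cons]
      exact ((show Commute (pd i) (tr v) from pd_tr i v).pow_left _).mul_left ih
  exact h _

lemma mpow_add_single (α : Fin d → ℕ) (i : Fin d) (a : ℝ) (x : E d) :
    mpow α (x + EuclideanSpace.single i a) = ∑ j ∈ Finset.range (α i + 1),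
      a ^ (α i - j) * (α i).choose j * mpow (Function.update α i j) x := by
  have h1 : ∀ (γ : Fin d → ℕ) (y : E d), mpow γ y =
      y i ^ γ i * ∏ k ∈ Finset.univ.erase i, y k ^ γ k := fun γ y =>
    (Finset.mul_prod_erase _ (fun k => y k ^ γ k) (Finset.mem_univ i)).symm
  rw [h1]
  have h2 : ∏ k ∈ Finset.univ.erase i, (x + EuclideanSpace.single i a) k ^ α k
      = ∏ k ∈ Finset.univ.erase i, x k ^ α k := by
    refine Finset.prod_congr rfl fun k hk => ?_
    have := Finset.ne_of_mem_erase hk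
    simp [this]
  have h3 : ∀ j, ∏ k ∈ Finset.univ.erase i, x k ^ (Function.update α i j) k
      = ∏ k ∈ Finset.univ.erase i, x k ^ α k := fun j => by
    refine Finset.prod_congr rfl fun k hk => ?_
    rw [Function.update_of_ne (Finset.ne_of_mem_erase hk)]
  simp only [h1 (Function.update _ _ _), h3, Function.update_self, h2]
  have : (x + EuclideanSpace.single i a) i = x i + a := by simp
  rw [this, add_pow, Finset.sum_mul]
  exact Finset.sum_congr rfl fun j _ => by ring

lemma IsGelfandShilov.translate_single {t s : ℝ} (ht : 0 < t) {f : E d → ℂ}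
    (hf : IsGelfandShilov t s f) (i : Fin d) (a : ℝ) :
    IsGelfandShilov t s (fun y => f (y - EuclideanSpace.single i a)) := by
  rw [isGelfandShilov_iff] at *
  obtain ⟨f1, f2⟩ := hf
  refine ⟨(tr (EuclideanSpace.single i a) ⟨f, f1⟩).2, fun h hh => ?_⟩
  obtain ⟨B, hB, HB⟩ := f2 (h / 2) (half_pos hh)
  obtain ⟨K, hK, HK⟩ := sum_bound (d := d) ht hh (abs_nonneg a)
  refine ⟨K * B, by positivity, fun α β x => ?_⟩
  change ‖(mpow α x : ℂ) * ((md β * tr (EuclideanSpace.single i a)) ⟨f, f1⟩ : Sm d).1 x‖ ≤ _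
  rw [md_tr]
  change ‖(mpow α x : ℂ) * (md β ⟨f, f1⟩ : Sm d).1 (x - EuclideanSpace.single i a)‖ ≤ _
  set z := x - EuclideanSpace.single i a with hz
  set G := (md β ⟨f, f1⟩ : Sm d).1 z with hG
  have hx : x = z + EuclideanSpace.single i a := by rw [hz]; abel
  rw [hx, mpow_add_single, Complex.ofReal_sum, Finset.sum_mul]
  calc _ ≤ ∑ j ∈ Finset.range (α i + 1),
        ‖((|a| ^ (α i - j) * (α i).choose j : ℝ))‖ * ‖(mpow (Function.update α i j) z : ℂ) * G‖ := by
        refine (norm_sum_le _ _).trans (le_of_eq (Finset.sum_congr rfl fun j _ => ?_))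
        push_cast
        simp only [norm_mul, norm_pow, Complex.norm_real, Real.norm_eq_abs, abs_abs]
        simp [mul_assoc]
    _ ≤ ∑ j ∈ Finset.range (α i + 1), (|a| ^ (α i - j) * (α i).choose j) *
          (B * wt t s (h / 2) (Function.update α i j) β) := by
        refine Finset.sum_le_sum fun j _ => ?_
        rw [Real.norm_of_nonneg (by positivity)]
        exact mul_le_mul_of_nonneg_left (HB _ β z) (by positivity)
    _ = (∑ j ∈ Finset.range (α i + 1), |a| ^ (α i - j) * (α i).choose j *
          ((h / 2) ^ mlen (Function.update α i j) * (mfact (Function.update α i j) : ℝ) ^ t)) *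
          (B * ((h / 2) ^ mlen β * (mfact β : ℝ) ^ s)) := by
        rw [Finset.sum_mul]
        refine Finset.sum_congr rfl fun j _ => ?_
        rw [wt_eq]; ring
    _ ≤ (K * (h ^ mlen α * (mfact α : ℝ) ^ t)) * (B * (h ^ mlen β * (mfact β : ℝ) ^ s)) := by
        have := mfact_pos β
        refine mul_le_mul (HK α i) ?_ (by positivity) (by positivity)
        gcongr
        linarith
    _ = _ := by rw [wt_eq]; ring

/-! Modulation in one coordinate. -/

/-- Modulation in one coordinate as an endomorphism of the smooth functions. -/
def mo (i : Fin d) (a : ℝ) : Module.End ℂ (Sm d) where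
  toFun f := ⟨fun y => Complex.exp (Complex.I * (y i * a : ℝ)) * f.1 y, by
    have hf : ContDiff ℝ ∞ f.1 := f.2
    refine ContDiff.mul ?_ hf
    refine ContDiff.cexp (contDiff_const.mul (Complex.ofRealCLM.contDiff.comp ?_))
    exact (EuclideanSpace.proj (𝕜 := ℝ) i).contDiff.mul contDiff_const⟩
  map_add' _ _ := by ext x; exact mul_add _ _ _
  map_smul' _ _ := by ext x; exact mul_left_comm _ _ _

lemma pd_mo (k i : Fin d) (a : ℝ) :
    pd k * mo i a = mo i a * (pd k + algebraMap ℂ _ (if k = i then Complex.I * a else 0)) := by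
  ext f x
  have hf : ContDiff ℝ ∞ f.1 := f.2
  have h0 : HasFDerivAt f.1 (fderiv ℝ f.1 x) x := (hf.differentiable (by simp) x).hasFDerivAt
  have h1 : HasFDerivAt (fun y : E d => (Complex.I * (y i * a : ℝ) : ℂ))
      (Complex.I • Complex.ofRealCLM.comp (a • (EuclideanSpace.proj (𝕜 := ℝ) i))) x := by
    have h2 : HasFDerivAt (fun y : E d => y i * a) (a • (EuclideanSpace.proj (𝕜 := ℝ) i)) x :=
      (EuclideanSpace.proj (𝕜 := ℝ) i).hasFDerivAt.mul_const a
    exact (Complex.ofRealCLM.hasFDerivAt.comp x h2).const_mul Complex.I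
  have h3 := (h1.cexp.mul h0).fderiv
  change fderiv ℝ (fun y => Complex.exp (Complex.I * (y i * a : ℝ)) * f.1 y) x _ =
    Complex.exp (Complex.I * (x i * a : ℝ)) * (fderiv ℝ f.1 x _ +
      (if k = i then Complex.I * a else 0) * f.1 x)
  change fderiv ℝ (fun y => Complex.exp (Complex.I * (y i * a : ℝ)) * f.1 y) x = _ at h3
  rw [h3]
  by_cases hk : k = i
  · subst hk
    simp
    ring
  · simp [hk, Ne.symm hk]

lemma md_mo (β : Fin d → ℕ) (i : Fin d) (a : ℝ) :
    md β * mo i a = mo i a * ∑ j ∈ Finset.range (β i + 1),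
      ((Complex.I * a) ^ (β i - j) * (β i).choose j : ℂ) • md (Function.update β i j) := by
  have h1 : ∀ (k : Fin d) (n : ℕ), pd k ^ n * mo i a =
      mo i a * (pd k + algebraMap ℂ _ (if k = i then Complex.I * a else 0)) ^ n := by
    intro k n
    induction n with
    | zero => simp
    | succ n ih => rw [pow_succ, mul_assoc, pd_mo, ← mul_assoc, ih, mul_assoc, ← pow_succ]
  have h2 : ∀ l : List (Fin d), (l.map fun k => pd k ^ β k).prod * mo i a = mo i a *
      (l.map fun k => (pd k + algebraMap ℂ (Module.End ℂ (Sm d))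
        (if k = i then Complex.I * a else 0)) ^ β k).prod := by
    intro l
    induction l with
    | nil => simp
    | cons k l ih =>
      simp only [List.map_cons, List.prod_cons]
      rw [mul_assoc, ih, ← mul_assoc, h1, mul_assoc]
  unfold md
  rw [h2]
  congr 1
  obtain ⟨l₁, l₂, hl⟩ := List.append_of_mem (List.mem_finRange i)
  have hnd : (l₁ ++ i :: l₂).Nodup := hl ▸ List.nodup_finRange d
  have hne : ∀ k ∈ l₁ ++ l₂, k ≠ i := by
    intro k hk hki
    subst hki
    have := (List.nodup_middle.1 hnd)
    exact (List.nodup_cons.1 this).1 hk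
  rw [hl]
  simp only [List.map_append, List.prod_append, List.map_cons, List.prod_cons, if_true,
    Function.update_self]
  have e1 : ∀ l : List (Fin d), (∀ k ∈ l, k ≠ i) →
      (l.map fun k => (pd k + algebraMap ℂ (Module.End ℂ (Sm d))
        (if k = i then Complex.I * a else 0)) ^ β k) = l.map fun k => pd k ^ β k := by
    intro l hl
    refine List.map_congr_left fun k hk => ?_
    simp [hl k hk]
  have e2 : ∀ (j : ℕ) (l : List (Fin d)), (∀ k ∈ l, k ≠ i) →
      (l.map fun k => (pd k : Module.End ℂ (Sm d)) ^ (Function.update β i j k))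
        = l.map fun k => pd k ^ β k := by
    intro j l hl
    refine List.map_congr_left fun k hk => ?_
    rw [Function.update_of_ne (hl k hk)]
  have n1 : ∀ k ∈ l₁, k ≠ i := fun k hk => hne k (List.mem_append_left _ hk)
  have n2 : ∀ k ∈ l₂, k ≠ i := fun k hk => hne k (List.mem_append_right _ hk)
  simp only [e1 _ n1, e1 _ n2, e2 _ _ n1, e2 _ _ n2]
  rw [(Algebra.commute_algebraMap_right (Complex.I * (a : ℂ)) (pd i)).add_pow, Finset.sum_mul,
    Finset.mul_sum]
  refine Finset.sum_congr rfl fun j _ => ?_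
  have : ((β i).choose j : Module.End ℂ (Sm d))
      = algebraMap ℂ (Module.End ℂ (Sm d)) ((β i).choose j : ℂ) := (map_natCast _ _).symm
  rw [this, ← map_pow, mul_assoc (pd i ^ j), ← map_mul, ← Algebra.commutes,
    ← Algebra.smul_def, smul_mul_assoc, mul_smul_comm]

lemma IsGelfandShilov.modulate_single {t s : ℝ} (hs : 0 < s) {f : E d → ℂ}
    (hf : IsGelfandShilov t s f) (i : Fin d) (a : ℝ) :
    IsGelfandShilov t s (fun y => Complex.exp (Complex.I * (y i * a : ℝ)) * f y) := by
  rw [isGelfandShilov_iff] at *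
  obtain ⟨f1, f2⟩ := hf
  refine ⟨(mo i a ⟨f, f1⟩).2, fun h hh => ?_⟩
  obtain ⟨B, hB, HB⟩ := f2 (h / 2) (half_pos hh)
  obtain ⟨K, hK, HK⟩ := sum_bound (d := d) hs hh (abs_nonneg a)
  refine ⟨K * B, by positivity, fun α β x => ?_⟩
  change ‖(mpow α x : ℂ) * ((md β * mo i a) ⟨f, f1⟩ : Sm d).1 x‖ ≤ _
  rw [md_mo, Module.End.mul_apply, LinearMap.sum_apply]
  change ‖(mpow α x : ℂ) * (Complex.exp (Complex.I * (x i * a : ℝ)) *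
    ((∑ j ∈ Finset.range (β i + 1), ((Complex.I * a) ^ (β i - j) * (β i).choose j : ℂ) •
      md (Function.update β i j) ⟨f, f1⟩ : Sm d) : E d → ℂ) x)‖ ≤ _
  have he : ‖Complex.exp (Complex.I * (x i * a : ℝ))‖ = 1 := by
    rw [mul_comm]; exact Complex.norm_exp_ofReal_mul_I _
  rw [mul_left_comm, norm_mul, he, one_mul]
  have hsum : ((∑ j ∈ Finset.range (β i + 1), ((Complex.I * a) ^ (β i - j) * (β i).choose j : ℂ) •
      md (Function.update β i j) ⟨f, f1⟩ : Sm d) : E d → ℂ) x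
      = ∑ j ∈ Finset.range (β i + 1), ((Complex.I * a) ^ (β i - j) * (β i).choose j : ℂ) *
      (md (Function.update β i j) ⟨f, f1⟩ : Sm d).1 x := by
    rw [Submodule.coe_sum, Finset.sum_apply]
    rfl
  rw [hsum, Finset.mul_sum]
  calc _ ≤ ∑ j ∈ Finset.range (β i + 1), (|a| ^ (β i - j) * (β i).choose j) *
        ‖(mpow α x : ℂ) * (md (Function.update β i j) ⟨f, f1⟩ : Sm d).1 x‖ := by
        refine (norm_sum_le _ _).trans (le_of_eq (Finset.sum_congr rfl fun j _ => ?_))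
        rw [mul_left_comm, norm_mul]
        simp
    _ ≤ ∑ j ∈ Finset.range (β i + 1), (|a| ^ (β i - j) * (β i).choose j) *
          (B * wt t s (h / 2) α (Function.update β i j)) := by
        refine Finset.sum_le_sum fun j _ => ?_
        exact mul_le_mul_of_nonneg_left (HB α _ x) (by positivity)
    _ = (∑ j ∈ Finset.range (β i + 1), |a| ^ (β i - j) * (β i).choose j *
          ((h / 2) ^ mlen (Function.update β i j) * (mfact (Function.update β i j) : ℝ) ^ s)) *
          (B * ((h / 2) ^ mlen α * (mfact α : ℝ) ^ t)) := by
        rw [Finset.sum_mul]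
        refine Finset.sum_congr rfl fun j _ => ?_
        rw [wt_eq]; ring
    _ ≤ (K * (h ^ mlen β * (mfact β : ℝ) ^ s)) * (B * (h ^ mlen α * (mfact α : ℝ) ^ t)) := by
        have := mfact_pos α
        refine mul_le_mul (HK β i) ?_ (by positivity) (by positivity)
        gcongr
        linarith
    _ = _ := by rw [wt_eq]; ring

end Aux

/-- The space `Σ_t^s(ℝᵈ)`, as a complex vector space of functions. -/
def GSSpace (d : ℕ) (t s : ℝ) : Submodule ℂ (E d → ℂ) where
  carrier := {f | IsGelfandShilov t s f}
  add_mem' := IsGelfandShilov.add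
  zero_mem' := isGelfandShilov_zero t s
  smul_mem' := fun c _ hf => hf.smul c

/-- The ultradistributions `(Σ_t^s)'(ℝᵈ)`: the conjugate linear functionals `φ ↦ (u, φ)` on
`Σ_t^s(ℝᵈ)` that are continuous, that is, bounded by a multiple of one of the norms
(these norms generate the topology and increase as `h` decreases). -/
def GSDual (d : ℕ) (t s : ℝ) : Type :=
  {u : GSSpace d t s →ₗ⋆[ℂ] ℂ //
    ∃ h : ℝ, 0 < h ∧ ∃ C : ℝ≥0, ∀ f : GSSpace d t s, ‖u f‖ₑ ≤ C * gsNorm t s h (f : E d → ℂ)}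

/-- The action `(u, φ)` of an ultradistribution on a test function. -/
def GSDual.pair {d : ℕ} {t s : ℝ} (u : GSDual d t s) (φ : GSSpace d t s) : ℂ := u.1 φ

/-! ### Short-time Fourier transform -/

/-- The time-frequency shift `M_ξ T_x f(y) = exp(i⟨y, ξ⟩) f(y - x)`. -/
def timeFreqShift {d : ℕ} (x ξ : E d) (f : E d → ℂ) : E d → ℂ :=
  fun y => Complex.exp (Complex.I * (inner ℝ y ξ : ℝ)) * f (y - x)

/-- `Σ_t^s(ℝᵈ)` is invariant under time-frequency shifts. -/
lemma IsGelfandShilov.timeFreqShift {d : ℕ} {t s : ℝ} (ht : 0 < t) (hs : 0 < s) (x ξ : E d)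
    {f : E d → ℂ} (hf : IsGelfandShilov t s f) : IsGelfandShilov t s (timeFreqShift x ξ f) := by
  have h1 : ∀ S : Finset (Fin d),
      IsGelfandShilov t s (fun y => f (y - ∑ i ∈ S, EuclideanSpace.single i (x i))) := by
    intro S
    induction S using Finset.induction_on with
    | empty => simpa using hf
    | insert i S hi ih =>
      have := ih.translate_single ht i (x i)
      simpa only [Finset.sum_insert hi, sub_sub] using this
  have h2 : ∀ S : Finset (Fin d), IsGelfandShilov t s
      (fun y => Complex.exp (Complex.I * (∑ i ∈ S, y i * ξ i : ℝ)) * f (y - x)) := by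
    intro S
    induction S using Finset.induction_on with
    | empty =>
      have h3 := h1 Finset.univ
      have h4 : ∑ i, EuclideanSpace.single i (x i) = x := by
        ext k
        simp [Finset.sum_apply, Pi.single_apply]
      rw [h4] at h3
      simpa using h3
    | insert i S hi ih =>
      have := ih.modulate_single hs i (ξ i)
      convert this using 2 with y
      rw [Finset.sum_insert hi, Complex.ofReal_add, mul_add, Complex.exp_add, mul_assoc]
  have h5 := h2 Finset.univ
  convert h5 using 2 with y
  unfold GelfandShilov.timeFreqShift
  have : (inner ℝ y ξ : ℝ) = ∑ i, y i * ξ i := by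
    simp [PiLp.inner_apply, mul_comm]
  rw [this]

/-- The short-time Fourier transform `V_ψ u(x, ξ) = (2π)^{-d/2} (u, M_ξ T_x ψ)`. -/
def stft {d : ℕ} {t s : ℝ} (ht : 0 < t) (hs : 0 < s) (ψ : GSSpace d t s) (u : GSDual d t s)
    (x ξ : E d) : ℂ :=
  (((2 * Real.pi) ^ (-(d : ℝ) / 2) : ℝ) : ℂ) *
    u.pair ⟨timeFreqShift x ξ (ψ : E d → ℂ), IsGelfandShilov.timeFreqShift ht hs x ξ ψ.2⟩

/-! ### The wave front set -/

/-- The wave front set `WF^{t,s}(u)`, a subset of `T*ℝᵈ \ 0`, computed with the window `ψ`: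
a point `z ≠ 0` does not belong to it if and only if there is an open set `U ⊆ T*ℝᵈ \ 0`
containing `z` such that, for every `r > 0`, the quantity `exp(r λ) |V_ψ u(λ^t x, λ^s ξ)|` is
bounded over all `λ > 0` and `(x, ξ) ∈ U`. -/
def waveFrontSet {d : ℕ} {t s : ℝ} (ht : 0 < t) (hs : 0 < s) (ψ : GSSpace d t s)
    (u : GSDual d t s) : Set (E d × E d) :=
  {z | z ≠ 0 ∧ ¬ ∃ U : Set (E d × E d), IsOpen U ∧ U ⊆ {0}ᶜ ∧ z ∈ U ∧
    ∀ r : ℝ, 0 < r → ∃ C : ℝ, ∀ l : ℝ, 0 < l → ∀ p ∈ U,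
      Real.exp (r * l) * ‖stft ht hs ψ u (l ^ t • p.1) (l ^ s • p.2)‖ ≤ C}

/-! ### Fourier transform and linear changes of variables of ultradistributions -/

/-- The Fourier transform `(2π)^{-d/2} ∫ f(x) exp(-i⟨x, ξ⟩) dx` of a function. -/
def fourierFun {d : ℕ} (f : E d → ℂ) : E d → ℂ :=
  fun ξ => (((2 * Real.pi) ^ (-(d : ℝ) / 2) : ℝ) : ℂ) *
    ∫ x, f x * Complex.exp (-Complex.I * (inner ℝ x ξ : ℝ))

/-- `v = û`: the Fourier transform maps `Σ_t^s(ℝᵈ)` to `Σ_s^t(ℝᵈ)`, and it is extended to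
ultradistributions by Parseval's formula `(û, φ̂) = (u, φ)`. -/
def IsFourierTransform {d : ℕ} {t s : ℝ} (u : GSDual d t s) (v : GSDual d s t) : Prop :=
  ∀ φ : GSSpace d t s, ∃ h : fourierFun (φ : E d → ℂ) ∈ GSSpace d s t,
    v.pair ⟨fourierFun (φ : E d → ℂ), h⟩ = u.pair φ

/-- The action `x ↦ A x` of a square matrix. -/
def matAct {d : ℕ} (A : Matrix (Fin d) (Fin d) ℝ) (x : E d) : E d := WithLp.toLp 2 (A.mulVec x.ofLp)

/-- `v(x) = c u(A x)`: the linear change of variables is extended to ultradistributions by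
`(u(A ·), φ) = |det A|⁻¹ (u, φ(A⁻¹ ·))`. -/
def IsDilation {d : ℕ} {t s : ℝ} (c : ℂ) (A : Matrix.GeneralLinearGroup (Fin d) ℝ)
    (u v : GSDual d t s) : Prop :=
  ∀ φ : GSSpace d t s,
    ∃ h : (fun x => (φ : E d → ℂ) (matAct (A⁻¹).1 x)) ∈ GSSpace d t s,
      v.pair φ = c * ((|A.1.det|⁻¹ : ℝ) : ℂ) *
        u.pair ⟨fun x => (φ : E d → ℂ) (matAct (A⁻¹).1 x), h⟩

/-- The symplectic matrix `J = (0, I; -I, 0)` acting on phase space. -/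
def symplecticJ {d : ℕ} (z : E d × E d) : E d × E d := (z.2, -z.1)

/-- The block diagonal matrix `diag(A⁻¹, Aᵀ)` acting on phase space. -/
def symplecticDiag {d : ℕ} (A : Matrix.GeneralLinearGroup (Fin d) ℝ) (z : E d × E d) : E d × E d :=
  (matAct (A⁻¹).1 z.1, matAct (A.1.transpose) z.2)

end GelfandShilov

end

open GelfandShilov

/-!
Pairing a test function with the time-frequency shifts of a window gives a short-time Fourier
transform that decays like `exp (-R * ρ)` for every `R`, where `ρ (x, ξ) = |x|^{1/t} + |ξ|^{1/s}`
is homogeneous under the dilations in the definition of the wave front set. A test function is an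
integral of time-frequency shifts of any nonzero window. This integral converges in each of the
norms `‖·‖_{t,s,h}`, so an ultradistribution `u`, extended by Hahn–Banach, may be applied under
the integral sign: `V_φ u` is dominated by the convolution of `|V_ψ u|` with a function decaying
like `exp (-R * ρ)`. Hence the wave front set does not depend on the window. The
Fourier transform and the linear changes of variables carry time-frequency shifts to
time-frequency shifts up to a factor of modulus one, acting by `𝒥` and `diag(A⁻¹, Aᵀ)` on phase
space, and these maps commute with the dilations.
-/

open scoped ContDiff ENNReal NNReal

noncomputable section

namespace GelfandShilov

open MeasureTheory FourierTransform
open Finset.HasAntidiagonal (antidiagonal mem_antidiagonal)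

variable {d : ℕ}

/-! ### Reordering coordinates and derivatives -/

lemma list_prod_map_mul {ι M : Type*} [Monoid M] {l : List ι} (hl : l.Nodup) {a b : ι → M}
    (h : ∀ i ∈ l, ∀ j ∈ l, i ≠ j → Commute (b i) (a j)) :
    (l.map fun i => a i * b i).prod = (l.map a).prod * (l.map b).prod := by
  induction l with
  | nil => simp
  | cons i l ih =>
    obtain ⟨hi, hl⟩ := List.nodup_cons.1 hl
    have hcomm : Commute (b i) (l.map a).prod := by
      refine Commute.list_prod_right _ _ fun x hx => ?_
      obtain ⟨j, hj, rfl⟩ := List.mem_map.1 hx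
      exact h i (by simp) j (List.mem_cons_of_mem _ hj) fun e => hi (e ▸ hj)
    simp only [List.map_cons, List.prod_cons]
    rw [ih hl fun j hj k hk => h j (List.mem_cons_of_mem _ hj) k (List.mem_cons_of_mem _ hk),
      mul_assoc, mul_assoc, ← mul_assoc (b i), hcomm.eq, mul_assoc]

section WeylRelation

variable {R : Type*} [Semiring R] {D X : R}

lemma mul_pow_of_mul_eq_mul_add_one (h : D * X = X * D + 1) (a : ℕ) :
    D * X ^ a = X ^ a * D + a • X ^ (a - 1) := by
  induction a with
  | zero => simp
  | succ a ih =>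
    have hX : a • X ^ (a - 1) * X = a • X ^ a := by
      rcases a with _ | a
      · simp
      · rw [smul_mul_assoc, Nat.add_sub_cancel, ← pow_succ]
    rw [pow_succ, ← mul_assoc, ih, add_mul, mul_assoc, h, hX, mul_add, mul_one, ← mul_assoc,
      Nat.add_sub_cancel, add_assoc, succ_nsmul']

lemma pow_mul_pow_of_mul_eq_mul_add_one (h : D * X = X * D + 1) (a b : ℕ) :
    D ^ b * X ^ a = ∑ p ∈ antidiagonal b,
      b.choose p.1 • a.descFactorial p.1 • (X ^ (a - p.1) * D ^ p.2) := by
  induction b with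
  | zero => simp
  | succ b ih =>
    have step : ∀ k m : ℕ, D * a.descFactorial k • (X ^ (a - k) * D ^ m) =
        a.descFactorial k • (X ^ (a - k) * D ^ (m + 1)) +
          a.descFactorial (k + 1) • (X ^ (a - (k + 1)) * D ^ m) := fun k m => by
      rw [mul_smul_comm, ← mul_assoc, mul_pow_of_mul_eq_mul_add_one h, add_mul, smul_add,
        mul_assoc, ← pow_succ', smul_mul_assoc, smul_smul, Nat.descFactorial_succ,
        mul_comm (a - k), Nat.sub_sub]
    rw [Finset.sum_antidiagonal_choose_succ_nsmul
      (fun k m => a.descFactorial k • (X ^ (a - k) * D ^ m)), pow_succ', mul_assoc, ih,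
      Finset.mul_sum, ← Finset.sum_add_distrib]
    refine Finset.sum_congr rfl fun p hp => ?_
    rw [mul_smul_comm, step, smul_add, ← Nat.choose_symm_of_eq_add
      (mem_antidiagonal.1 hp).symm]

end WeylRelation

/-- Multiplication by the coordinate `x i`, as an endomorphism of the smooth functions. -/
def mulX (i : Fin d) : Module.End ℂ (Sm d) where
  toFun f := ⟨fun y => (y i : ℂ) * f.1 y, by
    have hf : ContDiff ℝ ∞ f.1 := f.2
    exact (Complex.ofRealCLM.contDiff.comp (EuclideanSpace.proj (𝕜 := ℝ) i).contDiff).mul hf⟩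
  map_add' _ _ := by ext x; exact mul_add _ _ _
  map_smul' _ _ := by ext x; exact mul_left_comm _ _ _

lemma mulX_apply (i : Fin d) (f : Sm d) (x : E d) : (mulX i f).1 x = (x i : ℂ) * f.1 x := rfl

lemma mulX_pow_apply (i : Fin d) (n : ℕ) (f : Sm d) (x : E d) :
    ((mulX i ^ n) f).1 x = (x i : ℂ) ^ n * f.1 x := by
  induction n generalizing f with
  | zero => simp
  | succ n ih => rw [pow_succ, Module.End.mul_apply, ih, mulX_apply, pow_succ, mul_assoc]

lemma differentiable_coe (f : Sm d) : Differentiable ℝ f.1 :=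
  ContDiff.differentiable (n := ∞) f.2 (by simp)

lemma commute_pd_pd (i j : Fin d) : Commute (pd i) (pd j) := by
  ext f x
  have hf : ContDiff ℝ ∞ f.1 := f.2
  have hf' : Differentiable ℝ (fderiv ℝ f.1) :=
    (hf.fderiv_right (m := ∞) (by simp)).differentiable (by simp)
  have second_deriv : ∀ u v : E d, fderiv ℝ (fun y => fderiv ℝ f.1 y u) x v =
      fderiv ℝ (fderiv ℝ f.1) x v u := fun u v => by
    rw [fderiv_clm_apply (hf' x) (differentiableAt_const _)]
    simp
  change fderiv ℝ (fun y => fderiv ℝ f.1 y _) x _ = fderiv ℝ (fun y => fderiv ℝ f.1 y _) x _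
  rw [second_deriv, second_deriv]
  exact (hf.contDiffAt.isSymmSndFDerivAt (by
    rw [minSmoothness_of_isRCLikeNormedField]
    exact WithTop.coe_le_coe.2 (le_top : (2 : ℕ∞) ≤ ⊤))) _ _

lemma pd_mul_mulX (i j : Fin d) :
    pd i * mulX j = mulX j * pd i + algebraMap ℂ _ (if i = j then 1 else 0) := by
  ext f x
  have hcoord : HasFDerivAt (fun y : E d => (y j : ℂ))
      (Complex.ofRealCLM.comp (EuclideanSpace.proj (𝕜 := ℝ) j)) x :=
    Complex.ofRealCLM.hasFDerivAt.comp x (EuclideanSpace.proj (𝕜 := ℝ) j).hasFDerivAt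
  have hmul : fderiv ℝ (fun y : E d => (y j : ℂ) * f.1 y) x = _ :=
    (hcoord.mul (differentiable_coe f x).hasFDerivAt).fderiv
  change fderiv ℝ (fun y : E d => (y j : ℂ) * f.1 y) x _ =
    (x j : ℂ) * fderiv ℝ f.1 x _ + (if i = j then 1 else 0) * f.1 x
  rw [hmul]
  by_cases hij : i = j
  · subst hij
    simp
  · simp [hij, Ne.symm hij]

lemma commute_pd_mulX {i j : Fin d} (h : i ≠ j) : Commute (pd i) (mulX j) := by
  have := pd_mul_mulX i j
  rwa [if_neg h, map_zero, add_zero] at this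

lemma pd_mul_mulX_self (i : Fin d) : pd i * mulX i = mulX i * pd i + 1 := by
  rw [pd_mul_mulX, if_pos rfl, map_one]

/-- Multiplication by the monomial `x ^ α`, as an endomorphism of the smooth functions. -/
def mulMonomial (α : Fin d → ℕ) : Module.End ℂ (Sm d) :=
  ((List.finRange d).map fun i => mulX i ^ α i).prod

lemma mulMonomial_apply (α : Fin d → ℕ) (f : Sm d) (x : E d) :
    (mulMonomial α f).1 x = (mpow α x : ℂ) * f.1 x := by
  have h : ∀ l : List (Fin d), (((l.map fun i => mulX i ^ α i).prod) f).1 x =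
      (l.map fun i => ((x i : ℂ) ^ α i)).prod * f.1 x := fun l => by
    induction l with
    | nil => simp
    | cons i l ih =>
      simp only [List.map_cons, List.prod_cons]
      rw [Module.End.mul_apply, mulX_pow_apply, ih, mul_assoc]
  rw [mulMonomial, h, mpow, ← Fin.prod_univ_def]
  push_cast
  rfl

lemma md_add (α β : Fin d → ℕ) : md (α + β) = md α * md β := by
  unfold md
  rw [← list_prod_map_mul (List.nodup_finRange d)
    fun i _ j _ _ => ((commute_pd_pd i j).pow_left _).pow_right _]
  simp only [Pi.add_apply, pow_add]

lemma md_single (i : Fin d) (n : ℕ) : md (Pi.single i n) = pd i ^ n := by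
  unfold md
  rw [List.prod_map_eq_pow_single i _ fun j hj _ => by simp [hj],
    List.count_eq_one_of_mem (List.nodup_finRange d) (List.mem_finRange i), pow_one,
    Pi.single_eq_same]

lemma md_zero : md (0 : Fin d → ℕ) = 1 := by
  simp [md]

lemma md_add_single (β : Fin d → ℕ) (i : Fin d) : md (β + Pi.single i 1) = pd i * md β := by
  rw [add_comm, md_add, md_single, pow_one]

/-- The product over the coordinates `i` of `∂ᵢ ^ βᵢ xᵢ ^ αᵢ` for `i ∈ S` and of
`xᵢ ^ αᵢ ∂ᵢ ^ βᵢ` for `i ∉ S`. It interpolates between `x ^ α ∂ ^ β` and `∂ ^ β x ^ α`, so that the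
two factors can be interchanged one coordinate at a time. -/
def mixedOp (S : Finset (Fin d)) (α β : Fin d → ℕ) : Module.End ℂ (Sm d) :=
  ((List.finRange d).map fun i =>
    if i ∈ S then pd i ^ β i * mulX i ^ α i else mulX i ^ α i * pd i ^ β i).prod

lemma mixedOp_empty (α β : Fin d → ℕ) : mixedOp ∅ α β = mulMonomial α * md β := by
  unfold mixedOp mulMonomial md
  simp only [Finset.notMem_empty, if_false]
  exact list_prod_map_mul (List.nodup_finRange d)
    fun i _ j _ hij => ((commute_pd_mulX hij).pow_left _).pow_right _

lemma mixedOp_univ (α β : Fin d → ℕ) : mixedOp Finset.univ α β = md β * mulMonomial α := by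
  unfold mixedOp mulMonomial md
  simp only [Finset.mem_univ, if_true]
  exact list_prod_map_mul (List.nodup_finRange d)
    fun i _ j _ hij => (((commute_pd_mulX hij.symm).pow_left _).pow_right _).symm

lemma mixedOp_insert {S : Finset (Fin d)} {i : Fin d} (hi : i ∉ S) (α β : Fin d → ℕ) :
    mixedOp (insert i S) α β = ∑ p ∈ antidiagonal (β i),
      (β i).choose p.1 • (α i).descFactorial p.1 •
        mixedOp S (Function.update α i (α i - p.1)) (Function.update β i p.2) := by
  obtain ⟨l₁, l₂, hl⟩ := List.append_of_mem (List.mem_finRange i)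
  have hi_mem : i ∉ l₁ ++ l₂ :=
    (List.nodup_cons.1 (List.nodup_middle.1 (hl ▸ List.nodup_finRange d))).1
  rw [List.mem_append, not_or] at hi_mem
  have update_off : ∀ l : List (Fin d), i ∉ l → ∀ p : ℕ × ℕ, (l.map fun j => if j ∈ S then
      pd j ^ Function.update β i p.2 j * mulX j ^ Function.update α i (α i - p.1) j
      else mulX j ^ Function.update α i (α i - p.1) j * pd j ^ Function.update β i p.2 j) =
      l.map fun j => if j ∈ insert i S then pd j ^ β j * mulX j ^ α j
        else mulX j ^ α j * pd j ^ β j := fun l hil p => by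
    refine List.map_congr_left fun j hj => ?_
    have hji : j ≠ i := fun e => hil (e ▸ hj)
    simp [hji]
  unfold mixedOp
  simp only [hl, List.map_append, List.prod_append, List.map_cons, List.prod_cons,
    update_off l₁ hi_mem.1, update_off l₂ hi_mem.2, hi, if_false, Function.update_self,
    Finset.mem_insert_self, if_true]
  rw [pow_mul_pow_of_mul_eq_mul_add_one (pd_mul_mulX_self i), Finset.sum_mul, Finset.mul_sum]
  exact Finset.sum_congr rfl fun p _ => by simp only [smul_mul_assoc, mul_smul_comm]

/-! ### Seminorm bounds -/

lemma wt_mono {t s h h' : ℝ} (hh : 0 ≤ h) (h1 : h ≤ h') (α β : Fin d → ℕ) :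
    wt t s h α β ≤ wt t s h' α β := by
  have := mfact_pos α
  have := mfact_pos β
  unfold wt
  gcongr

lemma pow_mul_mfact_update_le {p h : ℝ} (hp : 0 ≤ p) (hh : 0 ≤ h) (γ : Fin d → ℕ) (i : Fin d)
    {j k : ℕ} (hjk : k + j = γ i) :
    h ^ k * (k.factorial : ℝ) ^ p * (h ^ mlen (Function.update γ i j) *
      (mfact (Function.update γ i j) : ℝ) ^ p) ≤ h ^ mlen γ * (mfact γ : ℝ) ^ p := by
  have hj : j ≤ γ i := by omega
  have hk : γ i - j = k := by omega
  have hlen := mlen_update γ i hj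
  have hfact := mfact_update γ i hj
  rw [hk] at hlen hfact
  have hfact' : (mfact (Function.update γ i j) : ℝ) ^ p * (k.factorial : ℝ) ^ p
      ≤ (mfact γ : ℝ) ^ p := by
    rw [← Real.mul_rpow (by positivity) (by positivity)]
    exact Real.rpow_le_rpow (by positivity) (by exact_mod_cast hfact) hp
  calc _ = h ^ (mlen (Function.update γ i j) + k) *
        ((mfact (Function.update γ i j) : ℝ) ^ p * (k.factorial : ℝ) ^ p) := by
        rw [pow_add]; ring
    _ ≤ _ := by rw [hlen]; gcongr

lemma pow_mul_wt_update_le {t s h : ℝ} (ht : 0 ≤ t) (hs : 0 ≤ s) (hh : 0 < h)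
    (α β : Fin d → ℕ) (i : Fin d) {a b k : ℕ} (ha : k + a = α i) (hb : k + b = β i) :
    h ^ (2 * k) * (k.factorial : ℝ) ^ (s + t) *
      wt t s h (Function.update α i a) (Function.update β i b) ≤ wt t s h α β := by
  have hk : (0 : ℝ) < k.factorial := by exact_mod_cast Nat.factorial_pos k
  rw [wt_eq, wt_eq, two_mul, pow_add, Real.rpow_add hk]
  refine le_trans (le_of_eq ?_) (mul_le_mul (pow_mul_mfact_update_le ht hh.le α i ha)
    (pow_mul_mfact_update_le hs hh.le β i hb) (by positivity) (by positivity))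
  ring

/- This is where `s + t > 1` is used: the factor `k!` produced by commuting `∂ᵢ` past `xᵢ` is
smaller than the gain `k! ^ (s + t)` in the weight, by more than any geometric factor. -/
lemma exists_factorial_mul_wt_update_le {t s h : ℝ} (ht : 0 ≤ t) (hs : 0 ≤ s) (hst : 1 < s + t)
    (hh : 0 < h) : ∃ K : ℝ, 0 ≤ K ∧ ∀ (α β : Fin d → ℕ) (i : Fin d) (a b k : ℕ),
      k + a = α i → k + b = β i →
        k.factorial * wt t s h (Function.update α i a) (Function.update β i b) ≤
          K * wt t s h α β := by
  obtain ⟨K, hK, H⟩ := pow_le_factorial_rpow (s := s + t - 1) (h := 1) (by linarith) one_pos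
    (a := (h ^ 2)⁻¹) (by positivity)
  refine ⟨K, hK, fun α β i a b k ha hb => ?_⟩
  have hkf : (0 : ℝ) < k.factorial := by exact_mod_cast Nat.factorial_pos k
  have hpow : 1 ≤ K * (k.factorial : ℝ) ^ (s + t - 1) * h ^ (2 * k) := by
    have := H k
    rwa [inv_pow, ← pow_mul, one_pow, mul_one, inv_le_iff_one_le_mul₀ (by positivity)] at this
  have hsplit : (k.factorial : ℝ) ^ (s + t) = k.factorial * (k.factorial : ℝ) ^ (s + t - 1) := by
    rw [← Real.rpow_one_add' hkf.le (by linarith)]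
    ring_nf
  have hV := wt_pos (t := t) (s := s) hh (Function.update α i a) (Function.update β i b)
  set V := wt t s h (Function.update α i a) (Function.update β i b)
  calc k.factorial * V ≤ (K * (k.factorial : ℝ) ^ (s + t - 1) * h ^ (2 * k)) *
        (k.factorial * V) := le_mul_of_one_le_left (by positivity) hpow
    _ = K * (h ^ (2 * k) * (k.factorial : ℝ) ^ (s + t) * V) := by rw [hsplit]; ring
    _ ≤ K * wt t s h α β := by
        gcongr
        exact pow_mul_wt_update_le ht hs hh α β i ha hb

lemma choose_sum_mul_wt_le {t s h : ℝ} (hh : 0 < h) (α β : Fin d → ℕ) (i : Fin d) :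
    (∑ p ∈ antidiagonal (β i), ((β i).choose p.1 : ℝ)) * (2 ^ α i * wt t s (h / 2) α β) ≤
      wt t s h α β := by
  have hchoose : ∑ p ∈ antidiagonal (β i), ((β i).choose p.1 : ℝ) = 2 ^ β i := by
    rw [Finset.Nat.sum_antidiagonal_eq_sum_range_succ_mk]
    exact_mod_cast Nat.sum_range_choose (β i)
  have hpow : (2 : ℝ) ^ β i * 2 ^ α i ≤ 2 ^ mlen (α + β) := by
    rw [← pow_add, add_comm]
    exact pow_le_pow_right₀ one_le_two
      (Finset.single_le_sum (f := α + β) (fun _ _ => Nat.zero_le _) (Finset.mem_univ i))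
  have hwt : 2 ^ mlen (α + β) * wt t s (h / 2) α β = wt t s h α β := by
    rw [wt, wt, div_pow]
    field_simp
  rw [hchoose, ← mul_assoc, ← hwt]
  exact mul_le_mul_of_nonneg_right hpow (wt_pos (half_pos hh) α β).le

/-- The bounds `w(x) |P α β f(x)| ≤ B h ^ |α + β| α! ^ t β! ^ s` for a weight `w` and a family of
operators `P`, such as `x ^ α ∂ ^ β` or `∂ ^ β x ^ α`. -/
def OpBound (w : E d → ℝ) (t s h B : ℝ) (P : (Fin d → ℕ) → (Fin d → ℕ) → Module.End ℂ (Sm d))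
    (f : Sm d) : Prop :=
  ∀ α β x, w x * ‖(P α β f).1 x‖ ≤ B * wt t s h α β

/-- The bounds `|x ^ α ∂ ^ β f(x)| ≤ B h ^ |α + β| α! ^ t β! ^ s`, that is, `‖f‖_{t,s,h} ≤ B`. -/
def GSBound (t s h B : ℝ) (f : Sm d) : Prop :=
  ∀ α β x, ‖(mpow α x : ℂ) * (md β f).1 x‖ ≤ B * wt t s h α β

lemma coe_sum_apply {ι : Type*} (S : Finset ι) (g : ι → Sm d) (x : E d) :
    (∑ k ∈ S, g k : Sm d).1 x = ∑ k ∈ S, (g k).1 x := by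
  rw [Submodule.coe_sum, Finset.sum_apply]

lemma norm_nsmul_apply (n : ℕ) (g : Sm d) (x : E d) : ‖(n • g).1 x‖ = n * ‖g.1 x‖ := by
  rw [← Nat.cast_smul_eq_nsmul ℂ]
  change ‖(n : ℂ) * g.1 x‖ = _
  rw [norm_mul, Complex.norm_natCast]

lemma OpBound.mixedOp_insert {t s h : ℝ} (ht : 0 ≤ t) (hs : 0 ≤ s) (hst : 1 < s + t)
    (hh : 0 < h) : ∃ K : ℝ, 0 ≤ K ∧ ∀ (S : Finset (Fin d)) (i : Fin d), i ∉ S →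
      ∀ w : E d → ℝ, (∀ x, 0 ≤ w x) → ∀ B : ℝ, 0 ≤ B → ∀ f,
        OpBound w t s (h / 2) B (mixedOp S) f →
          OpBound w t s h (K * B) (mixedOp (insert i S)) f := by
  obtain ⟨K, hK, H⟩ := exists_factorial_mul_wt_update_le (d := d) ht hs hst (half_pos hh)
  refine ⟨K, hK, fun S i hi w hw B hB f hf α β x => ?_⟩
  set W := wt t s (h / 2) α β
  have hW : 0 < W := wt_pos (half_pos hh) α β
  have term_le : ∀ p ∈ antidiagonal (β i), (α i).descFactorial p.1 * (w x *
      ‖(mixedOp S (Function.update α i (α i - p.1)) (Function.update β i p.2) f).1 x‖) ≤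
        2 ^ α i * (K * B * W) := fun p hp => by
    by_cases hpa : p.1 ≤ α i
    · have hV := H α β i (α i - p.1) p.2 p.1 (by omega) (mem_antidiagonal.1 hp)
      have hchoose : ((α i).choose p.1 : ℝ) ≤ 2 ^ α i := by
        exact_mod_cast Nat.choose_le_two_pow _ _
      have hV_pos := wt_pos (t := t) (s := s) (half_pos hh) (Function.update α i (α i - p.1))
        (Function.update β i p.2)
      rw [Nat.descFactorial_eq_factorial_mul_choose, Nat.cast_mul]
      calc _ ≤ (p.1.factorial * (α i).choose p.1 : ℝ) * (B * wt t s (h / 2)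
              (Function.update α i (α i - p.1)) (Function.update β i p.2)) := by
            exact mul_le_mul_of_nonneg_left (hf _ _ x) (by positivity)
        _ = (α i).choose p.1 * (B * (p.1.factorial * wt t s (h / 2)
              (Function.update α i (α i - p.1)) (Function.update β i p.2))) := by ring
        _ ≤ 2 ^ α i * (B * (K * W)) := by gcongr
        _ = _ := by ring
    · rw [Nat.descFactorial_eq_zero_iff_lt.2 (not_le.1 hpa), Nat.cast_zero, zero_mul]
      positivity
  rw [GelfandShilov.mixedOp_insert hi, LinearMap.sum_apply, coe_sum_apply]
  calc _ ≤ w x * ∑ p ∈ antidiagonal (β i), (β i).choose p.1 * ((α i).descFactorial p.1 *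
        ‖(mixedOp S (Function.update α i (α i - p.1)) (Function.update β i p.2) f).1 x‖) := by
        refine mul_le_mul_of_nonneg_left ((norm_sum_le _ _).trans_eq ?_) (hw x)
        simp only [LinearMap.smul_apply, norm_nsmul_apply]
    _ = ∑ p ∈ antidiagonal (β i), (β i).choose p.1 * ((α i).descFactorial p.1 * (w x *
        ‖(mixedOp S (Function.update α i (α i - p.1)) (Function.update β i p.2) f).1 x‖)) := by
        rw [Finset.mul_sum]
        exact Finset.sum_congr rfl fun p _ => by ring
    _ ≤ ∑ p ∈ antidiagonal (β i), (β i).choose p.1 * (2 ^ α i * (K * B * W)) :=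
        Finset.sum_le_sum fun p hp => mul_le_mul_of_nonneg_left (term_le p hp) (by positivity)
    _ = K * B * ((∑ p ∈ antidiagonal (β i), ((β i).choose p.1 : ℝ)) * (2 ^ α i * W)) := by
        rw [← Finset.sum_mul]; ring
    _ ≤ K * B * wt t s h α β := by
        gcongr
        exact choose_sum_mul_wt_le hh α β i

lemma OpBound.mixedOp {t s : ℝ} (ht : 0 ≤ t) (hs : 0 ≤ s) (hst : 1 < s + t)
    (S : Finset (Fin d)) :
    ∀ h : ℝ, 0 < h → ∃ h' K : ℝ, 0 < h' ∧ 0 ≤ K ∧ ∀ w : E d → ℝ, (∀ x, 0 ≤ w x) →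
      ∀ B : ℝ, 0 ≤ B → ∀ f, OpBound w t s h' B (fun α β => mulMonomial α * md β) f →
        OpBound w t s h (K * B) (mixedOp S) f := by
  induction S using Finset.induction_on with
  | empty =>
    refine fun h hh => ⟨h, 1, hh, zero_le_one, fun w _ B _ f hf α β x => ?_⟩
    rw [mixedOp_empty, one_mul]
    exact hf α β x
  | insert i S hi ih =>
    intro h hh
    obtain ⟨h', K, hh', hK, H⟩ := ih (h / 2) (half_pos hh)
    obtain ⟨K', hK', H'⟩ := OpBound.mixedOp_insert (d := d) ht hs hst hh
    refine ⟨h', K' * K, hh', by positivity, fun w hw B hB f hf => ?_⟩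
    rw [mul_assoc]
    exact H' S i hi w hw _ (by positivity) f (H w hw B hB f hf)

lemma gsBound_toReal_gsNorm {t s h : ℝ} (hh : 0 < h) (f : Sm d) (hf : gsNorm t s h f.1 < ⊤) :
    GSBound t s h (gsNorm t s h f.1).toReal f := by
  intro α β x
  rw [← div_le_iff₀ (wt_pos hh α β), ← ENNReal.ofReal_le_iff_le_toReal hf.ne, md_coe]
  unfold gsNorm
  exact le_iSup_of_le α (le_iSup_of_le β (le_iSup_of_le x le_rfl))

lemma GSBound.gsNorm_le {t s h B : ℝ} (hh : 0 < h) {f : Sm d} (hf : GSBound t s h B f) :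
    gsNorm t s h f.1 ≤ ENNReal.ofReal B := by
  refine iSup_le fun α => iSup_le fun β => iSup_le fun x => ENNReal.ofReal_le_ofReal ?_
  have := hf α β x
  rw [md_coe] at this
  exact (div_le_iff₀ (wt_pos hh α β)).2 this

lemma GSBound.mono {t s h h' B B' : ℝ} (hh : 0 < h) (hh' : h ≤ h') (hB : 0 ≤ B) (hBB : B ≤ B')
    {f : Sm d} (hf : GSBound t s h B f) : GSBound t s h' B' f := fun α β x =>
  (hf α β x).trans (mul_le_mul hBB (wt_mono hh.le hh' α β) (wt_pos hh α β).le (hB.trans hBB))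

/-- An element of `Σ_t^s(ℝᵈ)`, regarded as a smooth function. -/
def toSm {t s : ℝ} (f : GSSpace d t s) : Sm d := ⟨f.1, f.2.1⟩

lemma exists_gsBound {t s : ℝ} (f : GSSpace d t s) {h : ℝ} (hh : 0 < h) :
    ∃ B : ℝ, 0 ≤ B ∧ GSBound t s h B (toSm f) :=
  ⟨_, ENNReal.toReal_nonneg, gsBound_toReal_gsNorm hh (toSm f) (f.2.2 h hh)⟩

lemma mem_gsSpace_of_gsBound {t s : ℝ} (f : Sm d)
    (H : ∀ h : ℝ, 0 < h → ∃ B : ℝ, GSBound t s h B f) : f.1 ∈ GSSpace d t s := by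
  refine ⟨f.2, fun h hh => ?_⟩
  obtain ⟨B, hB⟩ := H h hh
  exact (hB.gsNorm_le hh).trans_lt ENNReal.ofReal_lt_top

lemma GSDual.exists_norm_pair_le {t s : ℝ} (u : GSDual d t s) :
    ∃ h C : ℝ, 0 < h ∧ 0 ≤ C ∧ ∀ (f : GSSpace d t s) (B : ℝ), 0 ≤ B → GSBound t s h B (toSm f) →
      ‖u.pair f‖ ≤ C * B := by
  obtain ⟨h, hh, C, H⟩ := u.2
  refine ⟨h, C, hh, C.2, fun f B hB hf => ?_⟩
  have hle : ‖u.pair f‖ₑ ≤ C * ENNReal.ofReal B :=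
    (H f).trans (mul_le_mul_right (hf.gsNorm_le hh) _)
  rw [← ofReal_norm, ← ENNReal.ofReal_coe_nnreal, ← ENNReal.ofReal_mul (p := (C : ℝ)) C.2] at hle
  exact (ENNReal.ofReal_le_ofReal_iff (by positivity)).1 hle

lemma GSDual.exists_pair_eq {t s : ℝ} (L : GSSpace d t s →ₗ⋆[ℂ] ℂ)
    (H : ∃ h C : ℝ, 0 < h ∧ 0 ≤ C ∧ ∀ (f : GSSpace d t s) (B : ℝ), 0 ≤ B →
      GSBound t s h B (toSm f) → ‖L f‖ ≤ C * B) : ∃ u : GSDual d t s, ∀ φ, u.pair φ = L φ := by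
  obtain ⟨h, C, hh, hC, H⟩ := H
  refine ⟨⟨L, h, hh, C.toNNReal, fun f => ?_⟩, fun _ => rfl⟩
  have hfin := f.2.2 h hh
  rw [← ofReal_norm]
  calc ENNReal.ofReal ‖L f‖ ≤ ENNReal.ofReal (C * (gsNorm t s h f.1).toReal) :=
        ENNReal.ofReal_le_ofReal
          (H f _ ENNReal.toReal_nonneg (gsBound_toReal_gsNorm hh (toSm f) hfin))
    _ = C.toNNReal * gsNorm t s h f.1 := by
        rw [ENNReal.ofReal_mul hC, ENNReal.ofReal_toReal hfin.ne, ENNReal.ofReal]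

lemma GSDual.ext_pair {t s : ℝ} {u v : GSDual d t s} (h : ∀ φ, u.pair φ = v.pair φ) : u = v :=
  Subtype.ext (LinearMap.ext h)

/-! ### Exponential decay -/

lemma mpow_add (α β : Fin d → ℕ) (x : E d) : mpow (α + β) x = mpow α x * mpow β x := by
  simp [mpow, pow_add, Finset.prod_mul_distrib]

lemma mpow_single (i : Fin d) (n : ℕ) (x : E d) : mpow (Pi.single i n) x = x i ^ n := by
  rw [mpow, Finset.prod_eq_single i (fun j _ hj => by simp [hj]) (by simp), Pi.single_eq_same]

lemma mpow_zero (x : E d) : mpow 0 x = 1 := by simp [mpow]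

lemma mlen_single (i : Fin d) (n : ℕ) : mlen (Pi.single i n) = n := by simp [mlen]

lemma mlen_add (α β : Fin d → ℕ) : mlen (α + β) = mlen α + mlen β := by
  simp [mlen, Finset.sum_add_distrib]

lemma mfact_single (i : Fin d) (n : ℕ) : mfact (Pi.single i n) = n.factorial := by
  rw [mfact, Finset.prod_eq_single i (fun j _ hj => by simp [hj]) (by simp), Pi.single_eq_same]

lemma mlen_zero : mlen (0 : Fin d → ℕ) = 0 := by simp [mlen]

lemma mfact_zero : mfact (0 : Fin d → ℕ) = 1 := by simp [mfact]

lemma wt_zero (t s h : ℝ) : wt t s h (0 : Fin d → ℕ) 0 = 1 := by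
  simp [wt, mlen_zero, mfact_zero]

lemma exists_norm_le_mul_abs_coord [NeZero d] (x : E d) : ∃ i, ‖x‖ ≤ d * |x i| := by
  obtain ⟨i, -, hi⟩ := Finset.exists_max_image Finset.univ (fun i => |x i|)
    ⟨0, Finset.mem_univ _⟩
  have expansion : x = ∑ j, EuclideanSpace.single j (x j) := by
    ext k
    simp [Finset.sum_apply, Pi.single_apply]
  refine ⟨i, ?_⟩
  calc ‖x‖ = ‖∑ j, EuclideanSpace.single j (x j)‖ := by rw [← expansion]
    _ ≤ ∑ j, ‖EuclideanSpace.single j (x j)‖ := norm_sum_le _ _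
    _ = ∑ j, |x j| := by simp
    _ ≤ ∑ _j : Fin d, |x i| := Finset.sum_le_sum fun j hj => hi j hj
    _ = d * |x i| := by simp

/- Take `t`-th roots, divide by `2 ^ n n!` and sum the exponential series. -/
lemma mul_exp_le_of_forall_pow_mul_le {t a B y : ℝ} (ht : 0 < t) (ha : 0 ≤ a) (hB : 0 ≤ B)
    (hy : 0 ≤ y) (H : ∀ n : ℕ, y ^ n * a ≤ B * (n.factorial : ℝ) ^ t) :
    a * Real.exp (t / 2 * y ^ (1 / t)) ≤ 2 ^ t * B := by
  set b := y ^ (1 / t) with hb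
  have : 0 ≤ b := by positivity
  have root_bound : ∀ n : ℕ, b ^ n * a ^ (1 / t) ≤ B ^ (1 / t) * n.factorial := fun n => by
    have := Real.rpow_le_rpow (by positivity) (H n) (by positivity : 0 ≤ 1 / t)
    rwa [Real.mul_rpow (by positivity) ha, Real.mul_rpow hB (by positivity),
      ← Real.rpow_mul (Nat.cast_nonneg _), mul_one_div_cancel ht.ne', Real.rpow_one,
      ← Real.rpow_natCast, ← Real.rpow_mul hy, mul_comm (n : ℝ), Real.rpow_mul hy,
      Real.rpow_natCast, ← hb] at this
  have term_le : ∀ n : ℕ,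
      (b / 2) ^ n / n.factorial * a ^ (1 / t) ≤ B ^ (1 / t) * (1 / 2) ^ n := fun n => by
    have : (0 : ℝ) < n.factorial := by exact_mod_cast Nat.factorial_pos n
    rw [div_pow, div_pow, one_pow, div_div, div_mul_eq_mul_div, div_le_iff₀ (by positivity)]
    refine (root_bound n).trans (le_of_eq ?_)
    field_simp
  have hexp : HasSum (fun n : ℕ => (b / 2) ^ n / n.factorial) (Real.exp (b / 2)) := by
    rw [Real.exp_eq_exp_ℝ]
    exact NormedSpace.expSeries_div_hasSum_exp (b / 2)
  have root_le : Real.exp (b / 2) * a ^ (1 / t) ≤ B ^ (1 / t) * 2 :=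
    hasSum_le term_le (hexp.mul_right _) (hasSum_geometric_two.mul_left _)
  calc a * Real.exp (t / 2 * b) = (Real.exp (b / 2) * a ^ (1 / t)) ^ t := by
        rw [Real.mul_rpow (by positivity) (by positivity), ← Real.rpow_mul ha,
          one_div_mul_cancel ht.ne', Real.rpow_one, ← Real.exp_mul]
        ring_nf
    _ ≤ (B ^ (1 / t) * 2) ^ t := Real.rpow_le_rpow (by positivity) root_le ht.le
    _ = 2 ^ t * B := by
        rw [Real.mul_rpow (by positivity) (by positivity), ← Real.rpow_mul hB,
          one_div_mul_cancel ht.ne', Real.rpow_one, mul_comm]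

lemma exists_forall_le_exp_neg_of_coord {t r : ℝ} (ht : 0 < t) (hr : 0 < r) :
    ∃ h : ℝ, 0 < h ∧ ∀ (x : E d) (a B : ℝ), 0 ≤ a → a ≤ B →
      (∀ (i : Fin d) (n : ℕ), |x i| ^ n * a ≤ B * (h ^ n * (n.factorial : ℝ) ^ t)) →
        a ≤ 2 ^ t * B * Real.exp (-r * ‖x‖ ^ (1 / t)) := by
  rcases Nat.eq_zero_or_pos d with rfl | hd
  · refine ⟨1, one_pos, fun x a B ha hB _ => ?_⟩
    rw [Subsingleton.elim x 0, norm_zero, Real.zero_rpow (by positivity), mul_zero, Real.exp_zero,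
      mul_one]
    exact hB.trans (le_mul_of_one_le_left (ha.trans hB) (Real.one_le_rpow one_le_two ht.le))
  have : NeZero d := ⟨hd.ne'⟩
  set h := (t / (2 * r)) ^ t / d with h_def
  have hh : 0 < h := by positivity
  refine ⟨h, hh, fun x a B ha hB H => ?_⟩
  obtain ⟨i, hi⟩ := exists_norm_le_mul_abs_coord x
  have coord_decay : a * Real.exp (t / 2 * (|x i| / h) ^ (1 / t)) ≤ 2 ^ t * B := by
    refine mul_exp_le_of_forall_pow_mul_le ht ha (ha.trans hB) (by positivity) fun n => ?_
    rw [div_pow, div_mul_eq_mul_div, div_le_iff₀ (by positivity)]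
    exact (H i n).trans (le_of_eq (by ring))
  have exponent_eq : t / 2 * (|x i| / h) ^ (1 / t) = r * (d * |x i|) ^ (1 / t) := by
    have : |x i| / h = d * |x i| / (t / (2 * r)) ^ t := by rw [h_def]; field_simp
    rw [this, Real.div_rpow (by positivity) (by positivity), ← Real.rpow_mul (by positivity),
      mul_one_div_cancel ht.ne', Real.rpow_one]
    field_simp
  rw [neg_mul, Real.exp_neg, ← div_eq_mul_inv, le_div_iff₀ (Real.exp_pos _)]
  refine le_trans ?_ coord_decay
  rw [exponent_eq]
  gcongr

lemma GSBound.norm_le {t s h B : ℝ} {f : Sm d} (hf : GSBound t s h B f) (x : E d) :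
    ‖f.1 x‖ ≤ B := by
  have := hf 0 0 x
  rwa [mpow_zero, md_zero, wt_zero, mul_one, Complex.ofReal_one, one_mul] at this

lemma exists_norm_le_mul_exp_neg {t s : ℝ} (ht : 0 < t) (f : GSSpace d t s) {r : ℝ}
    (hr : 0 < r) : ∃ C : ℝ, 0 ≤ C ∧ ∀ x, ‖f.1 x‖ ≤ C * Real.exp (-r * ‖x‖ ^ (1 / t)) := by
  obtain ⟨h, hh, H⟩ := exists_forall_le_exp_neg_of_coord (d := d) ht hr
  obtain ⟨B, hB, hf⟩ := exists_gsBound f hh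
  refine ⟨2 ^ t * B, by positivity, fun x =>
    H x _ B (norm_nonneg _) (hf.norm_le x) fun i n => ?_⟩
  have := hf (Pi.single i n) 0 x
  rw [mpow_single, md_zero, norm_mul, wt_eq, mlen_single, mfact_single, mlen_zero,
    mfact_zero] at this
  change ‖_‖ * ‖f.1 x‖ ≤ _ at this
  simpa using this

lemma integrable_norm_pow_mul_exp_neg_rpow {F : Type*} [NormedAddCommGroup F] [NormedSpace ℝ F]
    [FiniteDimensional ℝ F] [MeasurableSpace F] [BorelSpace F] (μ : Measure F)
    [μ.IsAddHaarMeasure] (n : ℕ) {p r : ℝ} (hp : 0 < p) (hr : 0 < r) :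
    Integrable (fun x : F => ‖x‖ ^ n * Real.exp (-r * ‖x‖ ^ p)) μ := by
  rcases subsingleton_or_nontrivial F with _ | _
  · exact .of_subsingleton
  set k := Module.finrank ℝ F - 1 with hk_def
  have hk : (-1 : ℝ) < (k + n : ℕ) := neg_one_lt_zero.trans_le (Nat.cast_nonneg _)
  refine (integrable_fun_norm_addHaar μ (f := fun y => y ^ n * Real.exp (-r * y ^ p))).2
    ((integrableOn_rpow_mul_exp_neg_mul_rpow hk hp hr).congr_fun (fun y _ => ?_)
      measurableSet_Ioi)
  simp only [← hk_def, Real.rpow_natCast, pow_add, smul_eq_mul, mul_assoc]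

lemma integrable_exp_neg_rpow {p r : ℝ} (hp : 0 < p) (hr : 0 < r) :
    Integrable fun x : E d => Real.exp (-r * ‖x‖ ^ p) := by
  simpa using integrable_norm_pow_mul_exp_neg_rpow (F := E d) volume 0 hp hr

lemma integrable_one_add_norm_pow_inv : Integrable fun x : E d => ((1 + ‖x‖) ^ (d + 1))⁻¹ := by
  refine (integrable_one_add_norm (E := E d) (μ := volume) (r := d + 1) (by simp)).congr
    (Filter.Eventually.of_forall fun x => ?_)
  simp only
  rw [Real.rpow_neg (by positivity)]
  exact_mod_cast congrArg (·⁻¹) (Real.rpow_natCast (1 + ‖x‖) (d + 1))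

lemma norm_add_rpow_le {F : Type*} [SeminormedAddGroup F] {p : ℝ} (hp : 0 ≤ p) (x y : F) :
    ‖x + y‖ ^ p ≤ 2 ^ p * (‖x‖ ^ p + ‖y‖ ^ p) := by
  have hmax : ‖x + y‖ ≤ 2 * max ‖x‖ ‖y‖ := (norm_add_le x y).trans (by
    linarith [le_max_left ‖x‖ ‖y‖, le_max_right ‖x‖ ‖y‖])
  have hmax_rpow : max ‖x‖ ‖y‖ ^ p ≤ ‖x‖ ^ p + ‖y‖ ^ p := by
    rcases max_choice ‖x‖ ‖y‖ with h | h <;> rw [h]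
    · exact le_add_of_nonneg_right (by positivity)
    · exact le_add_of_nonneg_left (by positivity)
  calc ‖x + y‖ ^ p ≤ (2 * max ‖x‖ ‖y‖) ^ p := by gcongr
    _ = 2 ^ p * max ‖x‖ ‖y‖ ^ p := Real.mul_rpow zero_le_two (by positivity)
    _ ≤ _ := by gcongr

/-- The quasi-norm `‖x‖ ^ (1 / t) + ‖ξ‖ ^ (1 / s)` on phase space, which is homogeneous of degree
one for the dilations `(x, ξ) ↦ (λ ^ t x, λ ^ s ξ)`. -/
def rho (t s : ℝ) (z : E d × E d) : ℝ := ‖z.1‖ ^ (1 / t) + ‖z.2‖ ^ (1 / s)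

lemma rho_nonneg (t s : ℝ) (z : E d × E d) : 0 ≤ rho t s z := by
  unfold rho; positivity

lemma continuous_rho {t s : ℝ} (ht : 0 < t) (hs : 0 < s) : Continuous (rho (d := d) t s) :=
  (continuous_fst.norm.rpow_const fun _ => Or.inr (by positivity)).add
    (continuous_snd.norm.rpow_const fun _ => Or.inr (by positivity))

lemma rho_rpow_smul {t s l : ℝ} (ht : t ≠ 0) (hs : s ≠ 0) (hl : 0 ≤ l) (x ξ : E d) :
    rho t s (l ^ t • x, l ^ s • ξ) = l * rho t s (x, ξ) := by
  unfold rho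
  simp only [norm_smul, Real.norm_of_nonneg (Real.rpow_nonneg hl _)]
  rw [Real.mul_rpow (by positivity) (norm_nonneg _), Real.mul_rpow (by positivity) (norm_nonneg _),
    ← Real.rpow_mul hl, ← Real.rpow_mul hl, mul_one_div_cancel ht, mul_one_div_cancel hs,
    Real.rpow_one, mul_add]

lemma exists_rho_add_le {t s : ℝ} (ht : 0 ≤ t) (hs : 0 ≤ s) :
    ∃ K : ℝ, 1 ≤ K ∧ ∀ z w : E d × E d, rho t s (z + w) ≤ K * (rho t s z + rho t s w) := by
  have hK : (1 : ℝ) ≤ 2 ^ (1 / t) := Real.one_le_rpow one_le_two (by positivity)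
  refine ⟨max (2 ^ (1 / t)) (2 ^ (1 / s)), hK.trans (le_max_left _ _), fun z w => ?_⟩
  calc rho t s (z + w) ≤ 2 ^ (1 / t) * (‖z.1‖ ^ (1 / t) + ‖w.1‖ ^ (1 / t)) +
        2 ^ (1 / s) * (‖z.2‖ ^ (1 / s) + ‖w.2‖ ^ (1 / s)) :=
        add_le_add (norm_add_rpow_le (by positivity) _ _) (norm_add_rpow_le (by positivity) _ _)
    _ ≤ max (2 ^ (1 / t)) (2 ^ (1 / s)) * (‖z.1‖ ^ (1 / t) + ‖w.1‖ ^ (1 / t)) +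
        max (2 ^ (1 / t)) (2 ^ (1 / s)) * (‖z.2‖ ^ (1 / s) + ‖w.2‖ ^ (1 / s)) := by
        gcongr
        · exact le_max_left _ _
        · exact le_max_right _ _
    _ = _ := by unfold rho; ring

lemma integrable_exp_neg_rho {t s r : ℝ} (ht : 0 < t) (hs : 0 < s) (hr : 0 < r) :
    Integrable fun z : E d × E d => Real.exp (-r * rho t s z) := by
  refine ((integrable_exp_neg_rpow (d := d) (one_div_pos.2 ht) hr).mul_prod
    (integrable_exp_neg_rpow (d := d) (one_div_pos.2 hs) hr)).congr
      (Filter.Eventually.of_forall fun z => ?_)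
  simp only [rho]
  rw [← Real.exp_add, mul_add]

/-! ### Stability under derivatives and multiplication by polynomials -/

lemma sub_single_add_single {β : Fin d → ℕ} {i : Fin d} (hi : β i ≠ 0) :
    β - Pi.single i 1 + Pi.single i 1 = β :=
  tsub_add_cancel_of_le (update_le_iff.2 ⟨Nat.one_le_iff_ne_zero.2 hi, by simp⟩)

lemma multiindex_induction {P : (Fin d → ℕ) → Prop} (zero : P 0)
    (add_single : ∀ β i, P β → P (β + Pi.single i 1)) (β : Fin d → ℕ) : P β := by
  induction hn : mlen β generalizing β with
  | zero =>
    have hβ : β = 0 := funext fun i => Finset.sum_eq_zero_iff.1 hn i (Finset.mem_univ i)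
    exact hβ ▸ zero
  | succ n ih =>
    obtain ⟨i, hi⟩ : ∃ i, β i ≠ 0 := by
      by_contra! h
      simp [mlen, h] at hn
    have hlen := congrArg mlen (sub_single_add_single hi)
    rw [mlen_add, mlen_single, hn] at hlen
    rw [← sub_single_add_single hi]
    exact add_single _ _ (ih _ (Nat.add_right_cancel hlen))

lemma wt_swap (t s h : ℝ) (α β : Fin d → ℕ) : wt t s h α β = wt s t h β α := by
  rw [wt_eq, wt_eq, mul_comm]

lemma wt_zero_mul_wt (t s h : ℝ) (α γ β : Fin d → ℕ) :
    wt t s h α 0 * wt t s h γ β = wt t s h γ 0 * wt t s h α β := by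
  simp only [wt_eq]
  ring

lemma mfact_add_le (α γ : Fin d → ℕ) : mfact (α + γ) ≤ 2 ^ mlen (α + γ) * (mfact α * mfact γ) := by
  simp only [mfact, mlen, ← Finset.prod_pow_eq_pow_sum, ← Finset.prod_mul_distrib, Pi.add_apply]
  refine Finset.prod_le_prod' fun i _ => ?_
  rw [← Nat.add_choose_mul_factorial_mul_factorial, mul_assoc]
  exact Nat.mul_le_mul_right _ (Nat.choose_le_two_pow _ _)

lemma wt_add_left_le {t s h h' : ℝ} (ht : 0 ≤ t) (hh : 0 < h) (hh' : h ≤ h')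
    (α γ β : Fin d → ℕ) :
    wt t s (h / 2 ^ t) (α + γ) β ≤ wt t s h γ 0 * wt t s h' α β := by
  have h2t : (1 : ℝ) ≤ 2 ^ t := Real.one_le_rpow one_le_two ht
  have hfact : (mfact (α + γ) : ℝ) ^ t ≤
      (2 ^ t) ^ mlen (α + γ) * ((mfact α : ℝ) ^ t * (mfact γ : ℝ) ^ t) := by
    rw [← Real.rpow_natCast, ← Real.rpow_mul (by norm_num), mul_comm t,
      Real.rpow_mul (by norm_num), Real.rpow_natCast,
      ← Real.mul_rpow (by positivity) (by positivity),
      ← Real.mul_rpow (by positivity) (by positivity)]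
    exact Real.rpow_le_rpow (by positivity) (by exact_mod_cast mfact_add_le α γ) ht
  have := mfact_pos β
  calc wt t s (h / 2 ^ t) (α + γ) β
      ≤ ((h / 2 ^ t) ^ mlen (α + γ) *
          ((2 ^ t) ^ mlen (α + γ) * ((mfact α : ℝ) ^ t * (mfact γ : ℝ) ^ t))) *
        (h ^ mlen β * (mfact β : ℝ) ^ s) := by
        rw [wt_eq]
        gcongr
        exact div_le_self hh.le h2t
    _ = wt t s h γ 0 * wt t s h α β := by
        have hscale : (h / 2 ^ t) ^ mlen (α + γ) * (2 ^ t) ^ mlen (α + γ) =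
            h ^ mlen α * h ^ mlen γ := by
          rw [← mul_pow, div_mul_cancel₀ _ (by positivity), mlen_add, pow_add]
        rw [← mul_assoc ((h / 2 ^ t) ^ _), hscale, wt_eq, wt_eq, mlen_zero, mfact_zero]
        simp only [pow_zero, Nat.cast_one, Real.one_rpow]
        ring
    _ ≤ wt t s h γ 0 * wt t s h' α β :=
        mul_le_mul_of_nonneg_left (wt_mono hh.le hh' α β) (wt_pos hh γ 0).le

lemma gsBound_md {t s h B : ℝ} (hs : 0 ≤ s) (hh : 0 < h) (hB : 0 ≤ B) {f : Sm d}
    (hf : GSBound t s (h / 2 ^ s) B f) (γ : Fin d → ℕ) :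
    GSBound t s h (B * wt t s h 0 γ) (md γ f) := fun α β x => by
  have hwt : wt t s (h / 2 ^ s) α (β + γ) ≤ wt t s h 0 γ * wt t s h α β := by
    simpa only [wt_swap t s] using wt_add_left_le (s := t) hs hh le_rfl β γ α
  rw [← Module.End.mul_apply, ← md_add, mul_assoc]
  exact (hf α (β + γ) x).trans (mul_le_mul_of_nonneg_left hwt hB)

/- The operators `x ^ α ∂ ^ β x ^ γ` are controlled by interchanging `∂ ^ β` and `x ^ γ` in the
presence of the weight `|x ^ α|`. -/
lemma exists_gsBound_mulMonomial {t s : ℝ} (ht : 0 ≤ t) (hs : 0 ≤ s) (hst : 1 < s + t) {h : ℝ}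
    (hh : 0 < h) : ∃ h' K : ℝ, 0 < h' ∧ 0 ≤ K ∧ ∀ (f : Sm d) (B : ℝ), 0 ≤ B →
      GSBound t s h' B f → ∀ γ, GSBound t s h (K * B * wt t s h γ 0) (mulMonomial γ f) := by
  obtain ⟨k, K, hk, hK, H⟩ := OpBound.mixedOp (d := d) ht hs hst Finset.univ h hh
  refine ⟨min h k / 2 ^ t, K, by positivity, hK, fun f B hB hf γ α β x => ?_⟩
  have weighted : OpBound (fun x => ‖(mpow α x : ℂ)‖) t s k (B * wt t s h α 0)
      (fun α β => mulMonomial α * md β) f := fun γ β x => by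
    have hα := mul_le_mul_of_nonneg_right (wt_mono (t := t) (s := s) (by positivity)
      (min_le_left h k) α 0) (wt_pos (t := t) (s := s) hk γ β).le
    rw [Module.End.mul_apply, mulMonomial_apply, ← norm_mul, ← mul_assoc, ← Complex.ofReal_mul,
      ← mpow_add, add_comm, mul_assoc]
    exact (hf (γ + α) β x).trans (mul_le_mul_of_nonneg_left
      ((wt_add_left_le ht (by positivity) (min_le_right h k) γ α β).trans hα) hB)
  have := H _ (fun x => norm_nonneg _) _ (mul_nonneg hB (wt_pos hh α 0).le) f weighted γ β x
  rw [mixedOp_univ, Module.End.mul_apply, ← norm_mul] at this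
  calc _ ≤ _ := this
    _ = K * B * (wt t s h α 0 * wt t s h γ β) := by ring
    _ = _ := by
        rw [wt_zero_mul_wt]
        ring

lemma md_mem_gsSpace {t s : ℝ} (hs : 0 ≤ s) {f : Sm d} (hf : f.1 ∈ GSSpace d t s)
    (γ : Fin d → ℕ) : (md γ f).1 ∈ GSSpace d t s := by
  refine mem_gsSpace_of_gsBound _ fun h hh => ?_
  obtain ⟨B, hB, hfB⟩ := exists_gsBound ⟨f.1, hf⟩ (h := h / 2 ^ s) (by positivity)
  exact ⟨_, gsBound_md hs hh hB hfB γ⟩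

lemma mulMonomial_mem_gsSpace {t s : ℝ} (ht : 0 ≤ t) (hs : 0 ≤ s) (hst : 1 < s + t) {f : Sm d}
    (hf : f.1 ∈ GSSpace d t s) (γ : Fin d → ℕ) : (mulMonomial γ f).1 ∈ GSSpace d t s := by
  refine mem_gsSpace_of_gsBound _ fun h hh => ?_
  obtain ⟨h', K, hh', -, H⟩ := exists_gsBound_mulMonomial (d := d) ht hs hst hh
  obtain ⟨B, hB, hfB⟩ := exists_gsBound ⟨f.1, hf⟩ hh'
  exact ⟨_, H f B hB hfB γ⟩

lemma mulMonomial_zero : mulMonomial (0 : Fin d → ℕ) = 1 := by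
  ext f x
  rw [mulMonomial_apply, mpow_zero, Complex.ofReal_one, one_mul, Module.End.one_apply]

lemma mulMonomial_single (i : Fin d) : mulMonomial (Pi.single i 1) = mulX i := by
  ext f x
  rw [mulMonomial_apply, mpow_single, pow_one, mulX_apply]

lemma mulMonomial_add_single (β : Fin d → ℕ) (i : Fin d) :
    mulMonomial (β + Pi.single i 1) = mulX i * mulMonomial β := by
  ext f x
  rw [mulMonomial_apply, Module.End.mul_apply, mulX_apply, mulMonomial_apply, mpow_add,
    mpow_single, pow_one, Complex.ofReal_mul, mul_right_comm, mul_assoc, mul_left_comm]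
  ring

lemma pd_mem_gsSpace {t s : ℝ} (hs : 0 ≤ s) {f : Sm d} (hf : f.1 ∈ GSSpace d t s) (i : Fin d) :
    (pd i f).1 ∈ GSSpace d t s := by
  simpa only [md_single, pow_one] using md_mem_gsSpace hs hf (Pi.single i 1)

lemma mulX_mem_gsSpace {t s : ℝ} (ht : 0 ≤ t) (hs : 0 ≤ s) (hst : 1 < s + t) {f : Sm d}
    (hf : f.1 ∈ GSSpace d t s) (i : Fin d) : (mulX i f).1 ∈ GSSpace d t s := by
  simpa only [mulMonomial_single] using mulMonomial_mem_gsSpace ht hs hst hf (Pi.single i 1)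

lemma one_add_norm_pow_le (N : ℕ) (x : E d) :
    (1 + ‖x‖) ^ N ≤ 2 ^ N * (1 + ∑ i, (d * |x i|) ^ N) := by
  have hnorm : ‖x‖ ^ N ≤ 1 + ∑ i, (d * |x i|) ^ N := by
    rcases Nat.eq_zero_or_pos d with rfl | hd
    · rw [Subsingleton.elim x 0, norm_zero]
      exact (pow_le_one₀ le_rfl zero_le_one).trans (le_add_of_nonneg_right (by positivity))
    · have : NeZero d := ⟨hd.ne'⟩
      obtain ⟨i, hi⟩ := exists_norm_le_mul_abs_coord x
      calc ‖x‖ ^ N ≤ (d * |x i|) ^ N := by gcongr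
        _ ≤ ∑ i, (d * |x i|) ^ N :=
          Finset.single_le_sum (f := fun i => (d * |x i|) ^ N) (fun _ _ => by positivity)
            (Finset.mem_univ i)
        _ ≤ _ := le_add_of_nonneg_left zero_le_one
  rcases N with _ | N
  · simp only [pow_zero, one_mul]
    exact le_add_of_nonneg_right (by positivity)
  have hsum : (0 : ℝ) ≤ ∑ i, (d * |x i|) ^ (N + 1) := by positivity
  calc (1 + ‖x‖) ^ (N + 1) ≤ 2 ^ N * (1 ^ (N + 1) + ‖x‖ ^ (N + 1)) :=
        add_pow_le zero_le_one (norm_nonneg x) (N + 1)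
    _ ≤ 2 ^ N * (2 * (1 + ∑ i, (d * |x i|) ^ (N + 1))) := by
        gcongr
        linarith [one_pow (M := ℝ) (N + 1)]
    _ = _ := by ring

lemma exists_opBound_one_add_norm_pow {t s h : ℝ} (ht : 0 ≤ t) (hh : 0 < h) (N : ℕ) :
    ∃ h' K : ℝ, 0 < h' ∧ 0 ≤ K ∧ ∀ (f : Sm d) (B : ℝ), 0 ≤ B → GSBound t s h' B f →
      OpBound (fun x => (1 + ‖x‖) ^ N) t s h (K * B) (fun α β => mulMonomial α * md β) f := by
  set c := h ^ N * (N.factorial : ℝ) ^ t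
  have : 0 ≤ c := by positivity
  have hwt : ∀ i : Fin d, wt t s h (Pi.single i N) 0 = c := fun i => by
    rw [wt_eq, mlen_single, mfact_single, mlen_zero, mfact_zero, Nat.cast_one, Real.one_rpow,
      pow_zero, mul_one, mul_one]
  refine ⟨h / 2 ^ t, 2 ^ N * (1 + d * (d ^ N * c)), by positivity, by positivity,
    fun f B hB hf α β x => ?_⟩
  set W := wt t s h α β
  rw [Module.End.mul_apply, mulMonomial_apply]
  set A := ‖(mpow α x : ℂ) * (md β f).1 x‖ with hA
  have : 0 ≤ A := norm_nonneg _
  have bound : A ≤ B * W := (hf α β x).trans (mul_le_mul_of_nonneg_left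
    (wt_mono (by positivity) (div_le_self hh.le (Real.one_le_rpow one_le_two ht)) _ _) hB)
  have coord_bound : ∀ i, |x i| ^ N * A ≤ B * (c * W) := fun i => by
    have := hf (α + Pi.single i N) β x
    rw [mpow_add, mpow_single, mul_comm (mpow α x), Complex.ofReal_mul, mul_assoc, norm_mul,
      ← hA, Complex.norm_real, Real.norm_eq_abs, abs_pow] at this
    rw [← hwt i]
    exact this.trans (mul_le_mul_of_nonneg_left (wt_add_left_le ht hh le_rfl _ _ _) hB)
  calc (1 + ‖x‖) ^ N * A ≤ 2 ^ N * (1 + ∑ i, (d * |x i|) ^ N) * A := by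
        gcongr
        exact one_add_norm_pow_le N x
    _ = 2 ^ N * (A + ∑ i, d ^ N * (|x i| ^ N * A)) := by
        simp only [mul_pow, mul_assoc, add_mul, one_mul, Finset.sum_mul]
    _ ≤ 2 ^ N * (B * W + ∑ _i : Fin d, d ^ N * (B * (c * W))) := by
        gcongr 2 ^ N * (?_ + ∑ i, (d : ℝ) ^ N * ?_) with i
        exact coord_bound i
    _ = _ := by
        rw [Finset.sum_const, Finset.card_univ, Fintype.card_fin, nsmul_eq_mul]
        ring

/-! ### The Fourier transform -/

/-- The normalizing constant `(2π) ^ (-d / 2)` of the Fourier transform and of the short-time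
Fourier transform. -/
def fourierConst (d : ℕ) : ℝ := (2 * Real.pi) ^ (-(d : ℝ) / 2)

lemma fourierConst_pos (d : ℕ) : 0 < fourierConst d := by
  unfold fourierConst
  positivity

lemma fourierConst_mul_self (d : ℕ) : fourierConst d * fourierConst d * (2 * Real.pi) ^ d = 1 := by
  rw [fourierConst, ← Real.rpow_natCast, ← Real.rpow_add (by positivity),
    ← Real.rpow_add (by positivity), show -(d : ℝ) / 2 + -(d : ℝ) / 2 + d = 0 by ring,
    Real.rpow_zero]

lemma fourierFun_eq_fourier (f : E d → ℂ) :
    fourierFun f = fun ξ => (fourierConst d : ℂ) * 𝓕 f ((2 * Real.pi)⁻¹ • ξ) := by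
  ext ξ
  rw [Real.fourier_eq']
  refine congrArg _ (integral_congr_ae (.of_forall fun x => ?_))
  have := Real.pi_ne_zero
  simp only [inner_smul_right, smul_eq_mul]
  rw [mul_comm]
  congr 2
  push_cast
  field_simp

lemma fourierConst_sq_mul_integral_comp (F : E d → ℂ) :
    (fourierConst d : ℂ) * fourierConst d * ∫ ξ, F ((2 * Real.pi)⁻¹ • ξ) = ∫ ξ, F ξ := by
  have hconst : (fourierConst d : ℂ) * fourierConst d * (((2 * Real.pi) ^ d : ℝ) : ℂ) = 1 :=
    mod_cast fourierConst_mul_self d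
  rw [Measure.integral_comp_inv_smul, finrank_euclideanSpace_fin, abs_of_nonneg (by positivity),
    Complex.real_smul, ← mul_assoc, hconst, one_mul]

lemma norm_fourierFun_le (f : E d → ℂ) (ξ : E d) :
    ‖fourierFun f ξ‖ ≤ fourierConst d * ∫ x, ‖f x‖ := by
  rw [fourierFun_eq_fourier, norm_mul, Complex.norm_real,
    Real.norm_of_nonneg (fourierConst_pos d).le]
  exact mul_le_mul_of_nonneg_left (VectorFourier.norm_fourierIntegral_le_integral_norm _ _ _ _ _)
    (fourierConst_pos d).le

lemma continuous_of_mem_gsSpace {t s : ℝ} {f : E d → ℂ} (hf : f ∈ GSSpace d t s) : Continuous f :=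
  hf.1.continuous

lemma integrable_norm_pow_mul_of_mem_gsSpace {t s : ℝ} (ht : 0 < t) {f : E d → ℂ}
    (hf : f ∈ GSSpace d t s) (n : ℕ) : Integrable fun x => ‖x‖ ^ n * ‖f x‖ := by
  obtain ⟨C, -, decay⟩ := exists_norm_le_mul_exp_neg ht ⟨f, hf⟩ one_pos
  refine ((integrable_norm_pow_mul_exp_neg_rpow volume n (one_div_pos.2 ht) one_pos).const_mul
    C).mono' ?_ (.of_forall fun x => ?_)
  · exact ((continuous_norm.pow n).mul (continuous_of_mem_gsSpace hf).norm).aestronglyMeasurable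
  · rw [Real.norm_of_nonneg (by positivity), mul_left_comm]
    exact mul_le_mul_of_nonneg_left (decay x) (by positivity)

lemma integrable_of_mem_gsSpace {t s : ℝ} (ht : 0 < t) {f : E d → ℂ} (hf : f ∈ GSSpace d t s) :
    Integrable f :=
  (integrable_norm_iff (continuous_of_mem_gsSpace hf).aestronglyMeasurable).1
    (by simpa using integrable_norm_pow_mul_of_mem_gsSpace ht hf 0)

/-- The Fourier transform of a test function, as a smooth function. -/
def fourierSm {t s : ℝ} (ht : 0 < t) (f : Sm d) (hf : f.1 ∈ GSSpace d t s) : Sm d :=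
  ⟨fourierFun f.1, by
    rw [fourierFun_eq_fourier]
    exact contDiff_const.mul ((Real.contDiff_fourier (N := ⊤) fun n _ =>
      integrable_norm_pow_mul_of_mem_gsSpace ht hf n).comp (contDiff_const_smul _))⟩

lemma fourierFun_smul (c : ℂ) (f : E d → ℂ) (ξ : E d) :
    fourierFun (c • f) ξ = c * fourierFun f ξ := by
  simp only [fourierFun, Pi.smul_apply, smul_eq_mul, mul_assoc, integral_const_mul]
  ring

lemma fourierFun_add {f g : E d → ℂ} (hf : Integrable f) (hg : Integrable g) (ξ : E d) :
    fourierFun (f + g) ξ = fourierFun f ξ + fourierFun g ξ := by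
  simp only [fourierFun_eq_fourier, ← mul_add, Real.fourier_eq, Pi.add_apply, smul_add]
  rw [integral_add ((Real.fourierIntegral_convergent_iff _).2 hf)
    ((Real.fourierIntegral_convergent_iff _).2 hg)]

lemma inner_single_one (x : E d) (i : Fin d) :
    inner ℝ x (EuclideanSpace.single i (1 : ℝ)) = x i := by
  simp [EuclideanSpace.inner_single_right]

lemma fourierSMulRight_innerSL_single (f : E d → ℂ) (x : E d) (i : Fin d) :
    VectorFourier.fourierSMulRight (innerSL ℝ) f x (EuclideanSpace.single i 1) =
      -(2 * Real.pi * Complex.I) * (x i * f x) := by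
  rw [← inner_single_one x i]
  rfl

lemma pd_fourierSm {t s : ℝ} (ht : 0 < t) (f : Sm d) (hf : f.1 ∈ GSSpace d t s) (i : Fin d)
    (hg : (mulX i f).1 ∈ GSSpace d t s) :
    pd i (fourierSm ht f hf) = -Complex.I • fourierSm ht (mulX i f) hg := by
  ext ξ
  have hint := integrable_norm_pow_mul_of_mem_gsSpace ht hf 1
  have hint' : Integrable (VectorFourier.fourierSMulRight (innerSL ℝ) f.1) :=
    (hint.const_mul (2 * Real.pi * ‖innerSL ℝ (E := E d)‖)).mono'
      (continuous_of_mem_gsSpace hf).aestronglyMeasurable.fourierSMulRight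
      (.of_forall fun x => (VectorFourier.norm_fourierSMulRight_le _ _ _).trans_eq
        (by rw [pow_one, mul_assoc]))
  have hderiv : HasFDerivAt (𝓕 f.1) _ ((2 * Real.pi)⁻¹ • ξ) :=
    Real.hasFDerivAt_fourier (integrable_of_mem_gsSpace ht hf) (by simpa only [pow_one] using hint)
      _
  have hmulX : (2 * Real.pi)⁻¹ • 𝓕 (VectorFourier.fourierSMulRight (innerSL ℝ) f.1)
      ((2 * Real.pi)⁻¹ • ξ) (EuclideanSpace.single i 1) =
      -Complex.I * 𝓕 (mulX i f).1 ((2 * Real.pi)⁻¹ • ξ) := by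
    rw [Real.fourier_continuousLinearMap_apply hint', Real.fourier_eq, Real.fourier_eq,
      ← integral_smul, ← integral_const_mul]
    refine integral_congr_ae (.of_forall fun x => ?_)
    have := Real.pi_ne_zero
    simp only [mulX_apply, fourierSMulRight_innerSL_single, Circle.smul_def, smul_eq_mul,
      Complex.real_smul]
    push_cast
    field_simp
  change fderiv ℝ (fourierFun f.1) ξ _ = -Complex.I * fourierFun (mulX i f).1 ξ
  simp only [fourierFun_eq_fourier]
  rw [mul_left_comm, ← hmulX, fderiv_const_mul, fderiv_comp_smul, hderiv.fderiv]
  · rfl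
  · exact hderiv.differentiableAt.comp ξ (differentiableAt_id.const_smul (2 * Real.pi)⁻¹)

lemma fderiv_apply_eq_sum_pd (f : Sm d) (x v : E d) :
    fderiv ℝ f.1 x v = ∑ j, v j • (pd j f).1 x := by
  have expansion : v = ∑ j, v j • EuclideanSpace.single j (1 : ℝ) := by
    ext k
    simp [Finset.sum_apply, Pi.single_apply]
  conv_lhs => rw [expansion, map_sum]
  exact Finset.sum_congr rfl fun j _ => map_smul _ _ _

lemma norm_fderiv_le_sum_pd (f : Sm d) (x : E d) : ‖fderiv ℝ f.1 x‖ ≤ ∑ j, ‖(pd j f).1 x‖ := by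
  refine ContinuousLinearMap.opNorm_le_bound _ (by positivity) fun v => ?_
  calc ‖fderiv ℝ f.1 x v‖ ≤ ∑ j, ‖v j • (pd j f).1 x‖ :=
        fderiv_apply_eq_sum_pd f x v ▸ norm_sum_le _ _
    _ ≤ ∑ j, ‖(pd j f).1 x‖ * ‖v‖ := Finset.sum_le_sum fun j _ => by
        rw [norm_smul, mul_comm]
        exact mul_le_mul_of_nonneg_left (PiLp.norm_apply_le v j) (norm_nonneg _)
    _ = _ := (Finset.sum_mul _ _ _).symm

lemma integrable_fderiv_of_mem_gsSpace {t s : ℝ} (ht : 0 < t) (hs : 0 ≤ s) {f : E d → ℂ}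
    (hf : f ∈ GSSpace d t s) : Integrable (fderiv ℝ f) :=
  (integrable_finsetSum Finset.univ fun j _ =>
    (integrable_of_mem_gsSpace ht (pd_mem_gsSpace hs (f := ⟨f, hf.1⟩) hf j)).norm).mono'
    (hf.1.continuous_fderiv (by simp)).aestronglyMeasurable
    (.of_forall (norm_fderiv_le_sum_pd ⟨f, hf.1⟩))

lemma fourierFun_pd {t s : ℝ} (ht : 0 < t) (hs : 0 ≤ s) (f : Sm d) (hf : f.1 ∈ GSSpace d t s)
    (i : Fin d) (ξ : E d) :
    fourierFun (pd i f).1 ξ = Complex.I * ξ i * fourierFun f.1 ξ := by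
  have hint := integrable_fderiv_of_mem_gsSpace ht hs hf
  have hfourier : 𝓕 (fderiv ℝ f.1) = VectorFourier.fourierSMulRight (-innerSL ℝ) (𝓕 f.1) :=
    Real.fourier_fderiv (integrable_of_mem_gsSpace ht hf) (differentiable_coe f) hint
  have hpd : 𝓕 (pd i f).1 ((2 * Real.pi)⁻¹ • ξ) =
      𝓕 (fderiv ℝ f.1) ((2 * Real.pi)⁻¹ • ξ) (EuclideanSpace.single i 1) :=
    (Real.fourier_continuousLinearMap_apply hint).symm
  simp only [fourierFun_eq_fourier]
  rw [hpd, hfourier, VectorFourier.fourierSMulRight_apply, neg_apply, neg_apply]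
  change (fourierConst d : ℂ) *
    (-(2 * Real.pi * Complex.I) • -(inner ℝ ((2 * Real.pi)⁻¹ • ξ) (EuclideanSpace.single i 1)) •
      𝓕 f.1 ((2 * Real.pi)⁻¹ • ξ)) = _
  have := Real.pi_ne_zero
  rw [inner_single_one, PiLp.smul_apply]
  simp only [smul_eq_mul, Complex.real_smul]
  push_cast
  field_simp

lemma md_fourierSm {t s : ℝ} (ht : 0 < t) (hs : 0 ≤ s) (hst : 1 < s + t) (f : Sm d)
    (hf : f.1 ∈ GSSpace d t s) (β : Fin d → ℕ) :
    md β (fourierSm ht f hf) = (-Complex.I) ^ mlen β •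
      fourierSm ht (mulMonomial β f) (mulMonomial_mem_gsSpace ht.le hs hst hf β) := by
  induction β using multiindex_induction with
  | zero =>
    simp only [md_zero, mlen_zero, pow_zero, one_smul, mulMonomial_zero, Module.End.one_apply]
  | add_single β i ih =>
    simp only [md_add_single, Module.End.mul_apply, ih, map_smul, mlen_add, mlen_single, pow_succ,
      mulMonomial_add_single, mul_smul]
    rw [pd_fourierSm ht _ _ i (mulX_mem_gsSpace ht.le hs hst
      (mulMonomial_mem_gsSpace ht.le hs hst hf β) i)]

lemma fourierFun_md {t s : ℝ} (ht : 0 < t) (hs : 0 ≤ s) (f : Sm d) (hf : f.1 ∈ GSSpace d t s)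
    (α : Fin d → ℕ) (ξ : E d) :
    fourierFun (md α f).1 ξ = Complex.I ^ mlen α * mpow α ξ * fourierFun f.1 ξ := by
  induction α using multiindex_induction with
  | zero => simp [md_zero, mlen_zero, mpow_zero]
  | add_single α i ih =>
    rw [md_add_single, Module.End.mul_apply, fourierFun_pd ht hs _ (md_mem_gsSpace hs hf α), ih,
      mlen_add, mlen_single, pow_succ, mpow_add, mpow_single]
    push_cast
    ring

lemma norm_mpow_mul_md_fourierSm {t s : ℝ} (ht : 0 < t) (hs : 0 ≤ s) (hst : 1 < s + t) (f : Sm d)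
    (hf : f.1 ∈ GSSpace d t s) (α β : Fin d → ℕ) (ξ : E d) :
    ‖(mpow α ξ : ℂ) * (md β (fourierSm ht f hf)).1 ξ‖ =
      ‖fourierFun (md α (mulMonomial β f)).1 ξ‖ := by
  rw [fourierFun_md ht hs _ (mulMonomial_mem_gsSpace ht.le hs hst hf β), md_fourierSm ht hs hst]
  change ‖(mpow α ξ : ℂ) * ((-Complex.I) ^ mlen β * fourierFun (mulMonomial β f).1 ξ)‖ = _
  simp

/- Continuity of the Fourier transform: `ξ ^ α ∂ ^ β` of the transform is the transform of
`∂ ^ α x ^ β f`, and its `L¹` norm is a weighted sup norm. -/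
lemma exists_gsBound_fourierSm {t s : ℝ} (ht : 0 < t) (hs : 0 ≤ s) (hst : 1 < s + t) {h : ℝ}
    (hh : 0 < h) : ∃ h' K : ℝ, 0 < h' ∧ 0 ≤ K ∧
      ∀ (f : Sm d) (hf : f.1 ∈ GSSpace d t s) (B : ℝ), 0 ≤ B →
        GSBound t s h' B f → GSBound s t h (K * B) (fourierSm ht f hf) := by
  obtain ⟨h₁, K₁, hh₁, hK₁, reorder⟩ := OpBound.mixedOp (d := d) ht.le hs hst Finset.univ h hh
  obtain ⟨h₂, K₂, hh₂, hK₂, weighted⟩ :=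
    exists_opBound_one_add_norm_pow (d := d) (s := s) ht.le hh₁ (d + 1)
  have := fourierConst_pos d
  set I := ∫ x : E d, ((1 + ‖x‖) ^ (d + 1))⁻¹
  have : 0 ≤ I := integral_nonneg fun x => by positivity
  refine ⟨h₂, fourierConst d * (K₁ * K₂ * I), hh₂, by positivity, fun f hf B hB hfB α β ξ => ?_⟩
  rw [norm_mpow_mul_md_fourierSm ht hs hst, wt_swap]
  set W := wt t s h β α
  have pointwise : ∀ x, ‖(md α (mulMonomial β f)).1 x‖ ≤
      K₁ * (K₂ * B) * W * ((1 + ‖x‖) ^ (d + 1))⁻¹ := fun x => by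
    have := reorder _ (fun x => by positivity) _ (by positivity) f (weighted f B hB hfB) β α x
    rw [mixedOp_univ, Module.End.mul_apply] at this
    rwa [← div_eq_mul_inv, le_div_iff₀ (by positivity), mul_comm]
  calc ‖fourierFun (md α (mulMonomial β f)).1 ξ‖
      ≤ fourierConst d * ∫ x, ‖(md α (mulMonomial β f)).1 x‖ := norm_fourierFun_le _ _
    _ ≤ fourierConst d * ∫ x, K₁ * (K₂ * B) * W * ((1 + ‖x‖) ^ (d + 1))⁻¹ := by
        refine mul_le_mul_of_nonneg_left ?_ (fourierConst_pos d).le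
        exact integral_mono_of_nonneg (.of_forall fun x => norm_nonneg _)
          (integrable_one_add_norm_pow_inv.const_mul _) (.of_forall pointwise)
    _ = fourierConst d * (K₁ * (K₂ * B) * W * I) := by rw [integral_const_mul]
    _ = fourierConst d * (K₁ * K₂ * I) * B * W := by ring

lemma fourierFun_mem_gsSpace {t s : ℝ} (ht : 0 < t) (hs : 0 ≤ s) (hst : 1 < s + t) {f : E d → ℂ}
    (hf : f ∈ GSSpace d t s) : fourierFun f ∈ GSSpace d s t := by
  refine mem_gsSpace_of_gsBound (fourierSm ht ⟨f, hf.1⟩ hf) fun h hh => ?_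
  obtain ⟨h', K, hh', -, H⟩ := exists_gsBound_fourierSm (d := d) ht hs hst hh
  obtain ⟨B, hB, hfB⟩ := exists_gsBound ⟨f, hf⟩ hh'
  exact ⟨_, H _ hf B hB hfB⟩

lemma integrable_fourier_of_fourierFun {f : E d → ℂ} (hf : Integrable (fourierFun f)) :
    Integrable (𝓕 f) := by
  rw [fourierFun_eq_fourier] at hf
  have hunit : IsUnit (fourierConst d : ℂ) :=
    isUnit_iff_ne_zero.2 (mod_cast (fourierConst_pos d).ne')
  exact (integrable_comp_smul_iff volume (𝓕 f) (by positivity)).1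
    ((integrable_const_mul_iff hunit _).1 hf)

lemma fourierFun_fourierFun_neg {f : E d → ℂ} (hc : Continuous f) (hf : Integrable f)
    (hf' : Integrable (fourierFun f)) (x : E d) : fourierFun (fourierFun f) (-x) = f x := by
  have inversion := congrFun (hc.fourierInv_fourier_eq hf (integrable_fourier_of_fourierFun hf')) x
  rw [Real.fourierInv_eq', ← fourierConst_sq_mul_integral_comp, mul_assoc,
    ← integral_const_mul] at inversion
  rw [fourierFun, ← inversion]
  refine congrArg _ (integral_congr_ae (.of_forall fun ξ => ?_))
  have := Real.pi_ne_zero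
  simp only [fourierFun_eq_fourier, inner_smul_left, inner_neg_right, conj_trivial, smul_eq_mul]
  rw [mul_assoc, mul_comm (𝓕 f _)]
  congr 3
  push_cast
  field_simp

lemma fourierFun_comp_neg (f : E d → ℂ) (ξ : E d) :
    fourierFun (fun x => f (-x)) ξ = fourierFun f (-ξ) := by
  unfold fourierFun
  rw [← integral_neg_eq_self]
  simp

lemma integral_conj_fourierFun_mul {f g : E d → ℂ} (hf : Integrable f) (hgc : Continuous g)
    (hg : Integrable g) (hg' : Integrable (fourierFun g)) :
    ∫ ξ, (starRingEnd ℂ) (fourierFun f ξ) * fourierFun g ξ = ∫ x, (starRingEnd ℂ) (f x) * g x := by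
  have hg'' := integrable_fourier_of_fourierFun hg'
  have plancherel : ∫ ξ, (starRingEnd ℂ) (𝓕 f ξ) * 𝓕 g ξ = ∫ x, (starRingEnd ℂ) (f x) * g x := by
    have := VectorFourier.integral_sesq_fourierIntegral_eq_neg_flip (L := innerₗ (E d))
      (innerSL ℂ) Real.continuous_fourierChar continuous_inner hf hg''
    rw [flip_innerₗ] at this
    change ∫ ξ, innerSL ℂ (𝓕 f ξ) (𝓕 g ξ) = ∫ x, innerSL ℂ (f x) (𝓕⁻ (𝓕 g) x) at this
    simpa only [hgc.fourierInv_fourier_eq hg hg'', innerSL_apply_apply, RCLike.inner_apply,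
      mul_comm] using this
  rw [← plancherel, ← fourierConst_sq_mul_integral_comp fun η => (starRingEnd ℂ) (𝓕 f η) * 𝓕 g η,
    ← integral_const_mul]
  congr 1 with ξ
  simp only [fourierFun_eq_fourier, map_mul, Complex.conj_ofReal]
  ring

/-! ### Linear changes of variables -/

/-- Composition `f ↦ f ∘ M` with a linear map, as an operator on smooth functions. -/
def compLin (M : E d →L[ℝ] E d) : Module.End ℂ (Sm d) where
  toFun f := ⟨fun y => f.1 (M y), (show ContDiff ℝ ∞ f.1 from f.2).comp M.contDiff⟩
  map_add' _ _ := rfl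
  map_smul' _ _ := rfl

/-- The derivative in the direction `M eᵢ`, as an operator on smooth functions. -/
def dirDeriv (M : E d →L[ℝ] E d) (i : Fin d) : Module.End ℂ (Sm d) :=
  ∑ j, ((M (EuclideanSpace.single i 1) j : ℝ) : ℂ) • pd j

lemma pd_mul_compLin (M : E d →L[ℝ] E d) (i : Fin d) :
    pd i * compLin M = compLin M * dirDeriv M i := by
  ext f x
  change fderiv ℝ (f.1 ∘ M) x (EuclideanSpace.single i 1) = (dirDeriv M i f).1 (M x)
  rw [fderiv_comp x (differentiable_coe f _) M.differentiableAt, M.fderiv,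
    ContinuousLinearMap.comp_apply, fderiv_apply_eq_sum_pd, dirDeriv, LinearMap.sum_apply,
    coe_sum_apply]
  exact Finset.sum_congr rfl fun j _ => Complex.real_smul

lemma norm_md_dirDeriv_le (M : E d →L[ℝ] E d) (i : Fin d) (γ : Fin d → ℕ) (f : Sm d) (x : E d) :
    ‖(md γ (dirDeriv M i f)).1 x‖ ≤ ‖M‖ * ∑ j, ‖(md (γ + Pi.single j 1) f).1 x‖ := by
  have coeff_le : ∀ j, ‖((M (EuclideanSpace.single i 1) j : ℝ) : ℂ)‖ ≤ ‖M‖ := fun j => by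
    rw [Complex.norm_real]
    refine (PiLp.norm_apply_le (M (EuclideanSpace.single i 1)) j).trans ?_
    simpa using M.le_opNorm (EuclideanSpace.single i (1 : ℝ))
  have hmd : ∀ j, md γ (pd j f) = md (γ + Pi.single j 1) f := fun j => by
    rw [md_add, md_single, pow_one, Module.End.mul_apply]
  rw [dirDeriv, LinearMap.sum_apply, map_sum, coe_sum_apply, Finset.mul_sum]
  refine (norm_sum_le _ _).trans (Finset.sum_le_sum fun j _ => ?_)
  rw [LinearMap.smul_apply, map_smul, hmd]
  exact (norm_mul_le _ _).trans (mul_le_mul_of_nonneg_right (coeff_le j) (norm_nonneg _))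

lemma exists_norm_md_compLin_le (M : E d →L[ℝ] E d) (β : Fin d → ℕ) (f : Sm d) (x : E d) :
    ∃ β' : Fin d → ℕ, mlen β' = mlen β ∧
      ‖(md β (compLin M f)).1 x‖ ≤ (d * ‖M‖) ^ mlen β * ‖(md β' f).1 (M x)‖ := by
  induction β using multiindex_induction generalizing f with
  | zero => exact ⟨0, rfl, by simp [md_zero, mlen_zero, compLin]⟩
  | add_single β i ih =>
    have hpd : md (β + Pi.single i 1) (compLin M f) = md β (compLin M (dirDeriv M i f)) := by
      rw [md_add, md_single, pow_one, ← Module.End.mul_apply, mul_assoc, pd_mul_compLin]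
      rfl
    obtain ⟨γ, hγ, hle⟩ := ih (dirDeriv M i f)
    obtain ⟨j, -, hj⟩ := Finset.exists_max_image Finset.univ
      (fun j => ‖(md (γ + Pi.single j 1) f).1 (M x)‖) ⟨i, Finset.mem_univ i⟩
    refine ⟨γ + Pi.single j 1, by simp only [mlen_add, mlen_single, hγ], ?_⟩
    calc _ ≤ (d * ‖M‖) ^ mlen β * (‖M‖ * ∑ k, ‖(md (γ + Pi.single k 1) f).1 (M x)‖) := by
          rw [hpd]
          exact hle.trans (mul_le_mul_of_nonneg_left (norm_md_dirDeriv_le ..) (by positivity))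
      _ ≤ (d * ‖M‖) ^ mlen β * (‖M‖ * ∑ _k : Fin d, ‖(md (γ + Pi.single j 1) f).1 (M x)‖) := by
          gcongr with k hk
          exact hj k hk
      _ = _ := by
          rw [Finset.sum_const, Finset.card_univ, Fintype.card_fin, nsmul_eq_mul, mlen_add,
            mlen_single, pow_succ]
          ring

lemma mfact_le_factorial_mlen (α : Fin d → ℕ) : mfact α ≤ (mlen α).factorial :=
  Nat.le_of_dvd (Nat.factorial_pos _) (Nat.prod_factorial_dvd_factorial_sum _ _)

lemma factorial_sum_le {ι : Type*} (S : Finset ι) (α : ι → ℕ) :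
    (∑ i ∈ S, α i).factorial ≤ (2 ^ S.card) ^ (∑ i ∈ S, α i) * ∏ i ∈ S, (α i).factorial := by
  classical
  induction S using Finset.induction_on with
  | empty => simp
  | insert i S hi ih =>
    rw [Finset.sum_insert hi, Finset.prod_insert hi, Finset.card_insert_of_notMem hi]
    set n := α i + ∑ j ∈ S, α j with hn
    calc n.factorial
        = n.choose (∑ j ∈ S, α j) * ((α i).factorial * (∑ j ∈ S, α j).factorial) := by
          rw [hn, ← Nat.add_choose_mul_factorial_mul_factorial, mul_assoc]
      _ ≤ 2 ^ n * ((α i).factorial *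
            ((2 ^ S.card) ^ n * ∏ j ∈ S, (α j).factorial)) := by
          gcongr
          · exact Nat.choose_le_two_pow _ _
          · refine ih.trans ?_
            gcongr
            · exact Nat.one_le_two_pow
            · exact Nat.le_add_left _ _
      _ = (2 ^ (S.card + 1)) ^ n * ((α i).factorial * ∏ j ∈ S, (α j).factorial) := by
          rw [pow_succ 2 S.card, mul_pow]
          ring

lemma mfact_rpow_le_of_mlen_eq {p : ℝ} (hp : 0 ≤ p) {α β : Fin d → ℕ} (h : mlen β = mlen α) :
    (mfact β : ℝ) ^ p ≤ ((2 ^ d) ^ p) ^ mlen α * (mfact α : ℝ) ^ p := by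
  have hfact : mfact β ≤ (2 ^ d) ^ mlen α * mfact α :=
    calc mfact β ≤ (mlen α).factorial := h ▸ mfact_le_factorial_mlen β
      _ ≤ (2 ^ d) ^ mlen α * mfact α := by
        simpa [mlen, mfact] using factorial_sum_le Finset.univ α
  calc (mfact β : ℝ) ^ p ≤ (((2 ^ d) ^ mlen α : ℝ) * mfact α) ^ p :=
        Real.rpow_le_rpow (by positivity) (by exact_mod_cast hfact) hp
    _ = ((2 ^ d) ^ p) ^ mlen α * (mfact α : ℝ) ^ p := by
        rw [Real.mul_rpow (by positivity) (by positivity), Real.rpow_pow_comm (by positivity)]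

lemma exists_abs_mpow_apply_le (N : E d →L[ℝ] E d) (α : Fin d → ℕ) (y : E d) :
    ∃ α' : Fin d → ℕ, mlen α' = mlen α ∧ |mpow α (N y)| ≤ (d * ‖N‖) ^ mlen α * |mpow α' y| := by
  rcases Nat.eq_zero_or_pos d with rfl | hd
  · exact ⟨α, rfl, by simp [mpow, mlen]⟩
  have : NeZero d := ⟨hd.ne'⟩
  obtain ⟨j, hj⟩ := exists_norm_le_mul_abs_coord y
  refine ⟨Pi.single j (mlen α), mlen_single _ _, ?_⟩
  rw [mpow_single, mpow, Finset.abs_prod, abs_pow, ← mul_pow, mlen, ← Finset.prod_pow_eq_pow_sum]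
  refine Finset.prod_le_prod (fun i _ => abs_nonneg _) fun i _ => ?_
  rw [abs_pow]
  refine pow_le_pow_left₀ (abs_nonneg _) ?_ _
  calc |N y i| ≤ ‖N y‖ := PiLp.norm_apply_le (N y) i
    _ ≤ ‖N‖ * ‖y‖ := N.le_opNorm y
    _ ≤ ‖N‖ * (d * |y j|) := by gcongr
    _ = d * ‖N‖ * |y j| := by ring

lemma pow_mul_wt_le_of_mlen_eq {t s h a b c : ℝ} (ht : 0 ≤ t) (hs : 0 ≤ s) (hh : 0 ≤ h)
    (ha : 0 ≤ a) (hb : 0 ≤ b) (hc : 0 < c) (hac : a * (2 ^ d) ^ t ≤ c) (hbc : b * (2 ^ d) ^ s ≤ c)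
    {α α' β β' : Fin d → ℕ} (hα : mlen α' = mlen α) (hβ : mlen β' = mlen β) :
    a ^ mlen α * b ^ mlen β * wt t s (h / c) α' β' ≤ wt t s h α β := by
  have factor_le : ∀ {p a : ℝ} {γ γ' : Fin d → ℕ}, 0 ≤ p → 0 ≤ a → a * (2 ^ d) ^ p ≤ c →
      mlen γ' = mlen γ → a ^ mlen γ * ((h / c) ^ mlen γ * (mfact γ' : ℝ) ^ p) ≤
        h ^ mlen γ * (mfact γ : ℝ) ^ p := fun {p a γ γ'} hp ha hac hγ => by
    calc a ^ mlen γ * ((h / c) ^ mlen γ * (mfact γ' : ℝ) ^ p)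
        ≤ a ^ mlen γ * ((h / c) ^ mlen γ * (((2 ^ d) ^ p) ^ mlen γ * (mfact γ : ℝ) ^ p)) := by
          gcongr
          exact mfact_rpow_le_of_mlen_eq hp hγ
      _ = (a * (2 ^ d) ^ p * (h / c)) ^ mlen γ * (mfact γ : ℝ) ^ p := by
          rw [mul_pow, mul_pow]
          ring
      _ ≤ h ^ mlen γ * (mfact γ : ℝ) ^ p := by
          gcongr
          exact (mul_le_mul_of_nonneg_right hac (by positivity)).trans_eq
            (mul_div_cancel₀ h hc.ne')
  rw [wt_eq, wt_eq, hα, hβ, mul_mul_mul_comm]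
  exact mul_le_mul (factor_le ht ha hac hα) (factor_le hs hb hbc hβ) (by positivity)
    (by positivity)

lemma exists_gsBound_compLin {t s : ℝ} (ht : 0 ≤ t) (hs : 0 ≤ s) (M N : E d →L[ℝ] E d)
    (hNM : ∀ x, N (M x) = x) {h : ℝ} (hh : 0 < h) :
    ∃ h' : ℝ, 0 < h' ∧ ∀ (f : Sm d) (B : ℝ), 0 ≤ B → GSBound t s h' B f →
      GSBound t s h B (compLin M f) := by
  set a := d * ‖N‖
  set b := d * ‖M‖
  set c := 1 + a * (2 ^ d) ^ t + b * (2 ^ d) ^ s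
  have ha : 0 ≤ a := by positivity
  have hb : 0 ≤ b := by positivity
  have hc : 0 < c := by positivity
  have hac : a * (2 ^ d) ^ t ≤ c := by
    have : 0 ≤ b * (2 ^ d) ^ s := by positivity
    linarith
  have hbc : b * (2 ^ d) ^ s ≤ c := by
    have : 0 ≤ a * (2 ^ d) ^ t := by positivity
    linarith
  refine ⟨h / c, by positivity, fun f B hB hf α β x => ?_⟩
  obtain ⟨α', hα', hmpow⟩ := exists_abs_mpow_apply_le N α (M x)
  obtain ⟨β', hβ', hmd⟩ := exists_norm_md_compLin_le M β f x
  rw [hNM] at hmpow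
  calc _ = |mpow α x| * ‖(md β (compLin M f)).1 x‖ := by
        rw [norm_mul, Complex.norm_real, Real.norm_eq_abs]
    _ ≤ a ^ mlen α * |mpow α' (M x)| * (b ^ mlen β * ‖(md β' f).1 (M x)‖) := by gcongr
    _ = a ^ mlen α * b ^ mlen β * ‖(mpow α' (M x) : ℂ) * (md β' f).1 (M x)‖ := by
        rw [norm_mul, Complex.norm_real, Real.norm_eq_abs]
        ring
    _ ≤ a ^ mlen α * b ^ mlen β * (B * wt t s (h / c) α' β') := by
        gcongr
        exact hf α' β' (M x)
    _ = B * (a ^ mlen α * b ^ mlen β * wt t s (h / c) α' β') := by ring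
    _ ≤ B * wt t s h α β := mul_le_mul_of_nonneg_left
        (pow_mul_wt_le_of_mlen_eq ht hs hh.le ha hb hc hac hbc hα' hβ') hB

lemma compLin_mem_gsSpace {t s : ℝ} (ht : 0 ≤ t) (hs : 0 ≤ s) {M N : E d →L[ℝ] E d}
    (hNM : ∀ x, N (M x) = x) {f : E d → ℂ} (hf : f ∈ GSSpace d t s) :
    (fun x => f (M x)) ∈ GSSpace d t s :=
  mem_gsSpace_of_gsBound (compLin M ⟨f, hf.1⟩) fun h hh => by
    obtain ⟨h', hh', H⟩ := exists_gsBound_compLin ht hs M N hNM hh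
    obtain ⟨B, hB, hfB⟩ := exists_gsBound ⟨f, hf⟩ hh'
    exact ⟨B, H _ B hB hfB⟩

/-! ### Translations and modulations -/

lemma pow_le_exp_mul_factorial_rpow {p h a : ℝ} (hp : 0 < p) (hh : 0 < h) (ha : 0 ≤ a) (m : ℕ) :
    a ^ m ≤ Real.exp (p * h⁻¹ ^ (1 / p) * a ^ (1 / p)) * (h ^ m * (m.factorial : ℝ) ^ p) := by
  set y := h⁻¹ ^ (1 / p) * a ^ (1 / p) with hy
  have hy_nonneg : 0 ≤ y := by positivity
  have hy_rpow : y ^ p = h⁻¹ * a := by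
    rw [hy, ← Real.mul_rpow (by positivity) ha, ← Real.rpow_mul (by positivity),
      one_div_mul_cancel hp.ne', Real.rpow_one]
  have hm : (0 : ℝ) < m.factorial := by exact_mod_cast Nat.factorial_pos m
  have pow_le : y ^ m ≤ Real.exp y * m.factorial :=
    (div_le_iff₀ hm).1 (Real.pow_div_factorial_le_exp _ hy_nonneg m)
  calc a ^ m = h ^ m * (y ^ m) ^ p := by
        rw [← Real.rpow_pow_comm hy_nonneg, hy_rpow, ← mul_pow, mul_inv_cancel_left₀ hh.ne']
    _ ≤ h ^ m * (Real.exp y * m.factorial) ^ p := by gcongr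
    _ = _ := by
        rw [Real.mul_rpow (Real.exp_pos _).le hm.le, ← Real.exp_mul, mul_assoc p, mul_comm p]
        ring

lemma abs_mpow_le_exp_mul {p h : ℝ} (hp : 0 < p) (hh : 0 < h) (α : Fin d → ℕ) (v : E d) :
    |mpow α v| ≤ Real.exp (d * (p * h⁻¹ ^ (1 / p)) * ‖v‖ ^ (1 / p)) *
      (h ^ mlen α * (mfact α : ℝ) ^ p) := by
  have factor_le : ∀ i, |v i ^ α i| ≤ Real.exp (p * h⁻¹ ^ (1 / p) * ‖v‖ ^ (1 / p)) *
      (h ^ α i * ((α i).factorial : ℝ) ^ p) := fun i =>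
    calc |v i ^ α i| ≤ ‖v‖ ^ α i := by
          rw [abs_pow]
          exact pow_le_pow_left₀ (abs_nonneg _) (PiLp.norm_apply_le v i) _
      _ ≤ _ := pow_le_exp_mul_factorial_rpow hp hh (norm_nonneg v) _
  rw [mpow, Finset.abs_prod]
  refine (Finset.prod_le_prod (fun i _ => abs_nonneg _) fun i _ => factor_le i).trans_eq ?_
  rw [Finset.prod_mul_distrib, Finset.prod_mul_distrib, Finset.prod_const, Finset.card_univ,
    Fintype.card_fin, ← Real.exp_nat_mul, Finset.prod_pow_eq_pow_sum,
    Real.finsetProd_rpow _ _ fun i _ => by positivity, ← mul_assoc (d : ℝ), mlen, mfact,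
    Nat.cast_prod]

/- Assign each coordinate to the larger of `|zᵢ|` and `|vᵢ|`. -/
lemma exists_abs_mpow_add_le (α : Fin d → ℕ) (z v : E d) : ∃ α₁ α₂ : Fin d → ℕ,
    mlen α₁ + mlen α₂ = mlen α ∧ mfact α₁ * mfact α₂ = mfact α ∧
      |mpow α (z + v)| ≤ 2 ^ mlen α * (|mpow α₁ z| * |mpow α₂ v|) := by
  refine ⟨fun i => if |v i| ≤ |z i| then α i else 0, fun i => if |v i| ≤ |z i| then 0 else α i,
    ?_, ?_, ?_⟩
  · rw [mlen, mlen, mlen, ← Finset.sum_add_distrib]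
    refine Finset.sum_congr rfl fun i _ => ?_
    split_ifs <;> simp
  · rw [mfact, mfact, mfact, ← Finset.prod_mul_distrib]
    refine Finset.prod_congr rfl fun i _ => ?_
    split_ifs <;> simp
  · rw [mpow, mpow, mpow, Finset.abs_prod, Finset.abs_prod, Finset.abs_prod, mlen,
      ← Finset.prod_pow_eq_pow_sum, ← Finset.prod_mul_distrib, ← Finset.prod_mul_distrib]
    refine Finset.prod_le_prod (fun i _ => abs_nonneg _) fun i _ => ?_
    have htri : |(z + v) i| ≤ |z i| + |v i| := abs_add_le _ _
    rw [abs_pow]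
    split_ifs
    · rw [pow_zero, abs_one, mul_one, abs_pow, ← mul_pow]
      exact pow_le_pow_left₀ (abs_nonneg _) (by linarith) _
    · rw [pow_zero, abs_one, one_mul, abs_pow, ← mul_pow]
      exact pow_le_pow_left₀ (abs_nonneg _) (by linarith) _

lemma md_tr_apply (β : Fin d → ℕ) (v : E d) (f : Sm d) (x : E d) :
    (md β (tr v f)).1 x = (md β f).1 (x - v) := by
  rw [← Module.End.mul_apply, md_tr]
  rfl

lemma exists_gsBound_tr {t s h : ℝ} (ht : 0 < t) (hh : 0 < h) : ∃ r : ℝ, 0 ≤ r ∧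
    ∀ (f : Sm d) (B : ℝ), 0 ≤ B → GSBound t s (h / 2) B f → ∀ v : E d,
      GSBound t s h (Real.exp (r * ‖v‖ ^ (1 / t)) * B) (tr v f) := by
  refine ⟨d * (t * (h / 2)⁻¹ ^ (1 / t)), by positivity, fun f B hB hf v α β x => ?_⟩
  obtain ⟨α₁, α₂, hlen, hfact, hsplit⟩ := exists_abs_mpow_add_le α (x - v) v
  have hfact_rpow : (mfact α₁ : ℝ) ^ t * (mfact α₂ : ℝ) ^ t = (mfact α : ℝ) ^ t := by
    rw [← Real.mul_rpow (by positivity) (by positivity), ← hfact, Nat.cast_mul]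
  have hshift := abs_mpow_le_exp_mul ht (half_pos hh) α₂ v
  have hderiv := hf α₁ β (x - v)
  rw [sub_add_cancel] at hsplit
  rw [md_tr_apply]
  rw [norm_mul, Complex.norm_real, Real.norm_eq_abs] at hderiv ⊢
  set X := Real.exp (d * (t * (h / 2)⁻¹ ^ (1 / t)) * ‖v‖ ^ (1 / t))
  calc _ ≤ 2 ^ mlen α * (|mpow α₁ (x - v)| * |mpow α₂ v|) * ‖(md β f).1 (x - v)‖ := by gcongr
    _ = 2 ^ mlen α * |mpow α₂ v| * (|mpow α₁ (x - v)| * ‖(md β f).1 (x - v)‖) := by ring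
    _ ≤ 2 ^ mlen α * (X * ((h / 2) ^ mlen α₂ * (mfact α₂ : ℝ) ^ t)) *
          (B * wt t s (h / 2) α₁ β) := by gcongr
    _ = X * B * ((2 ^ mlen α * (h / 2) ^ (mlen α₁ + mlen α₂) *
          ((mfact α₁ : ℝ) ^ t * (mfact α₂ : ℝ) ^ t)) * ((h / 2) ^ mlen β * (mfact β : ℝ) ^ s)) := by
        rw [wt_eq, pow_add]
        ring
    _ = X * B * ((h ^ mlen α * (mfact α : ℝ) ^ t) * ((h / 2) ^ mlen β * (mfact β : ℝ) ^ s)) := by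
        rw [hlen, hfact_rpow, ← mul_pow, mul_div_cancel₀ _ two_ne_zero]
    _ ≤ X * B * wt t s h α β := by
        rw [wt_eq]
        gcongr
        exact half_le_self hh.le

/- The difference is controlled by the first derivatives, through the mean value inequality. -/
lemma exists_gsBound_tr_sub {t s h : ℝ} (ht : 0 < t) (hs : 0 ≤ s) (hh : 0 < h) :
    ∃ h' K : ℝ, 0 < h' ∧ 0 ≤ K ∧ ∀ (f : Sm d) (B : ℝ), 0 ≤ B → GSBound t s h' B f →
      ∀ v : E d, ‖v‖ ≤ 1 → GSBound t s h (K * ‖v‖ * B) (tr v f - f) := by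
  obtain ⟨r, hr, tr_bound⟩ := exists_gsBound_tr (d := d) (s := s) ht hh
  have wt_nonneg : ∀ j : Fin d, 0 ≤ wt t s (h / 2) 0 (Pi.single j 1) := fun j =>
    (wt_pos (half_pos hh) _ _).le
  refine ⟨h / 2 / 2 ^ s, ∑ j : Fin d, Real.exp r * wt t s (h / 2) 0 (Pi.single j 1),
    by positivity, Finset.sum_nonneg fun j _ => mul_nonneg (Real.exp_pos r).le (wt_nonneg j),
    fun f B hB hf v hv α β x => ?_⟩
  set g := (mpow α x : ℂ) • md β f with hg
  have pd_le : ∀ y ∈ Metric.closedBall x ‖v‖, ∀ j, ‖(pd j g).1 y‖ ≤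
      Real.exp r * (B * wt t s (h / 2) 0 (Pi.single j 1)) * wt t s h α β := fun y hy j => by
    have hxy : ‖x - y‖ ≤ 1 := (mem_closedBall_iff_norm'.1 hy).trans hv
    have hpd : (pd j g).1 y = (mpow α x : ℂ) * (md β (tr (x - y) (md (Pi.single j 1) f))).1 x := by
      rw [md_tr_apply, sub_sub_cancel, ← Module.End.mul_apply, ← md_add, md_add_single, hg,
        map_smul]
      rfl
    rw [hpd]
    refine (tr_bound _ _ (mul_nonneg hB (wt_nonneg j))
      (gsBound_md hs (half_pos hh) hB hf (Pi.single j 1)) (x - y) α β x).trans ?_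
    have := wt_pos (t := t) (s := s) hh α β
    have := wt_nonneg j
    gcongr
    exact mul_le_of_le_one_right hr (Real.rpow_le_one (norm_nonneg _) hxy (by positivity))
  have mean_value := (convex_closedBall x ‖v‖).norm_image_sub_le_of_norm_fderiv_le
    (fun y _ => differentiable_coe g y)
    (fun y hy => (norm_fderiv_le_sum_pd g y).trans (Finset.sum_le_sum fun j _ => pd_le y hy j))
    (Metric.mem_closedBall_self (norm_nonneg v)) (y := x - v) (by simp)
  have hsub : (mpow α x : ℂ) * (md β (tr v f - f)).1 x = g.1 (x - v) - g.1 x := by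
    rw [map_sub]
    change (mpow α x : ℂ) * ((md β (tr v f)).1 x - (md β f).1 x) = _
    rw [md_tr_apply, mul_sub]
    rfl
  rw [hsub]
  refine mean_value.trans_eq ?_
  rw [sub_sub_cancel_left, norm_neg]
  simp only [Finset.sum_mul]
  exact Finset.sum_congr rfl fun j _ => by ring

lemma fourierFun_sub {f g : E d → ℂ} (hf : Integrable f) (hg : Integrable g) (ξ : E d) :
    fourierFun (f - g) ξ = fourierFun f ξ - fourierFun g ξ := by
  rw [sub_eq_add_neg, ← neg_one_smul ℂ g, fourierFun_add hf (hg.smul _), fourierFun_smul]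
  ring

lemma fourierFun_fourierFun_neg_of_mem_gsSpace {t s : ℝ} (ht : 0 < t) (hs : 0 < s)
    (hst : 1 < s + t) {f : E d → ℂ} (hf : f ∈ GSSpace d t s) (x : E d) :
    fourierFun (fourierFun f) (-x) = f x :=
  fourierFun_fourierFun_neg (continuous_of_mem_gsSpace hf) (integrable_of_mem_gsSpace ht hf)
    (integrable_of_mem_gsSpace hs (fourierFun_mem_gsSpace ht hs.le hst hf)) x

lemma exists_gsBound_of_fourierSm {t s : ℝ} (ht : 0 < t) (hs : 0 < s) (hst : 1 < s + t) {h : ℝ}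
    (hh : 0 < h) : ∃ h' K : ℝ, 0 < h' ∧ 0 ≤ K ∧
      ∀ (f : Sm d) (hf : f.1 ∈ GSSpace d t s) (B : ℝ), 0 ≤ B →
        GSBound s t h' B (fourierSm ht f hf) → GSBound t s h (K * B) f := by
  set R : E d →L[ℝ] E d := -ContinuousLinearMap.id ℝ (E d)
  obtain ⟨h₁, hh₁, reflect⟩ := exists_gsBound_compLin ht.le hs.le R R neg_neg hh
  obtain ⟨h₂, K, hh₂, hK, fourier⟩ :=
    exists_gsBound_fourierSm (d := d) hs ht.le (by rwa [add_comm]) hh₁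
  refine ⟨h₂, K, hh₂, hK, fun f hf B hB hfB => ?_⟩
  have hf' := fourierFun_mem_gsSpace ht hs.le hst hf
  have hinv : compLin R (fourierSm hs (fourierSm ht f hf) hf') = f :=
    Subtype.ext (funext (fourierFun_fourierFun_neg_of_mem_gsSpace ht hs hst hf))
  exact hinv ▸ reflect _ _ (by positivity) (fourier _ hf' B hB hfB)

/-- The modulation `f ↦ exp(i⟨·, ξ⟩) f`, as an operator on smooth functions. -/
def modulate (ξ : E d) : Module.End ℂ (Sm d) where
  toFun f := ⟨fun y => Complex.exp (Complex.I * (inner ℝ y ξ : ℝ)) * f.1 y,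
    (contDiff_const.mul (Complex.ofRealCLM.contDiff.comp
      (contDiff_id.inner ℝ contDiff_const))).cexp.mul (show ContDiff ℝ ∞ f.1 from f.2)⟩
  map_add' _ _ := by ext x; exact mul_add _ _ _
  map_smul' _ _ := by ext x; exact mul_left_comm _ _ _

lemma tr_add (v w : E d) : tr (v + w) = tr v * tr w := by
  ext f x
  change f.1 (x - (v + w)) = f.1 (x - v - w)
  rw [sub_sub]

lemma modulate_add (v w : E d) : modulate (v + w) = modulate v * modulate w := by
  ext f x
  change Complex.exp (Complex.I * (inner ℝ x (v + w) : ℝ)) * f.1 x =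
    Complex.exp (Complex.I * (inner ℝ x v : ℝ)) *
      (Complex.exp (Complex.I * (inner ℝ x w : ℝ)) * f.1 x)
  rw [← mul_assoc, ← Complex.exp_add, inner_add_right, Complex.ofReal_add, mul_add]

lemma tr_mem_gsSpace {t s : ℝ} (ht : 0 < t) {f : Sm d} (hf : f.1 ∈ GSSpace d t s) (x : E d) :
    (tr x f).1 ∈ GSSpace d t s :=
  mem_gsSpace_of_gsBound _ fun h hh => by
    obtain ⟨B, hB, hfB⟩ := exists_gsBound ⟨f.1, hf⟩ (half_pos hh)
    obtain ⟨r, -, H⟩ := exists_gsBound_tr (d := d) (s := s) ht hh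
    exact ⟨_, H f B hB hfB x⟩

lemma modulate_mem_gsSpace {t s : ℝ} (ht : 0 < t) (hs : 0 < s) {f : Sm d}
    (hf : f.1 ∈ GSSpace d t s) (ξ : E d) : (modulate ξ f).1 ∈ GSSpace d t s := by
  have hshift : timeFreqShift 0 ξ f.1 = (modulate ξ f).1 := by
    ext y
    simp only [timeFreqShift, sub_zero]
    rfl
  exact hshift ▸ IsGelfandShilov.timeFreqShift ht hs 0 ξ hf

lemma fourierFun_exp_mul (f : E d → ℂ) (ξ η : E d) :
    fourierFun (fun y => Complex.exp (Complex.I * (inner ℝ y ξ : ℝ)) * f y) η =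
      fourierFun f (η - ξ) := by
  refine congrArg _ (integral_congr_ae (.of_forall fun y => ?_))
  simp only
  rw [mul_right_comm, ← Complex.exp_add, mul_comm, inner_sub_right]
  congr 2
  push_cast
  ring

lemma fourierSm_modulate {t s : ℝ} (ht : 0 < t) (hs : 0 < s) (f : Sm d)
    (hf : f.1 ∈ GSSpace d t s) (ξ : E d) :
    fourierSm ht (modulate ξ f) (modulate_mem_gsSpace ht hs hf ξ) = tr ξ (fourierSm ht f hf) :=
  Subtype.ext (funext (fourierFun_exp_mul f.1 ξ))

lemma exists_gsBound_modulate {t s : ℝ} (ht : 0 < t) (hs : 0 < s) (hst : 1 < s + t) {h : ℝ}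
    (hh : 0 < h) : ∃ h' K r : ℝ, 0 < h' ∧ 0 ≤ K ∧ 0 ≤ r ∧
      ∀ f : Sm d, f.1 ∈ GSSpace d t s → ∀ B : ℝ, 0 ≤ B → GSBound t s h' B f →
        ∀ ξ : E d, GSBound t s h (K * Real.exp (r * ‖ξ‖ ^ (1 / s)) * B) (modulate ξ f) := by
  obtain ⟨h₁, K₁, hh₁, hK₁, of_fourier⟩ := exists_gsBound_of_fourierSm (d := d) ht hs hst hh
  obtain ⟨h₂, K₂, hh₂, hK₂, fourier⟩ :=
    exists_gsBound_fourierSm (d := d) ht hs.le hst (half_pos hh₁)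
  obtain ⟨r, hr, translate⟩ := exists_gsBound_tr (d := d) (s := t) hs hh₁
  refine ⟨h₂, K₁ * K₂, r, hh₂, by positivity, hr, fun f hf B hB hfB ξ => ?_⟩
  have hbound := translate _ _ (by positivity) (fourier f hf B hB hfB) ξ
  rw [← fourierSm_modulate ht hs] at hbound
  convert of_fourier _ _ _ (by positivity) hbound using 1
  ring

lemma exists_gsBound_modulate_sub {t s : ℝ} (ht : 0 < t) (hs : 0 < s) (hst : 1 < s + t) {h : ℝ}
    (hh : 0 < h) : ∃ h' K : ℝ, 0 < h' ∧ 0 ≤ K ∧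
      ∀ f : Sm d, f.1 ∈ GSSpace d t s → ∀ B : ℝ, 0 ≤ B → GSBound t s h' B f →
        ∀ ξ : E d, ‖ξ‖ ≤ 1 → GSBound t s h (K * ‖ξ‖ * B) (modulate ξ f - f) := by
  obtain ⟨h₁, K₁, hh₁, hK₁, of_fourier⟩ := exists_gsBound_of_fourierSm (d := d) ht hs hst hh
  obtain ⟨h₂, K₂, hh₂, hK₂, translate⟩ := exists_gsBound_tr_sub (d := d) hs ht.le hh₁
  obtain ⟨h₃, K₃, hh₃, hK₃, fourier⟩ := exists_gsBound_fourierSm (d := d) ht hs.le hst hh₂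
  refine ⟨h₃, K₁ * (K₂ * K₃), hh₃, by positivity, fun f hf B hB hfB ξ hξ => ?_⟩
  have hmod := modulate_mem_gsSpace ht hs hf ξ
  have hsub : tr ξ (fourierSm ht f hf) - fourierSm ht f hf =
      fourierSm ht (modulate ξ f - f) ((GSSpace d t s).sub_mem hmod hf) := by
    rw [← fourierSm_modulate ht hs]
    ext η
    exact (fourierFun_sub (integrable_of_mem_gsSpace ht hmod) (integrable_of_mem_gsSpace ht hf)
      η).symm
  have hbound := translate _ _ (by positivity) (fourier f hf B hB hfB) ξ hξ
  rw [hsub] at hbound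
  convert of_fourier _ _ _ (by positivity) hbound using 1
  ring

/-! ### Time-frequency shifts -/

/-- The time-frequency shift `M_ξ T_x` for `z = (x, ξ)`, as an operator on smooth functions. -/
def tfShift (z : E d × E d) : Module.End ℂ (Sm d) := modulate z.2 * tr z.1

lemma exists_gsBound_tfShift {t s : ℝ} (ht : 0 < t) (hs : 0 < s) (hst : 1 < s + t) {h : ℝ}
    (hh : 0 < h) {f : Sm d} (hf : f.1 ∈ GSSpace d t s) :
    ∃ C r : ℝ, 0 ≤ C ∧ 0 ≤ r ∧ ∀ z : E d × E d,
      GSBound t s h (C * Real.exp (r * rho t s z)) (tfShift z f) := by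
  obtain ⟨h₁, K, r₁, hh₁, hK, hr₁, modulate_bound⟩ :=
    exists_gsBound_modulate (d := d) ht hs hst hh
  obtain ⟨r₂, hr₂, tr_bound⟩ := exists_gsBound_tr (d := d) (s := s) ht hh₁
  obtain ⟨B, hB, hfB⟩ := exists_gsBound ⟨f.1, hf⟩ (half_pos hh₁)
  refine ⟨K * B, r₁ + r₂, by positivity, by positivity, fun z => ?_⟩
  refine (modulate_bound _ (tr_mem_gsSpace ht hf z.1) _ (by positivity)
    (tr_bound f B hB hfB z.1) z.2).mono hh le_rfl (by positivity) ?_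
  calc _ = K * B * (Real.exp (r₁ * ‖z.2‖ ^ (1 / s)) * Real.exp (r₂ * ‖z.1‖ ^ (1 / t))) := by ring
    _ ≤ _ := by
        rw [← Real.exp_add]
        gcongr
        have : 0 ≤ r₁ * ‖z.1‖ ^ (1 / t) := by positivity
        have : 0 ≤ r₂ * ‖z.2‖ ^ (1 / s) := by positivity
        unfold rho
        linarith

lemma GSBound.add {t s h B B' : ℝ} {f g : Sm d} (hf : GSBound t s h B f)
    (hg : GSBound t s h B' g) : GSBound t s h (B + B') (f + g) := fun α β x => by
  rw [map_add, Submodule.coe_add, Pi.add_apply, mul_add, add_mul]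
  exact (norm_add_le _ _).trans (add_le_add (hf α β x) (hg α β x))

lemma tfShift_sub_tfShift (z z₀ : E d × E d) (f : Sm d) :
    tfShift z f - tfShift z₀ f = modulate z.2 (tr (z.1 - z₀.1) (tr z₀.1 f) - tr z₀.1 f) +
      modulate z₀.2 (modulate (z.2 - z₀.2) (tr z₀.1 f) - tr z₀.1 f) := by
  rw [← Module.End.mul_apply (tr _), ← tr_add, sub_add_cancel, map_sub, map_sub,
    ← Module.End.mul_apply (modulate _) (modulate _), ← modulate_add, add_sub_cancel]
  simp only [tfShift, Module.End.mul_apply]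
  abel

lemma exists_gsBound_tfShift_sub {t s : ℝ} (ht : 0 < t) (hs : 0 < s) (hst : 1 < s + t) {h : ℝ}
    (hh : 0 < h) {f : Sm d} (hf : f.1 ∈ GSSpace d t s) (z₀ : E d × E d) :
    ∃ C : ℝ, 0 ≤ C ∧ ∀ z : E d × E d, ‖z - z₀‖ ≤ 1 →
      GSBound t s h (C * ‖z - z₀‖) (tfShift z f - tfShift z₀ f) := by
  have mem_tr := fun x => tr_mem_gsSpace ht hf x
  obtain ⟨h₁, K₁, r, hh₁, hK₁, hr, modulate_bound⟩ := exists_gsBound_modulate (d := d) ht hs hst hh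
  obtain ⟨h₂, K₂, hh₂, hK₂, modulate_sub⟩ := exists_gsBound_modulate_sub (d := d) ht hs hst hh₁
  obtain ⟨h₃, K₃, hh₃, hK₃, tr_sub⟩ := exists_gsBound_tr_sub (d := d) ht hs.le hh₁
  obtain ⟨B₂, hB₂, hfB₂⟩ := exists_gsBound ⟨_, mem_tr z₀.1⟩ hh₂
  obtain ⟨B₃, hB₃, hfB₃⟩ := exists_gsBound ⟨_, mem_tr z₀.1⟩ hh₃
  set X := Real.exp (r * (‖z₀.2‖ + 1) ^ (1 / s))
  have exp_le : ∀ ξ : E d, ‖ξ‖ ≤ ‖z₀.2‖ + 1 → Real.exp (r * ‖ξ‖ ^ (1 / s)) ≤ X := fun ξ hξ =>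
    Real.exp_le_exp.2 (mul_le_mul_of_nonneg_left
      (Real.rpow_le_rpow (norm_nonneg _) hξ (by positivity)) hr)
  refine ⟨K₁ * X * (K₃ * B₃) + K₁ * X * (K₂ * B₂), by positivity, fun z hz => ?_⟩
  have hz₁ : ‖z.1 - z₀.1‖ ≤ ‖z - z₀‖ := norm_fst_le (z - z₀)
  have hz₂ : ‖z.2 - z₀.2‖ ≤ ‖z - z₀‖ := norm_snd_le (z - z₀)
  rw [tfShift_sub_tfShift, add_mul]
  refine GSBound.add ?_ ?_
  · have hnorm : ‖z.2‖ ≤ ‖z₀.2‖ + 1 :=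
      (norm_le_norm_add_norm_sub' z.2 z₀.2).trans (by linarith)
    refine (modulate_bound _ (sub_mem (tr_mem_gsSpace ht (mem_tr _) _) (mem_tr _)) _
      (by positivity) (tr_sub _ B₃ hB₃ hfB₃ _ (hz₁.trans hz)) z.2).mono hh le_rfl
      (by positivity) ?_
    calc _ ≤ K₁ * X * (K₃ * ‖z - z₀‖ * B₃) := by
          gcongr
          exact exp_le _ hnorm
      _ = _ := by ring
  · refine (modulate_bound _ (sub_mem (modulate_mem_gsSpace ht hs (mem_tr _) _) (mem_tr _)) _
      (by positivity) (modulate_sub _ (mem_tr _) B₂ hB₂ hfB₂ _ (hz₂.trans hz)) z₀.2).mono hh le_rfl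
      (by positivity) ?_
    calc _ ≤ K₁ * X * (K₂ * ‖z - z₀‖ * B₂) := by
          gcongr
          exact exp_le _ (by linarith)
      _ = _ := by ring

/-! ### The short-time Fourier transform of a test function -/

/-- The unnormalized short-time Fourier transform `⟨f, M_ξ T_x ψ⟩` of a function `f` at
`z = (x, ξ)`, the counterpart on test functions of `stft`, without the factor `(2π)^(-d/2)`. -/
def stftFun (ψ f : E d → ℂ) (z : E d × E d) : ℂ :=
  ∫ y, f y * (starRingEnd ℂ) (timeFreqShift z.1 z.2 ψ y)

lemma norm_timeFreqShift (x ξ : E d) (f : E d → ℂ) (y : E d) :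
    ‖timeFreqShift x ξ f y‖ = ‖f (y - x)‖ := by
  rw [timeFreqShift, norm_mul, mul_comm Complex.I, Complex.norm_exp_ofReal_mul_I, one_mul]

lemma exists_norm_le_of_mem_gsSpace {t s : ℝ} {f : E d → ℂ} (hf : f ∈ GSSpace d t s) :
    ∃ B : ℝ, 0 ≤ B ∧ ∀ x, ‖f x‖ ≤ B := by
  obtain ⟨B, hB, hfB⟩ := exists_gsBound ⟨f, hf⟩ one_pos
  exact ⟨B, hB, hfB.norm_le⟩

lemma continuous_stftFun {t s : ℝ} (ht : 0 < t) {ψ f : E d → ℂ} (hψ : ψ ∈ GSSpace d t s)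
    (hf : f ∈ GSSpace d t s) : Continuous (stftFun ψ f) := by
  obtain ⟨B, -, hψB⟩ := exists_norm_le_of_mem_gsSpace hψ
  have hfc := continuous_of_mem_gsSpace hf
  have hψc := continuous_of_mem_gsSpace hψ
  have integrand_cont : Continuous fun p : (E d × E d) × E d =>
      f p.2 * (starRingEnd ℂ) (timeFreqShift p.1.1 p.1.2 ψ p.2) := by
    unfold timeFreqShift
    fun_prop
  refine continuous_of_dominated (bound := fun y => ‖f y‖ * B)
    (fun z => (integrand_cont.comp (Continuous.prodMk_right z)).aestronglyMeasurable)
    (fun z => .of_forall fun y => ?_) ((integrable_of_mem_gsSpace ht hf).norm.mul_const B)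
    (.of_forall fun y => integrand_cont.comp (Continuous.prodMk_left y))
  rw [norm_mul, RCLike.norm_conj, norm_timeFreqShift]
  gcongr
  exact hψB _

lemma integral_norm_mul_norm_sub_le {F G : Type*} [NormedAddCommGroup F] [NormedAddCommGroup G]
    {p R C₁ C₂ : ℝ} (hp : 0 < p) (hR : 0 ≤ R) (hC₁ : 0 ≤ C₁) (hC₂ : 0 ≤ C₂)
    {f : E d → F} {g : E d → G}
    (hf : ∀ x, ‖f x‖ ≤ C₁ * Real.exp (-(R * 2 ^ p + 1) * ‖x‖ ^ p))
    (hg : ∀ x, ‖g x‖ ≤ C₂ * Real.exp (-(R * 2 ^ p + 1) * ‖x‖ ^ p)) (x : E d) :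
    ∫ y, ‖f y‖ * ‖g (y - x)‖ ≤
      C₁ * C₂ * (∫ y : E d, Real.exp (-1 * ‖y‖ ^ p)) * Real.exp (-R * ‖x‖ ^ p) := by
  have integrand_le : ∀ y, ‖f y‖ * ‖g (y - x)‖ ≤
      C₁ * C₂ * Real.exp (-R * ‖x‖ ^ p) * Real.exp (-1 * ‖y‖ ^ p) := fun y => by
    have hxy := norm_add_rpow_le hp.le y (x - y)
    rw [add_sub_cancel, norm_sub_rev x y] at hxy
    have exponent_le : -(R * 2 ^ p + 1) * ‖y‖ ^ p + -(R * 2 ^ p + 1) * ‖y - x‖ ^ p ≤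
        -R * ‖x‖ ^ p + -1 * ‖y‖ ^ p := by
      have : 0 ≤ ‖y - x‖ ^ p := by positivity
      nlinarith [mul_le_mul_of_nonneg_left hxy hR]
    calc _ ≤ (C₁ * Real.exp (-(R * 2 ^ p + 1) * ‖y‖ ^ p)) *
          (C₂ * Real.exp (-(R * 2 ^ p + 1) * ‖y - x‖ ^ p)) :=
          mul_le_mul (hf y) (hg _) (norm_nonneg _) (by positivity)
      _ = C₁ * C₂ * Real.exp (-(R * 2 ^ p + 1) * ‖y‖ ^ p + -(R * 2 ^ p + 1) * ‖y - x‖ ^ p) := by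
          rw [Real.exp_add]; ring
      _ ≤ C₁ * C₂ * Real.exp (-R * ‖x‖ ^ p + -1 * ‖y‖ ^ p) := by gcongr
      _ = _ := by rw [Real.exp_add]; ring
  calc _ ≤ ∫ y : E d, C₁ * C₂ * Real.exp (-R * ‖x‖ ^ p) * Real.exp (-1 * ‖y‖ ^ p) :=
        integral_mono_of_nonneg (.of_forall fun y => by positivity)
          ((integrable_exp_neg_rpow hp one_pos).const_mul _) (.of_forall integrand_le)
    _ = _ := by rw [integral_const_mul]; ring

lemma exists_integral_norm_mul_norm_sub_le {t s : ℝ} (ht : 0 < t) {f g : E d → ℂ}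
    (hf : f ∈ GSSpace d t s) (hg : g ∈ GSSpace d t s) {R : ℝ} (hR : 0 ≤ R) :
    ∃ C : ℝ, 0 ≤ C ∧ ∀ x, ∫ y, ‖f y‖ * ‖g (y - x)‖ ≤ C * Real.exp (-R * ‖x‖ ^ (1 / t)) := by
  have hr : 0 < R * 2 ^ (1 / t) + 1 := by positivity
  obtain ⟨C₁, hC₁, f_le⟩ := exists_norm_le_mul_exp_neg ht ⟨f, hf⟩ hr
  obtain ⟨C₂, hC₂, g_le⟩ := exists_norm_le_mul_exp_neg ht ⟨g, hg⟩ hr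
  exact ⟨_, mul_nonneg (mul_nonneg hC₁ hC₂) (integral_nonneg fun y => (Real.exp_pos _).le),
    integral_norm_mul_norm_sub_le (one_div_pos.2 ht) hR hC₁ hC₂ f_le g_le⟩

lemma norm_stftFun_le (ψ f : E d → ℂ) (z : E d × E d) :
    ‖stftFun ψ f z‖ ≤ ∫ y, ‖f y‖ * ‖ψ (y - z.1)‖ := by
  refine (norm_integral_le_integral_norm _).trans_eq (congrArg _ (funext fun y => ?_))
  rw [norm_mul, RCLike.norm_conj, norm_timeFreqShift]

lemma fourierFun_timeFreqShift (f : E d → ℂ) (x ξ η : E d) :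
    fourierFun (timeFreqShift x ξ f) η =
      Complex.exp (-Complex.I * (inner ℝ x (η - ξ) : ℝ)) * fourierFun f (η - ξ) := by
  have hshift : timeFreqShift x ξ f =
    fun y => Complex.exp (Complex.I * (inner ℝ y ξ : ℝ)) * (fun y => f (y - x)) y := rfl
  rw [hshift, fourierFun_exp_mul, fourierFun, fourierFun, mul_left_comm,
    ← integral_const_mul (Complex.exp _), ← integral_add_right_eq_self _ x]
  refine congrArg _ (congrArg _ (funext fun y => ?_))
  rw [add_sub_cancel_right, inner_add_left, mul_left_comm, ← Complex.exp_add]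
  congr 2
  push_cast
  ring

lemma norm_fourierFun_timeFreqShift (f : E d → ℂ) (x ξ η : E d) :
    ‖fourierFun (timeFreqShift x ξ f) η‖ = ‖fourierFun f (η - ξ)‖ := by
  rw [fourierFun_timeFreqShift, norm_mul, neg_mul, ← mul_neg, mul_comm, ← Complex.ofReal_neg,
    mul_comm Complex.I, Complex.norm_exp_ofReal_mul_I, mul_one]

lemma norm_stftFun_le_fourierFun {t s : ℝ} (ht : 0 < t) (hs : 0 < s) (hst : 1 < s + t)
    {ψ f : E d → ℂ} (hψ : ψ ∈ GSSpace d t s) (hf : f ∈ GSSpace d t s) (z : E d × E d) :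
    ‖stftFun ψ f z‖ ≤ ∫ η, ‖fourierFun f η‖ * ‖fourierFun ψ (η - z.2)‖ := by
  have parseval := integral_conj_fourierFun_mul
    (integrable_of_mem_gsSpace ht (IsGelfandShilov.timeFreqShift ht hs z.1 z.2 hψ))
    (continuous_of_mem_gsSpace hf) (integrable_of_mem_gsSpace ht hf)
    (integrable_of_mem_gsSpace hs (fourierFun_mem_gsSpace ht hs.le hst hf))
  have stft_eq : stftFun ψ f z =
      ∫ η, (starRingEnd ℂ) (fourierFun (timeFreqShift z.1 z.2 ψ) η) * fourierFun f η := by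
    rw [parseval, stftFun]
    exact congrArg _ (funext fun y => mul_comm _ _)
  rw [stft_eq]
  refine (norm_integral_le_integral_norm _).trans_eq (congrArg _ (funext fun η => ?_))
  rw [norm_mul, RCLike.norm_conj, norm_fourierFun_timeFreqShift, mul_comm]

/- The definition of the transform gives decay in `x`, Parseval's identity decay in `ξ`; the
exponent `ρ` is at most twice the larger of its two summands. -/
lemma exists_norm_stftFun_le {t s : ℝ} (ht : 0 < t) (hs : 0 < s) (hst : 1 < s + t)
    {ψ f : E d → ℂ} (hψ : ψ ∈ GSSpace d t s) (hf : f ∈ GSSpace d t s) {R : ℝ} (hR : 0 ≤ R) :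
    ∃ C : ℝ, 0 ≤ C ∧ ∀ z, ‖stftFun ψ f z‖ ≤ C * Real.exp (-R * rho t s z) := by
  have hR₂ : 0 ≤ 2 * R := by positivity
  obtain ⟨C₁, hC₁, time_decay⟩ := exists_integral_norm_mul_norm_sub_le ht hf hψ hR₂
  obtain ⟨C₂, hC₂, freq_decay⟩ :=
    exists_integral_norm_mul_norm_sub_le hs (fourierFun_mem_gsSpace ht hs.le hst hf)
      (fourierFun_mem_gsSpace ht hs.le hst hψ) hR₂
  refine ⟨C₁ + C₂, by positivity, fun z => ?_⟩
  unfold rho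
  rcases le_total (‖z.1‖ ^ (1 / t)) (‖z.2‖ ^ (1 / s)) with h | h
  · exact ((norm_stftFun_le_fourierFun ht hs hst hψ hf z).trans (freq_decay z.2)).trans
      (mul_le_mul (by linarith) (Real.exp_le_exp.2 (by nlinarith)) (Real.exp_pos _).le
        (by positivity))
  · exact ((norm_stftFun_le ψ f z).trans (time_decay z.1)).trans
      (mul_le_mul (by linarith) (Real.exp_le_exp.2 (by nlinarith)) (Real.exp_pos _).le
        (by positivity))

lemma stftFun_timeFreqShift (ψ φ : E d → ℂ) (w z : E d × E d) :
    stftFun ψ (timeFreqShift w.1 w.2 φ) z =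
      Complex.exp (Complex.I * (inner ℝ w.1 (w.2 - z.2) : ℝ)) * stftFun ψ φ (z - w) := by
  unfold stftFun timeFreqShift
  rw [← integral_const_mul, ← integral_add_right_eq_self _ w.1]
  refine congrArg _ (funext fun y => ?_)
  have phase_eq : Complex.exp (Complex.I * (inner ℝ (y + w.1) w.2 : ℝ)) *
      Complex.exp (-Complex.I * (inner ℝ (y + w.1) z.2 : ℝ)) =
      Complex.exp (Complex.I * (inner ℝ w.1 (w.2 - z.2) : ℝ)) *
      Complex.exp (-Complex.I * (inner ℝ y (z.2 - w.2) : ℝ)) := by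
    rw [← Complex.exp_add, ← Complex.exp_add, inner_add_left, inner_add_left, inner_sub_right,
      inner_sub_right]
    congr 1
    push_cast
    ring
  rw [add_sub_cancel_right, Prod.fst_sub, Prod.snd_sub,
    show y + w.1 - z.1 = y - (z.1 - w.1) by abel, map_mul, map_mul, ← Complex.exp_conj,
    ← Complex.exp_conj, map_mul, map_mul, Complex.conj_I, Complex.conj_ofReal, Complex.conj_ofReal]
  linear_combination (φ y * (starRingEnd ℂ) (ψ (y - (z.1 - w.1)))) * phase_eq

lemma norm_stftFun_timeFreqShift (ψ φ : E d → ℂ) (w z : E d × E d) :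
    ‖stftFun ψ (timeFreqShift w.1 w.2 φ) z‖ = ‖stftFun ψ φ (z - w)‖ := by
  rw [stftFun_timeFreqShift, norm_mul, mul_comm Complex.I, Complex.norm_exp_ofReal_mul_I, one_mul]

/-! ### Reconstruction of test functions -/

lemma integrable_norm_stftFun_mul_exp {t s : ℝ} (ht : 0 < t) (hs : 0 < s) (hst : 1 < s + t)
    {ψ f : E d → ℂ} (hψ : ψ ∈ GSSpace d t s) (hf : f ∈ GSSpace d t s) {r : ℝ} (hr : 0 ≤ r) :
    Integrable fun z => ‖stftFun ψ f z‖ * Real.exp (r * rho t s z) := by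
  obtain ⟨C, -, decay⟩ := exists_norm_stftFun_le ht hs hst hψ hf (R := r + 1) (by positivity)
  have hrho := continuous_rho (d := d) ht hs
  have hV := continuous_stftFun ht hψ hf
  refine ((integrable_exp_neg_rho (d := d) ht hs one_pos).const_mul C).mono'
    (by fun_prop : Continuous _).aestronglyMeasurable (.of_forall fun z => ?_)
  rw [Real.norm_of_nonneg (by positivity)]
  calc _ ≤ C * Real.exp (-(r + 1) * rho t s z) * Real.exp (r * rho t s z) := by
        gcongr
        exact decay z
    _ = _ := by
        rw [mul_assoc, ← Real.exp_add]
        ring_nf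

lemma integrable_stftFun_right {t s : ℝ} (ht : 0 < t) (hs : 0 < s) (hst : 1 < s + t)
    {ψ f : E d → ℂ} (hψ : ψ ∈ GSSpace d t s) (hf : f ∈ GSSpace d t s) (x : E d) :
    Integrable fun ξ => stftFun ψ f (x, ξ) := by
  obtain ⟨C, hC, decay⟩ := exists_norm_stftFun_le ht hs hst hψ hf zero_le_one
  refine ((integrable_exp_neg_rpow (one_div_pos.2 hs) one_pos).const_mul C).mono'
    ((continuous_stftFun ht hψ hf).comp (Continuous.prodMk_right x)).aestronglyMeasurable
    (.of_forall fun ξ => (decay (x, ξ)).trans ?_)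
  have : 0 ≤ ‖x‖ ^ (1 / t) := by positivity
  refine mul_le_mul_of_nonneg_left (Real.exp_le_exp.2 ?_) hC
  simp only [rho]
  linarith

lemma fourierConst_mul_stftFun (ψ f : E d → ℂ) (x ξ : E d) :
    (fourierConst d : ℂ) * stftFun ψ f (x, ξ) =
      fourierFun (fun y => f y * (starRingEnd ℂ) (ψ (y - x))) ξ := by
  unfold fourierFun stftFun timeFreqShift fourierConst
  refine congrArg _ (congrArg _ (funext fun y => ?_))
  rw [map_mul, ← Complex.exp_conj, map_mul, Complex.conj_I, Complex.conj_ofReal]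
  ring

/-- The constant `(2π)^d ‖ψ‖²` in the reconstruction formula. -/
def reconstructionConst (ψ : E d → ℂ) : ℝ := (fourierConst d * fourierConst d)⁻¹ * ∫ x, ‖ψ x‖ ^ 2

lemma reconstructionConst_pos {t s : ℝ} (ht : 0 < t) {ψ : E d → ℂ} (hψ : ψ ∈ GSSpace d t s)
    (h0 : ψ ≠ 0) : 0 < reconstructionConst ψ := by
  obtain ⟨B, -, hψB⟩ := exists_norm_le_of_mem_gsSpace hψ
  obtain ⟨y, hy⟩ := Function.ne_iff.1 h0
  have := fourierConst_pos d
  have hc : Continuous fun x => ‖ψ x‖ ^ 2 := (continuous_of_mem_gsSpace hψ).norm.pow 2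
  have hint : Integrable fun x => ‖ψ x‖ ^ 2 :=
    ((integrable_of_mem_gsSpace ht hψ).norm.mul_const B).mono' hc.aestronglyMeasurable
      (.of_forall fun x => by
        rw [Real.norm_of_nonneg (by positivity), sq]
        gcongr
        exact hψB x)
  exact mul_pos (by positivity) (integral_pos_of_integrable_nonneg_nonzero (x := y) hc hint
    (fun x => by positivity) (pow_ne_zero _ (norm_ne_zero_iff.2 hy)))

/- For fixed `x`, Fourier inversion applied to `f · conj (T_x ψ)`. -/
lemma integral_stftFun_mul_timeFreqShift_right {t s : ℝ} (ht : 0 < t) (hs : 0 < s)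
    (hst : 1 < s + t) {ψ f : E d → ℂ} (hψ : ψ ∈ GSSpace d t s) (hf : f ∈ GSSpace d t s)
    (x y : E d) : ∫ ξ, stftFun ψ f (x, ξ) * timeFreqShift x ξ ψ y =
      ((fourierConst d * fourierConst d)⁻¹ : ℝ) * (f y * ((‖ψ (y - x)‖ ^ 2 : ℝ) : ℂ)) := by
  obtain ⟨B, -, hψB⟩ := exists_norm_le_of_mem_gsSpace hψ
  have hfc := continuous_of_mem_gsSpace hf
  have hψc := continuous_of_mem_gsSpace hψ
  have hc0 : (fourierConst d : ℂ) ≠ 0 := mod_cast (fourierConst_pos d).ne'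
  set g : E d → ℂ := fun y => f y * (starRingEnd ℂ) (ψ (y - x)) with hg
  have hgc : Continuous g := by fun_prop
  have hgi : Integrable g := by
    refine ((integrable_of_mem_gsSpace ht hf).norm.mul_const B).mono' hgc.aestronglyMeasurable
      (.of_forall fun y => ?_)
    rw [hg, norm_mul, RCLike.norm_conj]
    gcongr
    exact hψB _
  have fourier_g : fourierFun g = fun ξ => (fourierConst d : ℂ) * stftFun ψ f (x, ξ) :=
    funext fun ξ => (fourierConst_mul_stftFun ψ f x ξ).symm
  have inversion := fourierFun_fourierFun_neg hgc hgi
    (fourier_g ▸ (integrable_stftFun_right ht hs hst hψ hf x).const_mul _) y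
  have integral_eq : ∫ ξ, stftFun ψ f (x, ξ) * timeFreqShift x ξ ψ y =
      ((fourierConst d * fourierConst d)⁻¹ : ℝ) * ψ (y - x) * fourierFun (fourierFun g) (-y) := by
    rw [fourierFun, fourier_g, ← mul_assoc, ← integral_const_mul]
    refine congrArg _ (funext fun ξ => ?_)
    rw [← fourierConst, timeFreqShift, inner_neg_right, real_inner_comm, Complex.ofReal_neg,
      neg_mul_neg, Complex.ofReal_inv, Complex.ofReal_mul]
    field_simp
  rw [integral_eq, inversion, ← Complex.normSq_eq_norm_sq, ← Complex.mul_conj]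
  ring

lemma integral_stftFun_mul_timeFreqShift {t s : ℝ} (ht : 0 < t) (hs : 0 < s) (hst : 1 < s + t)
    {ψ f : E d → ℂ} (hψ : ψ ∈ GSSpace d t s) (hf : f ∈ GSSpace d t s) (y : E d) :
    ∫ z, stftFun ψ f z * timeFreqShift z.1 z.2 ψ y = reconstructionConst ψ * f y := by
  obtain ⟨B, -, hψB⟩ := exists_norm_le_of_mem_gsSpace hψ
  have hψc := continuous_of_mem_gsSpace hψ
  have hV := continuous_stftFun ht hψ hf
  have hV_int : Integrable fun z => ‖stftFun ψ f z‖ := by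
    simpa using integrable_norm_stftFun_mul_exp ht hs hst hψ hf le_rfl
  have hint : Integrable fun z : E d × E d => stftFun ψ f z * timeFreqShift z.1 z.2 ψ y := by
    refine (hV_int.mul_const B).mono' ?_ (.of_forall fun z => ?_)
    · unfold timeFreqShift
      exact (by fun_prop : Continuous _).aestronglyMeasurable
    · rw [norm_mul, norm_timeFreqShift]
      gcongr
      exact hψB _
  have window_integral : ∫ x, ((‖ψ (y - x)‖ ^ 2 : ℝ) : ℂ) = ((∫ x, ‖ψ x‖ ^ 2 : ℝ) : ℂ) := by
    rw [integral_sub_left_eq_self (fun x => ((‖ψ x‖ ^ 2 : ℝ) : ℂ)) volume y]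
    exact integral_ofReal
  rw [Measure.volume_eq_prod, integral_prod _ (by rwa [← Measure.volume_eq_prod])]
  simp only [integral_stftFun_mul_timeFreqShift_right ht hs hst hψ hf]
  rw [integral_const_mul, integral_const_mul, window_integral, reconstructionConst]
  push_cast
  ring

lemma GSBound.norm_md_le {t s h B : ℝ} {f : Sm d} (hf : GSBound t s h B f) (β : Fin d → ℕ)
    (x : E d) : ‖(md β f).1 x‖ ≤ B * wt t s h 0 β := by
  have := hf 0 β x
  rwa [mpow_zero, Complex.ofReal_one, one_mul] at this

lemma continuous_md_tfShift {t s : ℝ} (ht : 0 < t) (hs : 0 < s) (hst : 1 < s + t) {ψ : Sm d}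
    (hψ : ψ.1 ∈ GSSpace d t s) (β : Fin d → ℕ) (y : E d) :
    Continuous fun z => (md β (tfShift z ψ)).1 y := by
  refine continuous_iff_continuousAt.2 fun z₀ => ?_
  obtain ⟨C, -, sub_bound⟩ := exists_gsBound_tfShift_sub ht hs hst one_pos hψ z₀
  refine continuousAt_of_locally_lipschitz one_pos (C * wt t s 1 0 β) fun z hz => ?_
  rw [dist_eq_norm] at hz ⊢
  rw [dist_eq_norm, mul_right_comm]
  have hle := (sub_bound z hz.le).norm_md_le β y
  rwa [map_sub] at hle

lemma hasDerivAt_md_line (β : Fin d → ℕ) (i : Fin d) (f : Sm d) (y : E d) (a : ℝ) :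
    HasDerivAt (fun a : ℝ => (md β f).1 (y + a • EuclideanSpace.single i (1 : ℝ)))
      ((md (β + Pi.single i 1) f).1 (y + a • EuclideanSpace.single i (1 : ℝ))) a := by
  have hline : HasDerivAt (fun a : ℝ => y + a • EuclideanSpace.single i (1 : ℝ))
      (EuclideanSpace.single i (1 : ℝ)) a := by
    simpa using ((hasDerivAt_id a).smul_const (EuclideanSpace.single i (1 : ℝ))).const_add y
  rw [md_add_single]
  exact (differentiable_coe (md β f) _).hasFDerivAt.comp_hasDerivAt a hline

lemma exists_norm_md_tfShift_le {t s : ℝ} (ht : 0 < t) (hs : 0 < s) (hst : 1 < s + t)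
    {ψ f : Sm d} (hψ : ψ.1 ∈ GSSpace d t s) (hf : f.1 ∈ GSSpace d t s) (β : Fin d → ℕ) :
    ∃ bound : E d × E d → ℝ, Integrable bound ∧
      ∀ z y, ‖stftFun ψ.1 f.1 z * (md β (tfShift z ψ)).1 y‖ ≤ bound z := by
  obtain ⟨C, r, -, hr, shift_bound⟩ := exists_gsBound_tfShift ht hs hst one_pos hψ
  refine ⟨_, (integrable_norm_stftFun_mul_exp ht hs hst hψ hf hr).mul_const (C * wt t s 1 0 β),
    fun z y => ?_⟩
  rw [norm_mul, mul_assoc]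
  gcongr
  exact ((shift_bound z).norm_md_le β y).trans_eq (by ring)

lemma integral_stftFun_mul_md_tfShift {t s : ℝ} (ht : 0 < t) (hs : 0 < s) (hst : 1 < s + t)
    {ψ f : Sm d} (hψ : ψ.1 ∈ GSSpace d t s) (hf : f.1 ∈ GSSpace d t s) (β : Fin d → ℕ) (y : E d) :
    ∫ z, stftFun ψ.1 f.1 z * (md β (tfShift z ψ)).1 y =
      reconstructionConst ψ.1 * (md β f).1 y := by
  have meas : ∀ (β : Fin d → ℕ) (y : E d), AEStronglyMeasurable
      (fun z => stftFun ψ.1 f.1 z * (md β (tfShift z ψ)).1 y) := fun β y =>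
    ((continuous_stftFun ht hψ hf).mul
      (continuous_md_tfShift ht hs hst hψ β y)).aestronglyMeasurable
  induction β using multiindex_induction generalizing y with
  | zero =>
    simp only [md_zero]
    exact integral_stftFun_mul_timeFreqShift ht hs hst hψ hf y
  | add_single β i ih =>
    obtain ⟨bound, bound_int, le_bound⟩ := exists_norm_md_tfShift_le ht hs hst hψ hf β
    obtain ⟨bound', bound_int', le_bound'⟩ :=
      exists_norm_md_tfShift_le ht hs hst hψ hf (β + Pi.single i 1)
    let F : ℝ → E d × E d → ℂ := fun a z => stftFun ψ.1 f.1 z *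
      (md β (tfShift z ψ)).1 (y + a • EuclideanSpace.single i (1 : ℝ))
    let F' : ℝ → E d × E d → ℂ := fun a z => stftFun ψ.1 f.1 z *
      (md (β + Pi.single i 1) (tfShift z ψ)).1 (y + a • EuclideanSpace.single i (1 : ℝ))
    have F_deriv : ∀ z, ∀ a ∈ (Set.univ : Set ℝ), HasDerivAt (F · z) (F' a z) a := fun z a _ =>
      (hasDerivAt_md_line β i (tfShift z ψ) y a).const_mul (stftFun ψ.1 f.1 z)
    have F_meas : ∀ a, AEStronglyMeasurable (F a) := fun a => meas β _
    have F_int : Integrable (F 0) :=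
      bound_int.mono' (F_meas 0) (.of_forall fun z => le_bound z _)
    have F'_meas : AEStronglyMeasurable (F' 0) := meas _ _
    have F'_le : ∀ z, ∀ a ∈ (Set.univ : Set ℝ), ‖F' a z‖ ≤ bound' z := fun z a _ => le_bound' z _
    have deriv_integral : HasDerivAt (fun a => ∫ z, F a z) (∫ z, F' 0 z) 0 :=
      (hasDerivAt_integral_of_dominated_loc_of_deriv_le (μ := volume) Filter.univ_mem
        (.of_forall F_meas) F_int F'_meas (.of_forall F'_le) bound_int' (.of_forall F_deriv)).2
    simp only [F, ih] at deriv_integral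
    have deriv_eq := deriv_integral.unique
      ((hasDerivAt_md_line β i f y 0).const_mul (reconstructionConst ψ.1 : ℂ))
    simpa only [F', zero_smul, add_zero] using deriv_eq

/-! ### Reconstruction and ultradistributions -/

/-- The family `x^α D^β f(x) / (h^|α + β| α!^t β!^s)`, indexed by `(α, β, x)`, as an element of
`ℓ^∞`. It embeds the space normed by `‖·‖_{t,s,h}` isometrically into a Banach space, where
vector-valued integrals are available. -/
def gsFamily (t s : ℝ) {h : ℝ} (hh : 0 < h) :
    GSSpace d t s →ₗ[ℂ] lp (fun _ : (Fin d → ℕ) × (Fin d → ℕ) × E d => ℂ) ∞ where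
  toFun f := ⟨fun i => (mpow i.1 i.2.2 : ℂ) * (md i.2.1 (toSm f)).1 i.2.2 / wt t s h i.1 i.2.1, by
    obtain ⟨B, -, hf⟩ := exists_gsBound f hh
    refine memℓp_infty ⟨B, ?_⟩
    rintro _ ⟨i, rfl⟩
    have hW := wt_pos (t := t) (s := s) hh i.1 i.2.1
    simp only
    rw [norm_div, Complex.norm_real, Real.norm_of_nonneg hW.le, div_le_iff₀ hW]
    exact hf _ _ _⟩
  map_add' f g := by
    ext i
    have hadd : toSm (f + g) = toSm f + toSm g := rfl
    simp only [hadd, map_add]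
    change _ * ((md i.2.1 (toSm f)).1 i.2.2 + (md i.2.1 (toSm g)).1 i.2.2) / _ = _ / _ + _ / _
    ring
  map_smul' c f := by
    ext i
    have hsmul : toSm (c • f) = c • toSm f := rfl
    simp only [hsmul, map_smul]
    change _ * (c * (md i.2.1 (toSm f)).1 i.2.2) / _ = c * (_ / _)
    ring

lemma gsFamily_apply {t s h : ℝ} (hh : 0 < h) (f : GSSpace d t s)
    (i : (Fin d → ℕ) × (Fin d → ℕ) × E d) :
    gsFamily t s hh f i =
      (mpow i.1 i.2.2 : ℂ) * (md i.2.1 (toSm f)).1 i.2.2 / wt t s h i.1 i.2.1 := rfl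

lemma GSBound.norm_gsFamily_le {t s h B : ℝ} (hh : 0 < h) (hB : 0 ≤ B) {f : GSSpace d t s}
    (hf : GSBound t s h B (toSm f)) : ‖gsFamily t s hh f‖ ≤ B := by
  refine lp.norm_le_of_forall_le hB fun i => ?_
  have hW := wt_pos (t := t) (s := s) hh i.1 i.2.1
  rw [gsFamily_apply, norm_div, Complex.norm_real, Real.norm_of_nonneg hW.le, div_le_iff₀ hW]
  exact hf _ _ _

lemma gsBound_norm_gsFamily {t s h : ℝ} (hh : 0 < h) (f : GSSpace d t s) :
    GSBound t s h ‖gsFamily t s hh f‖ (toSm f) := by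
  intro α β x
  have hW := wt_pos (t := t) (s := s) hh α β
  have hle := lp.norm_apply_le_norm ENNReal.top_ne_zero (gsFamily t s hh f) (α, β, x)
  rwa [gsFamily_apply, norm_div, Complex.norm_real, Real.norm_of_nonneg hW.le,
    div_le_iff₀ hW] at hle

lemma gsFamily_injective {t s h : ℝ} (hh : 0 < h) :
    Function.Injective (gsFamily (d := d) t s hh) := by
  rw [← LinearMap.ker_eq_bot, LinearMap.ker_eq_bot']
  intro f hf
  have hbound := gsBound_norm_gsFamily hh f
  rw [hf, norm_zero] at hbound
  ext x
  exact norm_le_zero_iff.1 (hbound.norm_le x)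

/- Hahn–Banach; the conjugation turns the conjugate linear `u` into a linear functional. -/
lemma GSDual.exists_clm_gsFamily {t s : ℝ} (u : GSDual d t s) :
    ∃ (h : ℝ) (hh : 0 < h) (L : StrongDual ℂ (lp (fun _ => ℂ) ∞)),
      ∀ f, L (gsFamily t s hh f) = (starRingEnd ℂ) (u.pair f) := by
  obtain ⟨h, C, hh, -, pair_le⟩ := u.exists_norm_pair_le
  let conjPair : GSSpace d t s →ₗ[ℂ] ℂ :=
    { toFun := fun f => (starRingEnd ℂ) (u.pair f)
      map_add' := fun f g => by simp [GSDual.pair]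
      map_smul' := fun a f => by simp [GSDual.pair] }
  let e := LinearEquiv.ofInjective (gsFamily t s hh) (gsFamily_injective (d := d) hh)
  let onRange : StrongDual ℂ (LinearMap.range (gsFamily (d := d) t s hh)) :=
    (conjPair.comp e.symm.toLinearMap).mkContinuous C fun v => by
      obtain ⟨f, rfl⟩ := e.surjective v
      rw [LinearMap.comp_apply, LinearEquiv.coe_coe, LinearEquiv.symm_apply_apply]
      exact (RCLike.norm_conj _).trans_le
        (pair_le f _ (norm_nonneg _) (gsBound_norm_gsFamily hh f))
  obtain ⟨L, hL, -⟩ := exists_extension_norm_eq _ onRange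
  exact ⟨h, hh, L, fun f => (hL (e f)).trans (congrArg conjPair (e.symm_apply_apply f))⟩

/-- `tfShift` as a map of `Σ_t^s(ℝᵈ)`: the time-frequency shift `M_ξ T_x` by `z = (x, ξ)`. -/
def gsShift {t s : ℝ} (ht : 0 < t) (hs : 0 < s) (z : E d × E d) (ψ : GSSpace d t s) :
    GSSpace d t s :=
  ⟨timeFreqShift z.1 z.2 (ψ : E d → ℂ), IsGelfandShilov.timeFreqShift ht hs z.1 z.2 ψ.2⟩

lemma toSm_gsShift {t s : ℝ} (ht : 0 < t) (hs : 0 < s) (z : E d × E d) (ψ : GSSpace d t s) :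
    toSm (gsShift ht hs z ψ) = tfShift z (toSm ψ) := rfl

lemma GSDual.exists_norm_pair_gsShift_le {t s : ℝ} (ht : 0 < t) (hs : 0 < s) (hst : 1 < s + t)
    (u : GSDual d t s) (ψ : GSSpace d t s) : ∃ C r : ℝ, 0 ≤ C ∧ 0 ≤ r ∧
      ∀ z, ‖u.pair (gsShift ht hs z ψ)‖ ≤ C * Real.exp (r * rho t s z) := by
  obtain ⟨h, C, hh, hC, pair_le⟩ := u.exists_norm_pair_le
  obtain ⟨C', r, hC', hr, shift_bound⟩ := exists_gsBound_tfShift ht hs hst hh (f := toSm ψ) ψ.2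
  refine ⟨C * C', r, by positivity, hr, fun z => ?_⟩
  rw [mul_assoc]
  exact pair_le _ _ (by positivity) (shift_bound z)

lemma continuous_gsFamily_gsShift {t s h : ℝ} (ht : 0 < t) (hs : 0 < s) (hst : 1 < s + t)
    (hh : 0 < h) (ψ : GSSpace d t s) :
    Continuous fun z => gsFamily t s hh (gsShift ht hs z ψ) := by
  refine continuous_iff_continuousAt.2 fun z₀ => ?_
  obtain ⟨C, hC, sub_bound⟩ := exists_gsBound_tfShift_sub ht hs hst hh (f := toSm ψ) ψ.2 z₀
  refine continuousAt_of_locally_lipschitz one_pos C fun z hz => ?_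
  rw [dist_eq_norm] at hz
  rw [dist_eq_norm, dist_eq_norm, ← map_sub]
  exact GSBound.norm_gsFamily_le hh (by positivity) (sub_bound z hz.le)

lemma integrable_stftFun_smul_gsFamily {t s h : ℝ} (ht : 0 < t) (hs : 0 < s) (hst : 1 < s + t)
    (hh : 0 < h) (ψ f : GSSpace d t s) :
    Integrable fun z => stftFun ψ.1 f.1 z • gsFamily t s hh (gsShift ht hs z ψ) := by
  obtain ⟨C, r, hC, hr, shift_bound⟩ := exists_gsBound_tfShift ht hs hst hh (f := toSm ψ) ψ.2
  refine ((integrable_norm_stftFun_mul_exp ht hs hst ψ.2 f.2 hr).mul_const C).mono'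
    ((continuous_stftFun ht ψ.2 f.2).smul
      (continuous_gsFamily_gsShift ht hs hst hh ψ)).aestronglyMeasurable
    (.of_forall fun z => ?_)
  rw [norm_smul, mul_assoc, mul_comm _ C]
  gcongr
  exact GSBound.norm_gsFamily_le hh (by positivity) (shift_bound z)

lemma integral_stftFun_smul_gsFamily {t s h : ℝ} (ht : 0 < t) (hs : 0 < s) (hst : 1 < s + t)
    (hh : 0 < h) (ψ f : GSSpace d t s) :
    ∫ z, stftFun ψ.1 f.1 z • gsFamily t s hh (gsShift ht hs z ψ) =
      (reconstructionConst ψ.1 : ℂ) • gsFamily t s hh f := by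
  ext i
  have eval_integral := (lp.evalCLM ℂ (fun _ => ℂ) ∞ i).integral_comp_comm
    (integrable_stftFun_smul_gsFamily ht hs hst hh ψ f)
  have eval_eq : ∀ z, lp.evalCLM ℂ (fun _ => ℂ) ∞ i
      (stftFun ψ.1 f.1 z • gsFamily t s hh (gsShift ht hs z ψ)) =
      (mpow i.1 i.2.2 : ℂ) / wt t s h i.1 i.2.1 *
        (stftFun ψ.1 f.1 z * (md i.2.1 (tfShift z (toSm ψ))).1 i.2.2) := fun z => by
    change stftFun ψ.1 f.1 z * gsFamily t s hh (gsShift ht hs z ψ) i = _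
    rw [gsFamily_apply, toSm_gsShift]
    ring
  simp only [eval_eq] at eval_integral
  rw [integral_const_mul] at eval_integral
  refine eval_integral.symm.trans ?_
  refine (congrArg _ (integral_stftFun_mul_md_tfShift ht hs hst
    (ψ := toSm ψ) (f := toSm f) ψ.2 f.2 i.2.1 i.2.2)).trans ?_
  change _ = (reconstructionConst (toSm ψ).1 : ℂ) * gsFamily t s hh f i
  rw [gsFamily_apply]
  ring

lemma GSDual.norm_pair_le_integral {t s : ℝ} (ht : 0 < t) (hs : 0 < s) (hst : 1 < s + t)
    (u : GSDual d t s) {ψ : GSSpace d t s} (hψ : ψ ≠ 0) (f : GSSpace d t s) :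
    ‖u.pair f‖ ≤ (reconstructionConst ψ.1)⁻¹ *
      ∫ z, ‖stftFun ψ.1 f.1 z‖ * ‖u.pair (gsShift ht hs z ψ)‖ := by
  have hconst := reconstructionConst_pos ht ψ.2 fun h => hψ (Subtype.ext h)
  obtain ⟨h, hh, L, hL⟩ := u.exists_clm_gsFamily
  have pair_eq := L.integral_comp_comm (integrable_stftFun_smul_gsFamily ht hs hst hh ψ f)
  rw [integral_stftFun_smul_gsFamily ht hs hst hh, map_smul, hL] at pair_eq
  rw [inv_mul_eq_div, le_div_iff₀' hconst]
  calc reconstructionConst ψ.1 * ‖u.pair f‖ =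
        ‖∫ z, L (stftFun ψ.1 f.1 z • gsFamily t s hh (gsShift ht hs z ψ))‖ := by
        rw [pair_eq, norm_smul, RCLike.norm_conj, Complex.norm_real, Real.norm_of_nonneg hconst.le]
    _ ≤ ∫ z, ‖L (stftFun ψ.1 f.1 z • gsFamily t s hh (gsShift ht hs z ψ))‖ :=
        norm_integral_le_integral_norm _
    _ = _ := by simp only [map_smul, hL, norm_smul, RCLike.norm_conj]

/-! ### Independence of the window -/

/-- The dilation `(x, ξ) ↦ (l ^ t x, l ^ s ξ)` of phase space. -/
def dil (t s l : ℝ) (p : E d × E d) : E d × E d := (l ^ t • p.1, l ^ s • p.2)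

lemma rho_dil {t s l : ℝ} (ht : t ≠ 0) (hs : s ≠ 0) (hl : 0 ≤ l) (p : E d × E d) :
    rho t s (dil t s l p) = l * rho t s p := rho_rpow_smul ht hs hl p.1 p.2

lemma dil_sub (t s l : ℝ) (p q : E d × E d) :
    dil t s l (p - q) = dil t s l p - dil t s l q :=
  Prod.ext (smul_sub _ _ _) (smul_sub _ _ _)

lemma dil_surjective (t s : ℝ) {l : ℝ} (hl : 0 < l) :
    Function.Surjective (dil (d := d) t s l) := fun w =>
  ⟨((l ^ t)⁻¹ • w.1, (l ^ s)⁻¹ • w.2), Prod.ext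
    (smul_inv_smul₀ (Real.rpow_pos_of_pos hl t).ne' _)
    (smul_inv_smul₀ (Real.rpow_pos_of_pos hl s).ne' _)⟩

lemma rho_le_of_norm_le {t s M : ℝ} (ht : 0 ≤ t) (hs : 0 ≤ s) {p : E d × E d} (hp : ‖p‖ ≤ M) :
    rho t s p ≤ M ^ (1 / t) + M ^ (1 / s) := by
  have fst_le := (norm_fst_le p).trans hp
  have snd_le := (norm_snd_le p).trans hp
  unfold rho
  gcongr

lemma le_rho_of_le_norm {t s ε : ℝ} (ht : 0 ≤ t) (hs : 0 ≤ s) (hε : 0 ≤ ε) {p : E d × E d}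
    (hp : ε ≤ ‖p‖) : min (ε ^ (1 / t)) (ε ^ (1 / s)) ≤ rho t s p := by
  rw [Prod.norm_def] at hp
  unfold rho
  rcases le_max_iff.1 hp with hfst | hsnd
  · exact (min_le_left _ _).trans ((Real.rpow_le_rpow hε hfst (by positivity)).trans
      (le_add_of_nonneg_right (by positivity)))
  · exact (min_le_right _ _).trans ((Real.rpow_le_rpow hε hsnd (by positivity)).trans
      (le_add_of_nonneg_left (by positivity)))

/- After scaling, `rho (dil l (q - p)) = l * rho (q - p)` is at least a multiple of `l`, so it
absorbs both `r * l` and the contribution of `p` to `rho (dil l q)`. -/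
lemma exists_rho_dil_add_le {t s ε M r₀ r : ℝ} (ht : 0 < t) (hs : 0 < s) (hε : 0 < ε)
    (hM : 0 ≤ M) (hr₀ : 0 ≤ r₀) (hr : 0 ≤ r) :
    ∃ R : ℝ, 0 ≤ R ∧ ∀ l : ℝ, 0 ≤ l → ∀ p q : E d × E d, ‖p‖ ≤ M → ε ≤ ‖q - p‖ →
      r₀ * rho t s (dil t s l q) + r * l ≤ R * rho t s (dil t s l q - dil t s l p) := by
  obtain ⟨K, hK, rho_add_le⟩ := exists_rho_add_le (d := d) ht.le hs.le
  set c := min (ε ^ (1 / t)) (ε ^ (1 / s))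
  set m := M ^ (1 / t) + M ^ (1 / s)
  have hc : 0 < c := by positivity
  have : 0 ≤ m := by positivity
  refine ⟨r₀ * K + (r₀ * K * m + r) / c, by positivity, fun l hl p q hp hq => ?_⟩
  set ρ := rho t s (dil t s l q - dil t s l p) with hρ
  have l_le : l ≤ ρ / c := by
    rw [le_div_iff₀ hc, hρ, ← dil_sub, rho_dil ht.ne' hs.ne' hl]
    gcongr
    exact le_rho_of_le_norm ht.le hs.le hε.le hq
  have rho_q_le : rho t s (dil t s l q) ≤ K * (ρ + l * m) := by
    have triangle := rho_add_le (dil t s l q - dil t s l p) (dil t s l p)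
    rw [sub_add_cancel, rho_dil ht.ne' hs.ne' hl p] at triangle
    refine triangle.trans ?_
    gcongr
    exact rho_le_of_norm_le ht.le hs.le hp
  calc r₀ * rho t s (dil t s l q) + r * l ≤ r₀ * (K * (ρ + l * m)) + r * l := by gcongr
    _ = r₀ * K * ρ + (r₀ * K * m + r) * l := by ring
    _ ≤ r₀ * K * ρ + (r₀ * K * m + r) * (ρ / c) := by gcongr
    _ = _ := by ring

/-- `G (l ^ t x, l ^ s ξ)` decays faster than every exponential in `l`, uniformly for
`(x, ξ) ∈ U`: the estimate that defines the complement of the wave front set. -/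
def DilDecay (t s : ℝ) (G : E d × E d → ℝ) (U : Set (E d × E d)) : Prop :=
  ∀ r : ℝ, 0 < r → ∃ C : ℝ, ∀ l : ℝ, 0 < l → ∀ p ∈ U, Real.exp (r * l) * G (dil t s l p) ≤ C

lemma DilDecay.anti {t s : ℝ} {G : E d × E d → ℝ} {U V : Set (E d × E d)}
    (h : DilDecay t s G U) (hVU : V ⊆ U) : DilDecay t s G V := fun r hr =>
  let ⟨C, hC⟩ := h r hr
  ⟨C, fun l hl p hp => hC l hl p (hVU hp)⟩

lemma DilDecay.of_le_mul {t s t' s' k : ℝ} (hk : 0 ≤ k) {F G : E d × E d → ℝ}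
    {Θ : E d × E d → E d × E d} {U : Set (E d × E d)} (h : DilDecay t s G U)
    (hFG : ∀ l : ℝ, 0 < l → ∀ p, F (dil t' s' l p) ≤ k * G (dil t s l (Θ p))) :
    DilDecay t' s' F (Θ ⁻¹' U) := fun r hr => by
  obtain ⟨C, hC⟩ := h r hr
  refine ⟨k * C, fun l hl p hp => ?_⟩
  calc Real.exp (r * l) * F (dil t' s' l p) ≤
        Real.exp (r * l) * (k * G (dil t s l (Θ p))) := by gcongr; exact hFG l hl p
    _ = k * (Real.exp (r * l) * G (dil t s l (Θ p))) := by ring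
    _ ≤ k * C := by gcongr; exact hC l hl _ hp

lemma mem_waveFrontSet_iff {t s : ℝ} (ht : 0 < t) (hs : 0 < s) {ψ : GSSpace d t s}
    {u : GSDual d t s} {z : E d × E d} : z ∈ waveFrontSet ht hs ψ u ↔
      z ≠ 0 ∧ ∀ U ∈ nhds z, ¬ DilDecay t s (fun w => ‖u.pair (gsShift ht hs w ψ)‖) U := by
  have norm_stft : ∀ w : E d × E d,
      ‖stft ht hs ψ u w.1 w.2‖ = fourierConst d * ‖u.pair (gsShift ht hs w ψ)‖ := fun w => by
    change ‖(fourierConst d : ℂ) * u.pair (gsShift ht hs w ψ)‖ = _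
    rw [norm_mul, Complex.norm_real, Real.norm_of_nonneg (fourierConst_pos d).le]
  have decay_iff : ∀ U : Set (E d × E d),
      DilDecay t s (fun w => ‖stft ht hs ψ u w.1 w.2‖) U ↔
        DilDecay t s (fun w => ‖u.pair (gsShift ht hs w ψ)‖) U := fun U => by
    have hconst := fourierConst_pos d
    refine ⟨fun h => h.of_le_mul (Θ := id) (inv_nonneg.2 hconst.le) fun l _ p => ?_,
      fun h => h.of_le_mul (Θ := id) hconst.le fun l _ p => (norm_stft _).le⟩
    rw [norm_stft, inv_mul_cancel_left₀ hconst.ne', id]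
  refine and_congr_right fun hz => ⟨fun h U hU hdecay => h ?_, ?_⟩
  · obtain ⟨V, hV, V_open, hzV⟩ := mem_nhds_iff.1 (Filter.inter_mem hU
      (isOpen_compl_singleton.mem_nhds hz))
    exact ⟨V, V_open, fun p hp => (hV hp).2, hzV,
      ((decay_iff U).2 hdecay).anti fun p hp => (hV hp).1⟩
  · rintro h ⟨U, U_open, -, hzU, hdecay⟩
    exact h U (U_open.mem_nhds hzU) ((decay_iff U).1 hdecay)

/- Near `p` the decay of `G` is used, and away from `p` that of `V`. -/
lemma exists_mul_le_exp_neg {t s ε Cg r₀ r : ℝ} (ht : 0 < t) (hs : 0 < s) (hε : 0 < ε)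
    (hr₀ : 0 ≤ r₀) (hr : 0 < r) {V G : E d × E d → ℝ}
    (V_decay : ∀ R : ℝ, 0 ≤ R → ∃ C : ℝ, 0 ≤ C ∧ ∀ w, V w ≤ C * Real.exp (-R * rho t s w))
    (G_nonneg : ∀ w, 0 ≤ G w) (G_growth : ∀ w, G w ≤ Cg * Real.exp (r₀ * rho t s w))
    {z : E d × E d} (G_decay : DilDecay t s G (Metric.ball z (2 * ε))) :
    ∃ C : ℝ, ∀ l : ℝ, 0 < l → ∀ p ∈ Metric.ball z ε, ∀ w,
      V (w - dil t s l p) * G w ≤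
        C * Real.exp (-(r * l)) * Real.exp (-1 * rho t s (w - dil t s l p)) := by
  obtain ⟨R, hR, rho_le⟩ := exists_rho_dil_add_le (d := d) ht hs hε
    (show 0 ≤ ‖z‖ + ε by positivity) hr₀ hr.le
  obtain ⟨Cn, hCn⟩ := G_decay r hr
  obtain ⟨Cv, hCv, V_le⟩ := V_decay (R + 1) (by positivity)
  have Cg_nonneg : 0 ≤ Cg :=
    nonneg_of_mul_nonneg_left ((G_nonneg 0).trans (G_growth 0)) (Real.exp_pos _)
  have Cn_nonneg : 0 ≤ Cn := (mul_nonneg (Real.exp_pos _).le (G_nonneg _)).trans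
    (hCn 1 one_pos z (Metric.mem_ball_self (by positivity)))
  refine ⟨Cv * (Cn + Cg), fun l hl p hp w => ?_⟩
  obtain ⟨q, rfl⟩ := dil_surjective t s hl w
  set ρ := rho t s (dil t s l q - dil t s l p)
  have hρ : 0 ≤ ρ := rho_nonneg _ _ _
  rw [Metric.mem_ball] at hp
  have G_le : G (dil t s l q) ≤ (Cn + Cg) * Real.exp (-(r * l) + R * ρ) := by
    by_cases hq : dist q p < ε
    · have near := hCn l hl q ((dist_triangle q p z).trans_lt (by linarith))
      calc G (dil t s l q) ≤ Cn * Real.exp (-(r * l)) := by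
            rwa [Real.exp_neg, ← div_eq_mul_inv, le_div_iff₀' (Real.exp_pos _)]
        _ ≤ _ := by gcongr <;> simp only [le_add_iff_nonneg_right] <;> positivity
    · have norm_p_le : ‖p‖ ≤ ‖z‖ + ε := by
        linarith [norm_le_norm_add_norm_sub' p z, dist_eq_norm p z]
      have far := rho_le l hl.le p q norm_p_le (by rwa [← dist_eq_norm, ← not_lt])
      calc G (dil t s l q) ≤ Cg * Real.exp (r₀ * rho t s (dil t s l q)) := G_growth _
        _ ≤ _ := by
          gcongr
          · exact le_add_of_nonneg_left Cn_nonneg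
          · linarith
  have exp_eq : Real.exp (-(R + 1) * ρ) * Real.exp (-(r * l) + R * ρ) =
      Real.exp (-(r * l)) * Real.exp (-1 * ρ) := by
    rw [← Real.exp_add, ← Real.exp_add]
    ring_nf
  calc V (dil t s l q - dil t s l p) * G (dil t s l q) ≤
        Cv * Real.exp (-(R + 1) * ρ) * ((Cn + Cg) * Real.exp (-(r * l) + R * ρ)) :=
        mul_le_mul (V_le _) G_le (G_nonneg _) (by positivity)
    _ = _ := by linear_combination Cv * (Cn + Cg) * exp_eq

lemma DilDecay.integral_mul {t s Cg r₀ : ℝ} (ht : 0 < t) (hs : 0 < s) (hr₀ : 0 ≤ r₀)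
    {V G : E d × E d → ℝ} (V_nonneg : ∀ w, 0 ≤ V w)
    (V_decay : ∀ R : ℝ, 0 ≤ R → ∃ C : ℝ, 0 ≤ C ∧ ∀ w, V w ≤ C * Real.exp (-R * rho t s w))
    (G_nonneg : ∀ w, 0 ≤ G w) (G_growth : ∀ w, G w ≤ Cg * Real.exp (r₀ * rho t s w))
    {z : E d × E d} {U : Set (E d × E d)} (hU : U ∈ nhds z) (G_decay : DilDecay t s G U) :
    ∃ U' ∈ nhds z, DilDecay t s (fun p => ∫ w, V (w - p) * G w) U' := by
  obtain ⟨ε, hε, ball_subset⟩ := Metric.mem_nhds_iff.1 hU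
  have G_decay_ball : DilDecay t s G (Metric.ball z (2 * (ε / 2))) :=
    G_decay.anti (by rwa [mul_div_cancel₀ _ two_ne_zero])
  refine ⟨Metric.ball z (ε / 2), Metric.ball_mem_nhds z (half_pos hε), fun r hr => ?_⟩
  obtain ⟨C, mul_le⟩ := exists_mul_le_exp_neg ht hs (half_pos hε) hr₀ hr V_decay G_nonneg
    G_growth G_decay_ball
  have : (volume : Measure (E d × E d)).IsAddRightInvariant := by
    rw [Measure.volume_eq_prod]
    infer_instance
  refine ⟨C * ∫ w : E d × E d, Real.exp (-1 * rho t s w), fun l hl p hp => ?_⟩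
  have integral_le : ∫ w, V (w - dil t s l p) * G w ≤
      C * Real.exp (-(r * l)) * ∫ w : E d × E d, Real.exp (-1 * rho t s w) := by
    rw [← integral_sub_right_eq_self (fun w => Real.exp (-1 * rho t s w)) (dil t s l p),
      ← integral_const_mul]
    exact integral_mono_of_nonneg (.of_forall fun w => mul_nonneg (V_nonneg _) (G_nonneg w))
      (((integrable_exp_neg_rho ht hs one_pos).comp_sub_right _).const_mul _)
      (.of_forall (mul_le l hl p hp))
  calc Real.exp (r * l) * ∫ w, V (w - dil t s l p) * G w ≤ Real.exp (r * l) *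
        (C * Real.exp (-(r * l)) * ∫ w : E d × E d, Real.exp (-1 * rho t s w)) := by gcongr
    _ = Real.exp (r * l) * Real.exp (-(r * l)) *
        (C * ∫ w : E d × E d, Real.exp (-1 * rho t s w)) := by ring
    _ = _ := by rw [← Real.exp_add, add_neg_cancel, Real.exp_zero, one_mul]

lemma waveFrontSet_subset {t s : ℝ} (ht : 0 < t) (hs : 0 < s) (hst : 1 < s + t)
    (u : GSDual d t s) {ψ : GSSpace d t s} (hψ : ψ ≠ 0) (φ : GSSpace d t s) :
    waveFrontSet ht hs φ u ⊆ waveFrontSet ht hs ψ u := by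
  intro z hz
  rw [mem_waveFrontSet_iff] at hz ⊢
  refine ⟨hz.1, fun U hU hdecay => ?_⟩
  obtain ⟨Cg, r₀, -, hr₀, growth⟩ := u.exists_norm_pair_gsShift_le ht hs hst ψ
  obtain ⟨U', hU', hdecay'⟩ := hdecay.integral_mul ht hs hr₀
    (V := fun w => ‖stftFun ψ.1 φ.1 w‖) (fun _ => norm_nonneg _)
    (fun R hR => exists_norm_stftFun_le ht hs hst ψ.2 φ.2 hR) (fun _ => norm_nonneg _) growth hU
  have hconst := reconstructionConst_pos ht ψ.2 fun h => hψ (Subtype.ext h)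
  refine hz.2 U' hU' (hdecay'.of_le_mul (Θ := id) (inv_nonneg.2 hconst.le) fun l _ p => ?_)
  refine (u.norm_pair_le_integral ht hs hst hψ _).trans_eq ?_
  simp only [gsShift, norm_stftFun_timeFreqShift, id]

lemma waveFrontSet_eq {t s : ℝ} (ht : 0 < t) (hs : 0 < s) (hst : 1 < s + t) (u : GSDual d t s)
    {ψ φ : GSSpace d t s} (hψ : ψ ≠ 0) (hφ : φ ≠ 0) :
    waveFrontSet ht hs φ u = waveFrontSet ht hs ψ u :=
  (waveFrontSet_subset ht hs hst u hψ φ).antisymm (waveFrontSet_subset ht hs hst u hφ ψ)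

/-! ### Transport of wave front sets -/

lemma mem_waveFrontSet_of_le {t s t' s' k : ℝ} (ht : 0 < t) (hs : 0 < s) (ht' : 0 < t')
    (hs' : 0 < s') (hk : 0 ≤ k) {u : GSDual d t s} {ψ : GSSpace d t s} {v : GSDual d t' s'}
    {φ : GSSpace d t' s'} {Θ : E d × E d → E d × E d} {p : E d × E d} (hΘ : ContinuousAt Θ p)
    (hΘp : Θ p ≠ 0) (h : ∀ l : ℝ, 0 < l → ∀ q,
      ‖v.pair (gsShift ht' hs' (dil t' s' l q) φ)‖ ≤
        k * ‖u.pair (gsShift ht hs (dil t s l (Θ q)) ψ)‖)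
    (hp : p ∈ waveFrontSet ht' hs' φ v) : Θ p ∈ waveFrontSet ht hs ψ u := by
  rw [mem_waveFrontSet_iff] at hp ⊢
  exact ⟨hΘp, fun U hU hdecay => hp.2 _ (hΘ hU) (hdecay.of_le_mul hk h)⟩

lemma waveFrontSet_eq_image {t s t' s' k : ℝ} (ht : 0 < t) (hs : 0 < s) (ht' : 0 < t')
    (hs' : 0 < s') (hk : 0 < k) {u : GSDual d t s} {ψ : GSSpace d t s} {v : GSDual d t' s'}
    {φ : GSSpace d t' s'} (Θ : (E d × E d) ≃ₜ (E d × E d)) (hΘ : Θ 0 = 0)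
    (h : ∀ l : ℝ, 0 < l → ∀ p, ‖v.pair (gsShift ht' hs' (dil t' s' l (Θ p)) φ)‖ =
      k * ‖u.pair (gsShift ht hs (dil t s l p) ψ)‖) :
    waveFrontSet ht' hs' φ v = Θ '' waveFrontSet ht hs ψ u := by
  have hΘ_iff : ∀ p, Θ p = 0 ↔ p = 0 := fun p => Θ.injective.eq_iff' hΘ
  ext p
  obtain ⟨p, rfl⟩ := Θ.surjective p
  rw [Θ.injective.mem_set_image]
  refine ⟨fun hp => ?_, fun hp => ?_⟩
  · rw [← Θ.symm_apply_apply p]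
    refine mem_waveFrontSet_of_le ht hs ht' hs' hk.le Θ.symm.continuous.continuousAt ?_
      (fun l hl q => ?_) hp
    · rw [Θ.symm_apply_apply]
      exact fun hp0 => hp.1 ((hΘ_iff p).2 hp0)
    · rw [← h l hl, Θ.apply_symm_apply]
  · refine mem_waveFrontSet_of_le ht' hs' ht hs (inv_nonneg.2 hk.le) Θ.continuous.continuousAt
      (fun hp0 => hp.1 ((hΘ_iff p).1 hp0)) (fun l hl q => ?_) hp
    rw [h l hl, inv_mul_cancel_left₀ hk.ne']

/-! ### Fourier transforms of ultradistributions -/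

/-- The Fourier transform as an isomorphism from `Σ_t^s(ℝᵈ)` onto `Σ_s^t(ℝᵈ)`. -/
def gsFourier {t s : ℝ} (ht : 0 < t) (hs : 0 < s) (hst : 1 < s + t) :
    GSSpace d t s ≃ₗ[ℂ] GSSpace d s t where
  toFun f := ⟨fourierFun f.1, fourierFun_mem_gsSpace ht hs.le hst f.2⟩
  invFun g := ⟨fun x => fourierFun g.1 (-x),
    compLin_mem_gsSpace (M := -.id ℝ (E d)) (N := -.id ℝ (E d)) ht.le hs.le neg_neg
      (fourierFun_mem_gsSpace hs ht.le (by rwa [add_comm]) g.2)⟩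
  map_add' f g := Subtype.ext <| funext <|
    fourierFun_add (integrable_of_mem_gsSpace ht f.2) (integrable_of_mem_gsSpace ht g.2)
  map_smul' c f := Subtype.ext <| funext <| fourierFun_smul c f.1
  left_inv f := Subtype.ext <| funext <|
    fourierFun_fourierFun_neg_of_mem_gsSpace ht hs hst f.2
  right_inv g := Subtype.ext <| funext fun ξ => (fourierFun_comp_neg _ ξ).trans <|
    fourierFun_fourierFun_neg_of_mem_gsSpace hs ht (by rwa [add_comm]) g.2 ξ

lemma isFourierTransform_iff {t s : ℝ} (ht : 0 < t) (hs : 0 < s) (hst : 1 < s + t)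
    {u : GSDual d t s} {v : GSDual d s t} :
    IsFourierTransform u v ↔ ∀ f, v.pair (gsFourier ht hs hst f) = u.pair f :=
  ⟨fun h f => (h f).2, fun h f => ⟨(gsFourier ht hs hst f).2, h f⟩⟩

lemma existsUnique_isFourierTransform {t s : ℝ} (ht : 0 < t) (hs : 0 < s) (hst : 1 < s + t)
    (u : GSDual d t s) : ∃! v : GSDual d s t, IsFourierTransform u v := by
  simp only [isFourierTransform_iff ht hs hst]
  set T := gsFourier (d := d) ht hs hst
  obtain ⟨h, C, hh, hC, pair_le⟩ := u.exists_norm_pair_le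
  obtain ⟨h', K, hh', hK, bound⟩ := exists_gsBound_of_fourierSm (d := d) ht hs hst hh
  obtain ⟨v, hv⟩ : ∃ v : GSDual d s t, ∀ g, v.pair g = u.pair (T.symm g) := by
    refine GSDual.exists_pair_eq (u.1.comp T.symm.toLinearMap)
      ⟨h', C * K, hh', by positivity, fun g B hB hg => ?_⟩
    obtain ⟨f, rfl⟩ := T.surjective g
    rw [LinearMap.comp_apply, LinearEquiv.coe_coe, T.symm_apply_apply, mul_assoc]
    exact pair_le f _ (by positivity) (bound (toSm f) f.2 B hB hg)
  refine ⟨v, fun f => ?_, fun w hw => GSDual.ext_pair fun g => ?_⟩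
  · rw [hv, T.symm_apply_apply]
  · rw [hv, ← hw, T.apply_symm_apply]

lemma GSDual.pair_smul {t s : ℝ} (u : GSDual d t s) (c : ℂ) (f : GSSpace d t s) :
    u.pair (c • f) = (starRingEnd ℂ) c * u.pair f :=
  u.1.map_smulₛₗ c f

lemma gsFourier_gsShift {t s : ℝ} (ht : 0 < t) (hs : 0 < s) (hst : 1 < s + t)
    (ψ : GSSpace d t s) (z : E d × E d) :
    gsFourier ht hs hst (gsShift ht hs z ψ) = Complex.exp (Complex.I * (inner ℝ z.1 z.2 : ℝ)) •
      gsShift hs ht (symplecticJ z) (gsFourier ht hs hst ψ) := by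
  ext η
  change fourierFun (timeFreqShift z.1 z.2 ψ.1) η =
    Complex.exp (Complex.I * (inner ℝ z.1 z.2 : ℝ)) *
      (Complex.exp (Complex.I * (inner ℝ η (-z.1) : ℝ)) * fourierFun ψ.1 (η - z.2))
  rw [fourierFun_timeFreqShift, ← mul_assoc, ← Complex.exp_add, inner_sub_right, inner_neg_right,
    real_inner_comm η z.1]
  congr 2
  push_cast
  ring

lemma IsFourierTransform.norm_pair_gsShift {t s : ℝ} (ht : 0 < t) (hs : 0 < s)
    (hst : 1 < s + t) {u : GSDual d t s} {v : GSDual d s t} (huv : IsFourierTransform u v)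
    (ψ : GSSpace d t s) (z : E d × E d) :
    ‖v.pair (gsShift hs ht (symplecticJ z) (gsFourier ht hs hst ψ))‖ =
      ‖u.pair (gsShift ht hs z ψ)‖ := by
  rw [← (isFourierTransform_iff ht hs hst).1 huv, gsFourier_gsShift, GSDual.pair_smul, norm_mul,
    RCLike.norm_conj, mul_comm Complex.I, Complex.norm_exp_ofReal_mul_I, one_mul]

/-- The symplectic matrix `J` as a homeomorphism of phase space. -/
def symplecticJHomeomorph (d : ℕ) : (E d × E d) ≃ₜ (E d × E d) where
  toFun := symplecticJ
  invFun z := (-z.2, z.1)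
  left_inv z := by simp [symplecticJ]
  right_inv z := by simp [symplecticJ]
  continuous_toFun := continuous_snd.prodMk continuous_fst.neg
  continuous_invFun := continuous_snd.neg.prodMk continuous_fst

lemma dil_symplecticJ (t s l : ℝ) (z : E d × E d) :
    dil s t l (symplecticJ z) = symplecticJ (dil t s l z) :=
  Prod.ext rfl (smul_neg _ _)

lemma IsFourierTransform.waveFrontSet_eq_image {t s : ℝ} (ht : 0 < t) (hs : 0 < s)
    (hst : 1 < s + t) {u : GSDual d t s} {v : GSDual d s t} (huv : IsFourierTransform u v)
    {ψ : GSSpace d t s} (hψ : ψ ≠ 0) {φ : GSSpace d s t} (hφ : φ ≠ 0) :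
    waveFrontSet hs ht φ v = symplecticJ '' waveFrontSet ht hs ψ u := by
  rw [waveFrontSet_eq hs ht (by rwa [add_comm]) v
    ((gsFourier ht hs hst).map_ne_zero_iff.2 hψ) hφ]
  refine GelfandShilov.waveFrontSet_eq_image ht hs hs ht one_pos (symplecticJHomeomorph d)
    (Prod.ext rfl neg_zero) fun l _ z => ?_
  change ‖v.pair (gsShift hs ht (dil s t l (symplecticJ z)) _)‖ = _
  rw [dil_symplecticJ, huv.norm_pair_gsShift, one_mul]

/-! ### Linear changes of variables of ultradistributions -/

lemma matAct_eq_toEuclideanCLM (A : Matrix (Fin d) (Fin d) ℝ) :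
    matAct A = Matrix.toEuclideanCLM (𝕜 := ℝ) A := rfl

lemma continuous_matAct (A : Matrix (Fin d) (Fin d) ℝ) : Continuous (matAct A) :=
  (Matrix.toEuclideanCLM (𝕜 := ℝ) A).continuous

lemma matAct_mul (A B : Matrix (Fin d) (Fin d) ℝ) (x : E d) :
    matAct (A * B) x = matAct A (matAct B x) := by
  simp only [matAct_eq_toEuclideanCLM, map_mul, mul_apply_eq_comp]

lemma matAct_one (x : E d) : matAct 1 x = x := by
  rw [matAct_eq_toEuclideanCLM, map_one, one_apply_eq_self]

lemma inner_matAct (A : Matrix (Fin d) (Fin d) ℝ) (x y : E d) :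
    (inner ℝ (matAct A x) y : ℝ) = inner ℝ x (matAct A.transpose y) := by
  simp only [matAct, EuclideanSpace.inner_eq_star_dotProduct, star_trivial]
  rw [Matrix.mulVec_transpose, Matrix.dotProduct_mulVec]

lemma matAct_inv_matAct (A : Matrix.GeneralLinearGroup (Fin d) ℝ) (x : E d) :
    matAct (A⁻¹).1 (matAct A.1 x) = x := by
  rw [← matAct_mul, A.inv_mul, matAct_one]

lemma matAct_transpose_inv_matAct_transpose (A : Matrix.GeneralLinearGroup (Fin d) ℝ) (x : E d) :
    matAct (A⁻¹).1.transpose (matAct A.1.transpose x) = x := by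
  rw [← matAct_mul, ← Matrix.transpose_mul, A.mul_inv, Matrix.transpose_one, matAct_one]

lemma symplecticDiag_inv_symplecticDiag (A : Matrix.GeneralLinearGroup (Fin d) ℝ)
    (z : E d × E d) : symplecticDiag A⁻¹ (symplecticDiag A z) = z := by
  refine Prod.ext ?_ (matAct_transpose_inv_matAct_transpose A z.2)
  exact matAct_inv_matAct A⁻¹ z.1

lemma continuous_symplecticDiag (A : Matrix.GeneralLinearGroup (Fin d) ℝ) :
    Continuous (symplecticDiag A) :=
  ((continuous_matAct _).comp continuous_fst).prodMk ((continuous_matAct _).comp continuous_snd)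

/-- The block diagonal matrix `diag(A⁻¹, Aᵀ)` as a homeomorphism of phase space. -/
def symplecticDiagHomeomorph (A : Matrix.GeneralLinearGroup (Fin d) ℝ) :
    (E d × E d) ≃ₜ (E d × E d) where
  toFun := symplecticDiag A
  invFun := symplecticDiag A⁻¹
  left_inv := symplecticDiag_inv_symplecticDiag A
  right_inv := symplecticDiag_inv_symplecticDiag A⁻¹
  continuous_toFun := continuous_symplecticDiag A
  continuous_invFun := continuous_symplecticDiag A⁻¹

lemma dil_symplecticDiag (t s l : ℝ) (A : Matrix.GeneralLinearGroup (Fin d) ℝ) (z : E d × E d) :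
    dil t s l (symplecticDiag A z) = symplecticDiag A (dil t s l z) := by
  simp only [dil, symplecticDiag, matAct_eq_toEuclideanCLM, map_smul]

/-- The change of variables `f ↦ f(A⁻¹ ·)` of `Σ_t^s(ℝᵈ)`. -/
def gsCompInv {t s : ℝ} (ht : 0 < t) (hs : 0 < s) (A : Matrix.GeneralLinearGroup (Fin d) ℝ) :
    GSSpace d t s →ₗ[ℂ] GSSpace d t s where
  toFun f := ⟨fun x => f.1 (matAct (A⁻¹).1 x),
    compLin_mem_gsSpace (M := Matrix.toEuclideanCLM (𝕜 := ℝ) (A⁻¹).1)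
      (N := Matrix.toEuclideanCLM (𝕜 := ℝ) A.1) ht.le hs.le (matAct_inv_matAct A⁻¹) f.2⟩
  map_add' _ _ := rfl
  map_smul' _ _ := rfl

lemma gsCompInv_injective {t s : ℝ} (ht : 0 < t) (hs : 0 < s)
    (A : Matrix.GeneralLinearGroup (Fin d) ℝ) : Function.Injective (gsCompInv ht hs A) := by
  intro f g hfg
  ext x
  have hx : f.1 (matAct (A⁻¹).1 (matAct A.1 x)) = g.1 (matAct (A⁻¹).1 (matAct A.1 x)) :=
    congrFun (congrArg Subtype.val hfg) _
  rwa [matAct_inv_matAct] at hx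

lemma isDilation_iff {t s : ℝ} (ht : 0 < t) (hs : 0 < s) {c : ℂ}
    {A : Matrix.GeneralLinearGroup (Fin d) ℝ} {u v : GSDual d t s} : IsDilation c A u v ↔
      ∀ f, v.pair f = c * ((|A.1.det|⁻¹ : ℝ) : ℂ) * u.pair (gsCompInv ht hs A f) :=
  ⟨fun h f => (h f).2, fun h f => ⟨(gsCompInv ht hs A f).2, h f⟩⟩

lemma existsUnique_isDilation {t s : ℝ} (ht : 0 < t) (hs : 0 < s) (c : ℂ)
    (A : Matrix.GeneralLinearGroup (Fin d) ℝ) (u : GSDual d t s) :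
    ∃! v : GSDual d t s, IsDilation c A u v := by
  simp only [isDilation_iff ht hs]
  obtain ⟨h, C, hh, hC, pair_le⟩ := u.exists_norm_pair_le
  obtain ⟨h', hh', bound⟩ := exists_gsBound_compLin ht.le hs.le
    (Matrix.toEuclideanCLM (𝕜 := ℝ) (A⁻¹).1) (Matrix.toEuclideanCLM (𝕜 := ℝ) A.1)
    (matAct_inv_matAct A⁻¹) hh
  set k : ℂ := c * ((|A.1.det|⁻¹ : ℝ) : ℂ)
  obtain ⟨v, hv⟩ : ∃ v : GSDual d t s, ∀ f, v.pair f = k * u.pair (gsCompInv ht hs A f) := by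
    refine GSDual.exists_pair_eq (k • u.1.comp (gsCompInv ht hs A))
      ⟨h', ‖k‖ * C, hh', by positivity, fun f B hB hf => ?_⟩
    change ‖k * u.pair (gsCompInv ht hs A f)‖ ≤ _
    rw [norm_mul, mul_assoc]
    gcongr
    exact pair_le _ _ hB (bound (toSm f) B hB hf)
  exact ⟨v, hv, fun w hw => GSDual.ext_pair fun f => (hw f).trans (hv f).symm⟩

lemma gsCompInv_gsShift {t s : ℝ} (ht : 0 < t) (hs : 0 < s)
    (A : Matrix.GeneralLinearGroup (Fin d) ℝ) (φ : GSSpace d t s) (z : E d × E d) :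
    gsCompInv ht hs A (gsShift ht hs (symplecticDiag A z) φ) =
      gsShift ht hs z (gsCompInv ht hs A φ) := by
  ext y
  change Complex.exp (Complex.I * (inner ℝ (matAct (A⁻¹).1 y) (matAct A.1.transpose z.2) : ℝ)) *
      φ.1 (matAct (A⁻¹).1 y - matAct (A⁻¹).1 z.1) =
    Complex.exp (Complex.I * (inner ℝ y z.2 : ℝ)) * φ.1 (matAct (A⁻¹).1 (y - z.1))
  rw [inner_matAct, matAct_transpose_inv_matAct_transpose, matAct_eq_toEuclideanCLM, map_sub]

lemma IsDilation.norm_pair_gsShift {t s : ℝ} (ht : 0 < t) (hs : 0 < s) {c : ℂ}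
    {A : Matrix.GeneralLinearGroup (Fin d) ℝ} {u v : GSDual d t s} (huv : IsDilation c A u v)
    (φ : GSSpace d t s) (z : E d × E d) :
    ‖v.pair (gsShift ht hs (symplecticDiag A z) φ)‖ =
      ‖c‖ * |A.1.det|⁻¹ * ‖u.pair (gsShift ht hs z (gsCompInv ht hs A φ))‖ := by
  rw [(isDilation_iff ht hs).1 huv, gsCompInv_gsShift, norm_mul, norm_mul, Complex.norm_real,
    Real.norm_of_nonneg (by positivity)]

lemma IsDilation.waveFrontSet_eq_image {t s : ℝ} (ht : 0 < t) (hs : 0 < s) (hst : 1 < s + t)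
    {c : ℂ} (hc : c ≠ 0) {A : Matrix.GeneralLinearGroup (Fin d) ℝ} {u v : GSDual d t s}
    (huv : IsDilation c A u v) {ψ φ : GSSpace d t s} (hψ : ψ ≠ 0) (hφ : φ ≠ 0) :
    waveFrontSet ht hs φ v = symplecticDiag A '' waveFrontSet ht hs ψ u := by
  have compInv_ne_zero : gsCompInv ht hs A φ ≠ 0 :=
    (map_ne_zero_iff _ (gsCompInv_injective ht hs A)).2 hφ
  have factor_pos : 0 < ‖c‖ * |A.1.det|⁻¹ :=
    mul_pos (norm_pos_iff.2 hc) (inv_pos.2 (abs_pos.2 A.det_ne_zero))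
  rw [← waveFrontSet_eq ht hs hst u hψ compInv_ne_zero]
  refine GelfandShilov.waveFrontSet_eq_image ht hs ht hs factor_pos (symplecticDiagHomeomorph A)
    (Prod.ext (map_zero (Matrix.toEuclideanCLM (𝕜 := ℝ) (A⁻¹).1))
      (map_zero (Matrix.toEuclideanCLM (𝕜 := ℝ) A.1.transpose))) fun l _ z => ?_
  change ‖v.pair (gsShift ht hs (dil t s l (symplecticDiag A z)) φ)‖ = _
  rw [dil_symplecticDiag, huv.norm_pair_gsShift]

end GelfandShilov

end

theorem proposition3p6_general {d : ℕ} {t s : ℝ} (ht : 0 < t) (hs : 0 < s) (hst : 1 < s + t)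
    (u : GSDual d t s) :
    ((∃! v : GSDual d s t, IsFourierTransform u v) ∧
      ∀ v : GSDual d s t, IsFourierTransform u v →
        ∀ ψ : GSSpace d t s, ψ ≠ 0 → ∀ φ : GSSpace d s t, φ ≠ 0 →
          waveFrontSet hs ht φ v = symplecticJ '' waveFrontSet ht hs ψ u) ∧
    ∀ (A : Matrix.GeneralLinearGroup (Fin d) ℝ) (c : ℂ),
      (∃! v : GSDual d t s, IsDilation c A u v) ∧
      (c ≠ 0 → ∀ v : GSDual d t s, IsDilation c A u v →
        ∀ ψ : GSSpace d t s, ψ ≠ 0 → ∀ φ : GSSpace d t s, φ ≠ 0 →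
          waveFrontSet ht hs φ v = symplecticDiag A '' waveFrontSet ht hs ψ u) :=
  ⟨⟨existsUnique_isFourierTransform ht hs hst u,
    fun _ huv _ hψ _ hφ => huv.waveFrontSet_eq_image ht hs hst hψ hφ⟩,
    fun A c => ⟨existsUnique_isDilation ht hs c A u,
      fun hc _ huv _ hψ _ hφ => huv.waveFrontSet_eq_image ht hs hst hc hψ hφ⟩⟩

theorem proposition3p6 {d : ℕ} {t s : ℝ} (ht : 0 < t) (hs : 0 < s) (hst : 1 < s + t)
    (u : GSDual d t s) :
    ((∃! v : GSDual d s t, IsFourierTransform u v) ∧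
      ∀ v : GSDual d s t, IsFourierTransform u v →
        ∀ ψ : GSSpace d t s, ψ ≠ 0 → ∀ φ : GSSpace d s t, φ ≠ 0 →
          waveFrontSet hs ht φ v = symplecticJ '' waveFrontSet ht hs ψ u) ∧
    ∀ (A : Matrix.GeneralLinearGroup (Fin d) ℝ) (c : ℂ), ‖c‖ = |A.1.det| ^ (1 / 2 : ℝ) →
      (∃! v : GSDual d t s, IsDilation c A u v) ∧
      ∀ v : GSDual d t s, IsDilation c A u v →
        ∀ ψ : GSSpace d t s, ψ ≠ 0 → ∀ φ : GSSpace d t s, φ ≠ 0 →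
          waveFrontSet ht hs φ v = symplecticDiag A '' waveFrontSet ht hs ψ u := by
  refine (proposition3p6_general ht hs hst u).imp_right fun h A c hc => (h A c).imp_right (· ?_)
  exact norm_pos_iff.1 (hc ▸ Real.rpow_pos_of_pos (abs_pos.2 A.det_ne_zero) _)
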